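/- Setting. Let $A=\mathbb F_q[\theta]$, $K=\mathbb F_q(\theta)$ with the absolute value at infinity ($|\theta|=q$), $K_\infty$ its completion, $\mathbb C_\infty$ the completion of an algebraic closure of $K_\infty$, $\Omega=\mathbb C_\infty\setminus K_\infty$, and $|z|_i=\inf_{a\in K_\infty}|z-a|$. A function $f:\Omega\to\mathbb C_\infty$ is holomorphic if on every $\Omega_n=\{z\in\Omega: |z|\le q^n,\ |z|_i\ge q^{-n}\}$, $n\ge1$, it is a uniform limit of rational functions without poles in $\Omega_n$; it is bounded on vertical lines if there are $R,N>0$ with $|f(z)|<N$ whenever $|z|_i>R$. Let $\sigma$ be the automorphism $\sum a_i\theta^{-i}\mapsto\sum a_i^q\theta^{-i}$ of $\overline{\mathbb F}_q((1/\theta))=\widehat{K_\infty^{\rm nr}}\subset\mathbb C_\infty$, let $\psi$ be a continuous $K_\infty$-automorphism of $\mathbb C_\infty$ extending $\sigma$, let $M$ be a field with $\widehat{K_\infty^{\rm nr}}\subseteq M\subseteq\mathbb C_\infty$, and put $\Omega^\psi(M)=\{z\in M:\psi(z)\ne z\}\subseteq\Omega$. Let $\exp_C(z)=\sum_{i\ge0}z^{q^i}/\prod_{j<i}(\theta^{q^i}-\theta^{q^j})$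 be the Carlitz exponential, $\tilde\pi=\theta(-\theta)^{1/(q-1)}\prod_{i\ge1}(1-\theta^{1-q^i})^{-1}$ the Carlitz period (for a fixed $(q-1)$-st root of $-\theta$), and $u_N(z)=\exp_C(\tilde\pi z/N)^{-1}$ for $0\neq N\in A$. For a holomorphic $f$ let $\partial^n f=\tilde\pi^{-n}\mathcal D^nf$, where $f(z+\epsilon)=\sum_{n\ge0}(\mathcal D^nf)(z)\epsilon^n$ for small $\epsilon$. For $\gamma=\begin{pmatrix}a&b\\c&d\end{pmatrix}\in\mathrm{GL}_2(K)$ and integers $k,m$ put $(G|_{k,m}\gamma)(z)=\det(\gamma)^m(cz+d)^{-k}G\big(\tfrac{az+b}{cz+d}\big)$ for $G:\Omega^\psi(M)\to\mathbb C_\infty$. Write $X(z)=(\tilde\pi z-\tilde\pi\psi(z))^{-1}$ for $z\in\Omega^\psi(M)$. Modular forms. Let $\Gamma\le\mathrm{GL}_2(A)$ be a congruence subgroup, and let $m_\Gamma$ be the monic generator of the largest ideal $J$ of $A$ with $\begin{pmatrix}1&a\\0&1\end{pmatrix}\in\Gamma$ for all $a\in J$. A nearly holomorphic Drinfeld modular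 form of weight $k\in\mathbb Z_{\ge0}$, type $m\in\mathbb Z/(q-1)\mathbb Z$ and depth at most $s$ for $\Gamma$ is a continuous $G:\Omega^\psi(M)\to\mathbb C_\infty$ such that (i) $G|_{k,m}\gamma=G$ for $\gamma\in\Gamma$; (ii) $G=\sum_{i=0}^sf_iX^i$ with $f_i$ holomorphic on $\Omega$ and bounded on vertical lines; (iii) for each $\gamma\in\mathrm{GL}_2(A)$ there are $a_{\gamma,i,\ell}\in\mathbb C_\infty$ with $(G|_{k,m}\gamma)(z)=\sum_{i=0}^sX(z)^i\sum_{\ell\ge0}a_{\gamma,i,\ell}\,u_{m_{\gamma^{-1}\Gamma\gamma}}(z)^\ell$ for all $z\in\Omega^\psi(M)$ with $|u_{m_{\gamma^{-1}\Gamma\gamma}}(z)|$ sufficiently small. For a field $K\subseteq L\subseteq\mathbb C_\infty$, $\mathcal N_k^{m,\le s}(\Gamma;L)$ is the set of those $G$ for which the $u_{m_\Gamma}$-expansions of the $f_i$ have coefficients in $L$. Statement. For $k,r\ge0$ there is a well-defined operator $\delta_k^r$ on the functions $\sum_{i=0}^sf_iX^i$ on $\Omega^\psi(M)$ ($s\ge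 0$, $f_i$ holomorphic on $\Omega$), given by $$\delta_k^r\Big(\sum_{i=0}^sf_iX^i\Big)=\sum_{i=0}^s\sum_{j=0}^r\binom{k-i+r-1}{j}\,(\partial^{r-j}f_i)\,X^{i+j},$$ where $\binom{x}{j}=x(x-1)\cdots(x-j+1)/j!$ (so $\delta_k^0=\mathrm{Id}$). For every $\gamma\in\mathrm{GL}_2(K)$, every holomorphic $f:\Omega\to\mathbb C_\infty$, all integers $m$ and all integers $k,\mu,r\ge0$ with $k\ge2\mu$, $$\delta_k^r(fX^\mu)\big|_{k+2r,\,m+r}\gamma=\delta_k^r\big((fX^\mu)|_{k,m}\gamma\big).$$ Moreover, for every field $K\subseteq L\subseteq\mathbb C_\infty$, every congruence subgroup $\Gamma$, all $k,r,s\ge0$ and all $m$, if $G\in\mathcal N_k^{m,\le s}(\Gamma;L)$ then $\delta_k^r(G)\in\mathcal N_{k+2r}^{m+r,\le s+r}(\Gamma;L)$. -/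

import Mathlib

open Polynomial Topology Filter

noncomputable section

namespace DrinfeldMS

/-! ### The fields `K = 𝔽_q(θ)`, `K_∞` and `ℂ_∞` -/

section Fields

variable (F : Type*) [Field F] [Fintype F]

/-- The number `q` of elements of the constant field `𝔽_q = F`. -/
abbrev q : ℕ := Fintype.card F

theorem one_lt_q : 1 < q F := Fintype.one_lt_card

open Classical in
/-- The absolute value `|·|_∞` on `K = 𝔽_q(θ)`: `|x| = q ^ deg x`, in particular `|θ| = q`. -/
def inftyAbs : AbsoluteValue (RatFunc F) ℝ where
  toFun x := if x = 0 then 0 else (q F : ℝ) ^ x.intDegree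
  map_mul' x y := by
    have hq : (q F : ℝ) ≠ 0 := by exact_mod_cast (zero_lt_one.trans (one_lt_q F)).ne'
    by_cases hx : x = 0
    · simp [hx]
    by_cases hy : y = 0
    · simp [hy]
    simp [hx, hy, RatFunc.intDegree_mul hx hy, zpow_add₀ hq]
  nonneg' x := by
    split_ifs <;> positivity
  eq_zero' x := by
    have hq : (q F : ℝ) ≠ 0 := by exact_mod_cast (zero_lt_one.trans (one_lt_q F)).ne'
    by_cases hx : x = 0
    · simp [hx]
    · simp [hx, zpow_ne_zero _ hq]
  add_le' x y := by
    have hq : (1 : ℝ) ≤ q F := by exact_mod_cast (one_lt_q F).le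
    by_cases hx : x = 0
    · simp [hx]
    by_cases hy : y = 0
    · simp [hy]
    by_cases hxy : x + y = 0
    · simp only [hxy, if_true, hx, hy, if_false]; positivity
    simp only [hx, hy, hxy, if_false]
    have h := RatFunc.intDegree_add_le hy hxy
    rcases le_max_iff.1 h with h | h
    · exact (zpow_le_zpow_right₀ hq h).trans (le_add_of_nonneg_right (by positivity))
    · exact (zpow_le_zpow_right₀ hq h).trans (le_add_of_nonneg_left (by positivity))

theorem inftyAbs_apply {x : RatFunc F} (hx : x ≠ 0) :
    inftyAbs F x = (q F : ℝ) ^ x.intDegree := by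
  simp [inftyAbs, hx]

theorem inftyAbs_add_le (x y : RatFunc F) :
    inftyAbs F (x + y) ≤ max (inftyAbs F x) (inftyAbs F y) := by
  have hq : (1 : ℝ) ≤ q F := by exact_mod_cast (one_lt_q F).le
  by_cases hx : x = 0
  · simp [hx]
  by_cases hy : y = 0
  · simp [hy]
  by_cases hxy : x + y = 0
  · rw [hxy, map_zero]
    exact le_max_of_le_left ((inftyAbs F).nonneg x)
  rw [inftyAbs_apply F hx, inftyAbs_apply F hy, inftyAbs_apply F hxy]
  rcases le_max_iff.1 (RatFunc.intDegree_add_le hy hxy) with h | h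
  · exact le_max_of_le_left (zpow_le_zpow_right₀ hq h)
  · exact le_max_of_le_right (zpow_le_zpow_right₀ hq h)

/-- `K_∞ = 𝔽_q((1/θ))`, the completion of `K` at the infinite place. -/
abbrev Kinf := (inftyAbs F).Completion

/-- The embedding `K → K_∞`. -/
def ratToKinf : RatFunc F →+* Kinf F :=
  (UniformSpace.Completion.coeRingHom (α := WithAbs (inftyAbs F))).comp
    (WithAbs.equiv (inftyAbs F)).symm.toRingHom

theorem norm_ratToKinf (x : RatFunc F) : ‖ratToKinf F x‖ = inftyAbs F x :=
  UniformSpace.Completion.norm_coe _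

instance : IsUltrametricDist (Kinf F) :=
  IsUltrametricDist.isUltrametricDist_of_forall_norm_add_le_max_norm fun x y => by
    induction x, y using UniformSpace.Completion.induction_on₂ with
    | hp => exact isClosed_le (by fun_prop) (by fun_prop)
    | ih a b =>
      rw [← UniformSpace.Completion.coe_add]
      simp only [UniformSpace.Completion.norm_coe]
      exact inftyAbs_add_le F a.ofAbs b.ofAbs

instance : NontriviallyNormedField (Kinf F) where
  non_trivial := ⟨ratToKinf F RatFunc.X, by
    rw [norm_ratToKinf, inftyAbs_apply F RatFunc.X_ne_zero, RatFunc.intDegree_X, zpow_one]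
    exact_mod_cast one_lt_q F⟩

/-- An algebraic closure of `K_∞`, with the unique extension of the absolute value. -/
abbrev Kbar := AlgebraicClosure (Kinf F)

instance : NormedField (Kbar F) := spectralNorm.normedField (Kinf F) (Kbar F)

/-- `ℂ_∞`, the completion of the algebraic closure of `K_∞`. -/
abbrev Cinf := UniformSpace.Completion (Kbar F)

/-- The embedding `K_∞ → ℂ_∞`. -/
def ofKinf : Kinf F →+* Cinf F :=
  (UniformSpace.Completion.coeRingHom (α := Kbar F)).comp (algebraMap (Kinf F) (Kbar F))

theorem norm_ofKinf (x : Kinf F) : ‖ofKinf F x‖ = ‖x‖ :=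
  (UniformSpace.Completion.norm_coe _).trans (spectralNorm_extends x)

/-- The embedding `K → ℂ_∞`. -/
def ofK : RatFunc F →+* Cinf F := (ofKinf F).comp (ratToKinf F)

/-- The embedding `A = 𝔽_q[θ] → ℂ_∞`. -/
def ofA : F[X] →+* Cinf F := (ofK F).comp (algebraMap F[X] (RatFunc F))

/-- The embedding `𝔽_q → ℂ_∞`. -/
def ofFq : F →+* Cinf F := (ofA F).comp C

/-- The element `θ` of `ℂ_∞`. -/
def theta : Cinf F := ofA F X

/-- The algebraic closure of `𝔽_q` in `ℂ_∞`. -/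
def fqBar : Set (Cinf F) := {x | (ofFq F).IsIntegralElem x}

/-- The completion of the maximal unramified extension `K_∞ · 𝔽̄_q` of `K_∞`, inside `ℂ_∞`. -/
def knrHat : Subfield (Cinf F) :=
  (Subfield.closure (Set.range (ofKinf F) ∪ fqBar F)).topologicalClosure

/-- An extension `ψ` of the Frobenius map `σ`: a continuous automorphism of the field `ℂ_∞` over
`K_∞` with `ψ (∑ aᵢ θ⁻ⁱ) = ∑ aᵢ^q θ⁻ⁱ` for all Laurent series in `1/θ` with coefficients
in `𝔽̄_q`. -/
structure SigmaExtension where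
  /-- the underlying automorphism -/
  toRingEquiv : Cinf F ≃+* Cinf F
  continuous_toRingEquiv : Continuous toRingEquiv
  map_kinf : ∀ x : Kinf F, toRingEquiv (ofKinf F x) = ofKinf F x
  map_series : ∀ (n : ℤ) (a : ℕ → Cinf F), (∀ i, a i ∈ fqBar F) →
    toRingEquiv (∑' i : ℕ, a i * theta F ^ (n - (i : ℤ))) =
      ∑' i : ℕ, a i ^ q F * theta F ^ (n - (i : ℤ))

instance : CoeFun (SigmaExtension F) fun _ => Cinf F → Cinf F := ⟨fun ψ => ψ.toRingEquiv⟩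

end Fields

variable {F : Type*} [Field F] [Fintype F]

/-! ### The Drinfeld upper half plane and holomorphic functions -/

variable (F) in
/-- `Ω = ℂ_∞ ∖ K_∞`. -/
def Omega : Set (Cinf F) := (Set.range (ofKinf F))ᶜ

/-- `|z|_i = inf {|z - a| : a ∈ K_∞}`. -/
def imNorm (z : Cinf F) : ℝ := Metric.infDist z (Set.range (ofKinf F))

variable (F) in
/-- The affinoid `Ω_n = {z : |z| ≤ q ^ n, |z|_i ≥ q ^ (-n)}`. -/
def affinoid (n : ℕ) : Set (Cinf F) :=
  {z | z ∈ Omega F ∧ ‖z‖ ≤ (q F : ℝ) ^ n ∧ ((q F : ℝ) ^ n)⁻¹ ≤ imNorm z}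

/-- `f` is holomorphic on `Ω`: on each `Ω_n` with `n ≥ 1` it is a uniform limit of rational
functions without poles in `Ω_n`. (Values of `f` outside `Ω` are irrelevant.) -/
def IsHolomorphic (f : Cinf F → Cinf F) : Prop :=
  ∀ n : ℕ, 1 ≤ n → ∀ ε : ℝ, 0 < ε → ∃ P Q : (Cinf F)[X],
    ∀ z ∈ affinoid F n, Q.eval z ≠ 0 ∧ ‖f z - P.eval z / Q.eval z‖ < ε

/-- `f` is bounded on vertical lines. -/
def IsBoundedOnVerticalLines (f : Cinf F → Cinf F) : Prop :=
  ∃ R N : ℝ, 0 < R ∧ 0 < N ∧ ∀ z ∈ Omega F, R < imNorm z → ‖f z‖ < N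

open Classical in
/-- The `n`-th hyperderivative `𝒟ⁿ f`, that is, the `n`-th coefficient of the expansion
`f (z + ε) = ∑ (𝒟ⁿ f)(z) εⁿ` for all small `ε`. -/
def hyperderiv (n : ℕ) (f : Cinf F → Cinf F) (z : Cinf F) : Cinf F :=
  if h : ∃ c : ℕ → Cinf F, ∀ᶠ ε in 𝓝 (0 : Cinf F),
      HasSum (fun i : ℕ => c i * ε ^ i) (f (z + ε)) then h.choose n else 0

/-! ### The Carlitz exponential, the Carlitz period and the parameter `u_N` -/

variable (F) in
/-- `D_i = ∏_{j < i} (θ^(q^i) - θ^(q^j))`. -/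
def carlitzD (i : ℕ) : Cinf F :=
  ∏ j ∈ Finset.range i, (theta F ^ (q F ^ i) - theta F ^ (q F ^ j))

/-- The exponential `exp_C (z) = ∑ z^(q^i) / D_i` of the Carlitz module `C_θ = θ + τ`. -/
def carlitzExp (z : Cinf F) : Cinf F := ∑' i : ℕ, z ^ (q F ^ i) / carlitzD F i

/-- The Carlitz period `π̃ = θ (-θ)^(1/(q-1)) ∏_{i ≥ 1} (1 - θ^(1-q^i))⁻¹`, where `ρ` is the chosen
`(q-1)`-st root of `-θ`. -/
def carlitzPeriod (ρ : Cinf F) : Cinf F :=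
  theta F * ρ * ∏' i : ℕ, (1 - theta F ^ (1 - (q F : ℤ) ^ (i + 1)))⁻¹

/-- `u_N (z) = exp_C (π̃ z / N)⁻¹`. -/
def uParam (ρ : Cinf F) (N : F[X]) (z : Cinf F) : Cinf F :=
  (carlitzExp (carlitzPeriod ρ * z / ofA F N))⁻¹

/-- The normalized hyperderivative `∂ⁿ = π̃⁻ⁿ 𝒟ⁿ`. -/
def del (ρ : Cinf F) (n : ℕ) (f : Cinf F → Cinf F) (z : Cinf F) : Cinf F :=
  hyperderiv n f z / carlitzPeriod ρ ^ n

/-! ### Fractional linear transformations and the slash action -/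

/-- `j(γ; z) = c z + d`. -/
def jFactor (γ : GL (Fin 2) (RatFunc F)) (z : Cinf F) : Cinf F :=
  ofK F (γ.val 1 0) * z + ofK F (γ.val 1 1)

/-- `γ · z = (a z + b) / (c z + d)`. -/
def mobius (γ : GL (Fin 2) (RatFunc F)) (z : Cinf F) : Cinf F :=
  (ofK F (γ.val 0 0) * z + ofK F (γ.val 0 1)) / jFactor γ z

/-- A field `M` with `K_∞^nr,^ ⊆ M ⊆ ℂ_∞`. -/
abbrev NrExtension (F : Type*) [Field F] [Fintype F] :=
  {M : Subfield (Cinf F) // knrHat F ≤ M}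

/-- `Ω^ψ(M) = M ∖ M^ψ`. -/
def OmegaPsi (ψ : SigmaExtension F) (M : NrExtension F) : Set (Cinf F) :=
  {z | z ∈ M.1 ∧ ψ z ≠ z}

theorem ofKinf_mem (M : NrExtension F) (x : Kinf F) : ofKinf F x ∈ M.1 :=
  M.2 (Subfield.le_topologicalClosure _
    (Subfield.subset_closure (Set.mem_union_left _ (Set.mem_range_self x))))

theorem map_ofK (ψ : SigmaExtension F) (x : RatFunc F) : ψ (ofK F x) = ofK F x :=
  ψ.map_kinf _

theorem OmegaPsi_subset_Omega (ψ : SigmaExtension F) (M : NrExtension F) :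
    OmegaPsi ψ M ⊆ Omega F := by
  rintro z ⟨-, hz⟩ ⟨x, rfl⟩
  exact hz (ψ.map_kinf x)

theorem jFactor_ne_zero (γ : GL (Fin 2) (RatFunc F)) {z : Cinf F} (hz : z ∈ Omega F) :
    jFactor γ z ≠ 0 := by
  intro h
  have hdet : γ.val.det ≠ 0 := γ.isUnit.map Matrix.detMonoidHom |>.ne_zero
  rw [Matrix.det_fin_two] at hdet
  have hinj : Function.Injective (ofK F) := (ofK F).injective
  unfold jFactor at h
  by_cases hc : γ.val 1 0 = 0
  · rw [hc, map_zero, zero_mul, zero_add, map_eq_zero_iff _ hinj] at h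
    exact hdet (by rw [hc, h]; ring)
  · have hc' : ofK F (γ.val 1 0) ≠ 0 := by rwa [Ne, map_eq_zero_iff _ hinj]
    refine hz ⟨ratToKinf F (-(γ.val 1 1) / γ.val 1 0), ?_⟩
    change ofK F _ = z
    rw [map_div₀, map_neg, div_eq_iff hc']
    linear_combination -h

theorem mobius_mem (ψ : SigmaExtension F) (M : NrExtension F) (γ : GL (Fin 2) (RatFunc F))
    {z : Cinf F} (hz : z ∈ OmegaPsi ψ M) : mobius γ z ∈ OmegaPsi ψ M := by
  have hK : ∀ x : RatFunc F, ofK F x ∈ M.1 := fun x => ofKinf_mem M _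
  have hj := jFactor_ne_zero γ (OmegaPsi_subset_Omega ψ M hz)
  have hj' : ψ (jFactor γ z) ≠ 0 := by simpa using hj
  have hdet : γ.val.det ≠ 0 := γ.isUnit.map Matrix.detMonoidHom |>.ne_zero
  rw [Matrix.det_fin_two] at hdet
  have hdet' : ofK F (γ.val 0 0 * γ.val 1 1 - γ.val 0 1 * γ.val 1 0) ≠ 0 := by
    rwa [Ne, map_eq_zero_iff _ (ofK F).injective]
  refine ⟨div_mem (add_mem (mul_mem (hK _) hz.1) (hK _))
    (add_mem (mul_mem (hK _) hz.1) (hK _)), fun h => ?_⟩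
  unfold mobius at h
  rw [map_div₀, div_eq_div_iff hj' hj] at h
  unfold jFactor at h
  have hφ := map_ofK ψ
  simp only [map_add, map_mul, hφ] at h
  refine hz.2 (sub_eq_zero.1 ((mul_eq_zero.1 (?_ :
    ofK F (γ.val 0 0 * γ.val 1 1 - γ.val 0 1 * γ.val 1 0) * (ψ z - z) = 0)).resolve_left hdet'))
  simp only [map_sub, map_mul]
  linear_combination h

/-- The slash operator
`(f |_{k,m} γ)(z) = det(γ)^m j(γ;z)^(-k) f(γ · z)` on functions on `Ω^ψ(M)`. -/
def slash {ψ : SigmaExtension F} {M : NrExtension F} (k m : ℤ) (γ : GL (Fin 2) (RatFunc F))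
    (f : OmegaPsi ψ M → Cinf F) (z : OmegaPsi ψ M) : Cinf F :=
  ofK F γ.val.det ^ m * jFactor γ z ^ (-k) * f ⟨mobius γ z, mobius_mem ψ M γ z.2⟩

/-! ### Congruence subgroups of `Γ(1) = GL₂(A)` -/

/-- `Γ` is a congruence subgroup: it contains the principal congruence subgroup `Γ(𝔫)` for some
`𝔫 ∈ A` of positive degree. -/
def IsCongruenceSubgroup (Γ : Subgroup (GL (Fin 2) F[X])) : Prop :=
  ∃ n : F[X], 0 < n.natDegree ∧ ∀ γ : GL (Fin 2) F[X],
    n ∣ γ.val 0 0 - 1 → n ∣ γ.val 1 1 - 1 → n ∣ γ.val 0 1 → n ∣ γ.val 1 0 → γ ∈ Γ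

/-- The largest ideal `J` of `A` such that `Γ` contains all matrices `(1 a; 0 1)` with `a ∈ J`. -/
def cuspIdeal (Γ : Subgroup (GL (Fin 2) F[X])) : Ideal F[X] :=
  sSup {J | ∀ a ∈ J, ∃ γ ∈ Γ, γ.val = !![1, a; 0, 1]}

/-- `m_Γ`, the monic generator of the ideal above. -/
def cuspGen (Γ : Subgroup (GL (Fin 2) F[X])) : F[X] :=
  Submodule.IsPrincipal.generator (cuspIdeal Γ) *
    C (Submodule.IsPrincipal.generator (cuspIdeal Γ)).leadingCoeff⁻¹

/-- The inclusion `GL₂(A) → GL₂(K)`. -/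
def toGLK : GL (Fin 2) F[X] →* GL (Fin 2) (RatFunc F) :=
  Matrix.GeneralLinearGroup.map (algebraMap F[X] (RatFunc F))

/-- The conjugate `γ⁻¹ Γ γ`. -/
def conjSubgroup (Γ : Subgroup (GL (Fin 2) F[X])) (γ : GL (Fin 2) F[X]) :
    Subgroup (GL (Fin 2) F[X]) :=
  Γ.map (MulAut.conj γ⁻¹).toMonoidHom

/-! ### Nearly holomorphic Drinfeld modular forms and the Maass-Shimura operators -/

section Forms

variable {ψ : SigmaExtension F} {M : NrExtension F}

/-- The function `f / (π̃ Id - π̃ ψ)^μ` on `Ω^ψ(M)`. -/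
def nhTerm (ρ : Cinf F) (μ : ℕ) (f : Cinf F → Cinf F) (z : OmegaPsi ψ M) : Cinf F :=
  f z / (carlitzPeriod ρ * z - carlitzPeriod ρ * ψ z) ^ μ

/-- The function `∑_{i ≤ s} f_i / (π̃ Id - π̃ ψ)^i` on `Ω^ψ(M)`. -/
def nhSum (ρ : Cinf F) (s : ℕ) (f : ℕ → Cinf F → Cinf F) (z : OmegaPsi ψ M) : Cinf F :=
  ∑ i ∈ Finset.range (s + 1), nhTerm ρ i (f i) z

/-- `∑_{j ≤ r} binom(k - μ + r - 1, j) ∂^(r-j) f / (π̃ Id - π̃ ψ)^(μ+j)`. The binomial coefficient is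
the integer `x (x - 1) ⋯ (x - j + 1) / j!` at the integer `x = k - μ + r - 1`. -/
def msTerm (ρ : Cinf F) (k r μ : ℕ) (f : Cinf F → Cinf F) (z : OmegaPsi ψ M) : Cinf F :=
  ∑ j ∈ Finset.range (r + 1),
    ((Ring.choose ((k : ℤ) - μ + r - 1) j : ℤ) : Cinf F) * nhTerm ρ (μ + j) (del ρ (r - j) f) z

/-- `G` has the expansion `G = ∑_{i ≤ s} f_i / (π̃ Id - π̃ ψ)^i` with `f_i` holomorphic on `Ω`. -/
def HasExpansion (ρ : Cinf F) (G : OmegaPsi ψ M → Cinf F) (s : ℕ) (f : ℕ → Cinf F → Cinf F) :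
    Prop :=
  (∀ i ≤ s, IsHolomorphic (f i)) ∧ G = nhSum ρ s f

open Classical in
/-- The Maass-Shimura operator `δ_k^r`: if `G = ∑_{i ≤ s} f_i / (π̃ Id - π̃ ψ)^i` with `f_i`
holomorphic on `Ω`, then `δ_k^r G` is the sum of the functions
`∑_{j ≤ r} binom(k - i + r - 1, j) ∂^(r-j) f_i / (π̃ Id - π̃ ψ)^(i+j)`. -/
def maassShimura (ρ : Cinf F) (k r : ℕ) (G : OmegaPsi ψ M → Cinf F) : OmegaPsi ψ M → Cinf F :=
  if h : ∃ p : ℕ × (ℕ → Cinf F → Cinf F), HasExpansion ρ G p.1 p.2 then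
    fun z => ∑ i ∈ Finset.range (h.choose.1 + 1), msTerm ρ k r i (h.choose.2 i) z
  else 0

/-- `G` is a nearly holomorphic Drinfeld modular form of weight `k`, type (the class modulo `q - 1`
of) `m` and depth at most `s` for `Γ`. -/
structure IsNearlyHolomorphicForm (ρ : Cinf F) (k : ℕ) (m : ℤ) (s : ℕ)
    (Γ : Subgroup (GL (Fin 2) F[X])) (G : OmegaPsi ψ M → Cinf F) : Prop where
  continuous : Continuous G
  slash_eq : ∀ γ ∈ Γ, slash k m (toGLK γ) G = G
  expansion : ∃ f : ℕ → Cinf F → Cinf F, HasExpansion ρ G s f ∧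
    ∀ i ≤ s, IsBoundedOnVerticalLines (f i)
  cusps : ∀ γ : GL (Fin 2) F[X], ∃ (a : ℕ → ℕ → Cinf F) (ε : ℝ), 0 < ε ∧
    ∀ z : OmegaPsi ψ M, ‖uParam ρ (cuspGen (conjSubgroup Γ γ)) z‖ < ε →
      (∀ i ≤ s, Summable fun l : ℕ => a i l * uParam ρ (cuspGen (conjSubgroup Γ γ)) z ^ l) ∧
      slash k m (toGLK γ) G z = nhSum ρ s
        (fun i w => ∑' l : ℕ, a i l * uParam ρ (cuspGen (conjSubgroup Γ γ)) w ^ l) z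

/-- The `u_N`-expansion of `f` exists and has coefficients in `L`. -/
def HasUExpansionOver (ρ : Cinf F) (N : F[X]) (L : Subfield (Cinf F)) (f : Cinf F → Cinf F) :
    Prop :=
  ∃ a : ℕ → Cinf F, (∀ l, a l ∈ L) ∧ ∃ ε : ℝ, 0 < ε ∧ ∀ z ∈ Omega F, ‖uParam ρ N z‖ < ε →
    HasSum (fun l : ℕ => a l * uParam ρ N z ^ l) (f z)

/-- The set `𝒩_k^{m,≤s}(Γ; L)` of nearly holomorphic Drinfeld modular forms of weight `k`, type `m`
and depth at most `s` for `Γ` that are defined over `L`. -/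
def nearlyHolomorphicForms (ρ : Cinf F) (k : ℕ) (m : ℤ) (s : ℕ)
    (Γ : Subgroup (GL (Fin 2) F[X])) (L : Subfield (Cinf F)) : Set (OmegaPsi ψ M → Cinf F) :=
  {G | IsNearlyHolomorphicForm ρ k m s Γ G ∧ ∃ f : ℕ → Cinf F → Cinf F, HasExpansion ρ G s f ∧
    ∀ i ≤ s, HasUExpansionOver ρ (cuspGen Γ) L (f i)}

end Forms

end DrinfeldMS

end

/-! The difficulty is that `ψ` is not analytic, so a nearly holomorphic function $G=\sum f_iX^i$ has
no Taylor series in $z$. The proof freezes the second variable. Put $w=\psi(z)$ and regard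
$F(x)=\sum f_i(x)(\tilde\pi x-\tilde\pi w)^{-i}$ as an analytic function of $x$ near $z$
(`frozenSum`). With the step written as $T/\tilde\pi$, the Taylor series of $(\tilde\pi x-\tilde\pi
w)^{-1}$ at $z$ is $X(1+XT)^{-1}$. The coefficient of $T^r$ in $(1+XT)^{k+r-1}\cdot
F(z+T/\tilde\pi)$ therefore contains $f_i$ with the factor $X^i(1+XT)^{k-i+r-1}$, which is exactly
the formula defining $\delta_k^r$ (`sum_msTerm_eq_localOperator`). All depths are thus handled by
one operator on analytic functions of one variable.

Since `ψ` commutes with fractional linear maps over $K$, slashing $G$ slashes its frozen function,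
with $w$ replaced by $\gamma w$. Equivariance becomes a statement about one analytic function $\Psi$
near $\gamma z$ (`localOperator_slash`). One expands $\Psi$ in powers of $\gamma x-\gamma
z=\det\gamma\, j(z)^{-1}j(x)^{-1}(x-z)$ and compares coefficients of $T^r$. What remains is that the
coefficient of $T^e$ in $(1+YT)^N(1+Y_1T)^{e-N-1}$ is $\binom Ne(Y-Y_1)^e$
(`coeff_binomSeries_mul_binomSeries`), together with $X(\gamma
z)=j^2\det(\gamma)^{-1}(X-c/(\tilde\pi j))$.

The operator is well defined because the $f_i$ are determined by $G$, even locally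
(`eventually_eq_zero_of_nhSum_eq_zero`). Translation by small elements of $K_\infty$ does not change
$X$, so the identity theorem separates the argument of the $f_i$ from $X$. Afterwards $X$ still
takes infinitely many values, and a polynomial with infinitely many zeros vanishes.

The remaining conditions on forms come from non-archimedean analysis. A Cauchy estimate, proved by
averaging over roots of unity, shows that holomorphic functions have Taylor series on discs of
radius $|z|_i$ and that hyperderivatives preserve holomorphy and boundedness on vertical lines. For
expansions at the cusps, additivity of $\exp_C$ gives
$u_N(z+\epsilon)=u_N(z)/(1+u_N(z)\exp_C(\tilde\pi\epsilon/N))$. Hence $\partial^n$ acts on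
$u_N$-series with coefficients in $K$, the powers of $\tilde\pi$ cancelling. This needs $u_N$ to be
finite on $\Omega$, that is, the zeros of $\exp_C$ to lie in $\tilde\pi K_\infty$. Both
$\exp_C(\tilde\pi)=0$ and this inclusion are proved here. -/

noncomputable section

set_option linter.unusedSectionVars false

/-! ### Completions of algebraically closed ultrametric fields -/

/-- A complete ultrametric field with a dense algebraically closed subfield is algebraically
closed. -/
theorem isAlgClosed_of_denseRange_of_isUltrametricDist {k L : Type*} [Field k]
    [NontriviallyNormedField L] [CompleteSpace L] [IsUltrametricDist L] [Algebra k L]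
    (hi : DenseRange (algebraMap k L)) [IsAlgClosed k] : IsAlgClosed L := by
  apply IsAlgClosed.of_exists_root
  intro f fmon firr
  have fdeg0 : f.natDegree ≠ 0 := (Irreducible.natDegree_pos firr).ne'
  let E := f.SplittingField
  let : NormedField E := spectralNorm.normedField L E
  let : NormedAlgebra L E := spectralNorm.normedAlgebra L E
  let a := rootOfSplits (SplittingField.splits f)
      (by simpa using degree_ne_of_natDegree_ne fdeg0)
  have fa0 : f.aeval a = 0 := by
    rw [← eval_map_algebraMap]
    exact eval_rootOfSplits (Polynomial.SplittingField.splits f)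
      (by simpa using degree_ne_of_natDegree_ne fdeg0)
  have hclosed : IsClosed (Set.range (algebraMap L E)) :=
    (algebraMap_isometry L E).isClosedEmbedding.isClosed_range
  have hmem : a ∈ Set.range (algebraMap L E) := by
    rw [← hclosed.closure_eq, Metric.mem_closure_iff]
    intro δ δpos
    -- This tolerance on the coefficients is chosen so that the continuity-of-roots bound below
    -- returns exactly `δ`. The roots of `g` lie in `k`, so `a` is a limit of elements of the closed
    -- subfield `L`.
    have hε : (δ / (max ‖a‖ 1)) ^ f.natDegree / (f.natDegree + 1) > 0 := by positivity
    obtain ⟨g, gmon, gdeg, gcoeff⟩ :=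
      exists_monic_and_natDegree_eq_and_norm_map_algebraMap_coeff_sub_lt hi fmon hε
    let ⟨b, hb, hab⟩ := exists_aroots_norm_sub_lt_of_norm_coeff_sub_lt
        hε fa0 fmon (gmon.map _) (gdeg ▸ (g.natDegree_map _)) gcoeff
        (by simpa [Polynomial.map_map] using (IsAlgClosed.splits g).map ((algebraMap L E).comp _))
    have hab : ‖a - b‖ < δ := by
      rw [← Real.rpow_natCast, ← mul_comm_div, div_self, one_mul,
          ← Real.rpow_mul (div_pos δpos (by positivity)).le, mul_inv_cancel₀] at hab
      · simpa [mul_assoc, div_mul_cancel₀ _ (by positivity : (max ‖a‖ 1) > 0).ne'] using hab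
      · simp [fdeg0]
      · positivity
    rw [Polynomial.aroots_def, Splits.roots_map ((IsAlgClosed.splits g).map _),
        Multiset.mem_map] at hb
    obtain ⟨c, _, hc⟩ := hb
    exact ⟨b, ⟨c, hc⟩, by rwa [dist_eq_norm]⟩
  obtain ⟨c, hc⟩ := hmem
  refine ⟨c, (algebraMap L E).injective ?_⟩
  rwa [← Polynomial.aeval_algebraMap_apply_eq_algebraMap_eval, hc, map_zero]

namespace DrinfeldMS

/-! ### Power series on discs in ultrametric fields -/

section Ultrametric

variable {C : Type*} [NontriviallyNormedField C] [CompleteSpace C] [IsUltrametricDist C]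

theorem summable_iff_tendsto_norm {f : ℕ → C} :
    Summable f ↔ Tendsto (fun n => ‖f n‖) atTop (𝓝 0) := by
  refine ⟨fun h => tendsto_zero_iff_norm_tendsto_zero.1 h.tendsto_atTop_zero, fun h => ?_⟩
  refine NonarchimedeanAddGroup.summable_of_tendsto_cofinite_zero ?_
  rw [Nat.cofinite_eq_atTop]
  exact tendsto_zero_iff_norm_tendsto_zero.2 h

theorem summable_of_norm_le {f : ℕ → C} {g : ℕ → C} (hg : Summable g) {B : ℝ}
    (h : ∀ n, ‖f n‖ ≤ B * ‖g n‖) : Summable f := by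
  rw [summable_iff_tendsto_norm] at hg ⊢
  refine squeeze_zero (fun n => norm_nonneg _) h ?_
  simpa using hg.const_mul B

theorem norm_tsum_le_bound {f : ℕ → C} {B : ℝ} (h : ∀ i, ‖f i‖ ≤ B) : ‖∑' i, f i‖ ≤ B :=
  IsUltrametricDist.norm_tsum_le_of_forall_le h

theorem norm_hasSum_le {f : ℕ → C} {a : C} (ha : HasSum f a) {B : ℝ} (h : ∀ i, ‖f i‖ ≤ B) :
    ‖a‖ ≤ B :=
  ha.tsum_eq ▸ norm_tsum_le_bound h

theorem norm_add_eq_of_lt {x y : C} (h : ‖y‖ < ‖x‖) : ‖x + y‖ = ‖x‖ := by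
  rw [IsUltrametricDist.norm_add_eq_max_of_norm_ne_norm h.ne', max_eq_left h.le]

theorem norm_add_le_of_le {x y : C} {B : ℝ} (hx : ‖x‖ ≤ B) (hy : ‖y‖ ≤ B) : ‖x + y‖ ≤ B :=
  (IsUltrametricDist.norm_add_le_max x y).trans (max_le hx hy)

theorem norm_sub_le_of_le {x y : C} {B : ℝ} (hx : ‖x‖ ≤ B) (hy : ‖y‖ ≤ B) : ‖x - y‖ ≤ B :=
  sub_eq_add_neg x y ▸ norm_add_le_of_le hx (by rwa [norm_neg])

theorem hasSum_cauchy_product {a b : ℕ → C} {x y : C} (hx : HasSum a x) (hy : HasSum b y) :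
    HasSum (fun n => ∑ kl ∈ Finset.HasAntidiagonal.antidiagonal n, a kl.1 * b kl.2) (x * y) := by
  have : NonarchimedeanRing C := ⟨NonarchimedeanAddGroup.is_nonarchimedean⟩
  have h3 := hx.summable.mul_of_nonarchimedean hy.summable
  rw [← hx.tsum_eq, ← hy.tsum_eq,
    hx.summable.tsum_mul_tsum_eq_tsum_sum_antidiagonal hy.summable h3]
  exact (summable_sum_mul_antidiagonal_of_summable_mul h3).hasSum

theorem coeff_mul_mul_pow (ε : C) (c d : PowerSeries C) (n : ℕ) :
    (c * d).coeff n * ε ^ n = ∑ kl ∈ Finset.HasAntidiagonal.antidiagonal n,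
      (c.coeff kl.1 * ε ^ kl.1) * (d.coeff kl.2 * ε ^ kl.2) := by
  rw [PowerSeries.coeff_mul, Finset.sum_mul]
  refine Finset.sum_congr rfl fun kl hkl => ?_
  rw [← Finset.HasAntidiagonal.mem_antidiagonal.1 hkl, pow_add]
  ring

/-- `f (z + ε) = ∑ cₙ εⁿ` whenever `|ε| < R`. -/
def HasTaylorOn (f : C → C) (z : C) (R : ℝ) (c : PowerSeries C) : Prop :=
  ∀ ε : C, ‖ε‖ < R → HasSum (fun n => c.coeff n * ε ^ n) (f (z + ε))

variable {f g : C → C} {z : C} {R : ℝ} {c d : PowerSeries C}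

theorem HasTaylorOn.mono {R' : ℝ} (h : HasTaylorOn f z R c) (hR : R' ≤ R) :
    HasTaylorOn f z R' c := fun ε hε => h ε (hε.trans_le hR)

theorem HasTaylorOn.add (hf : HasTaylorOn f z R c) (hg : HasTaylorOn g z R d) :
    HasTaylorOn (fun x => f x + g x) z R (c + d) := fun ε hε => by
  simpa [add_mul] using (hf ε hε).add (hg ε hε)

theorem HasTaylorOn.sub (hf : HasTaylorOn f z R c) (hg : HasTaylorOn g z R d) :
    HasTaylorOn (fun x => f x - g x) z R (c - d) := fun ε hε => by
  simpa [sub_mul] using (hf ε hε).sub (hg ε hε)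

theorem HasTaylorOn.mul (hf : HasTaylorOn f z R c) (hg : HasTaylorOn g z R d) :
    HasTaylorOn (fun x => f x * g x) z R (c * d) := by
  intro ε hε
  have h := hasSum_cauchy_product (hf ε hε) (hg ε hε)
  simp_rw [coeff_mul_mul_pow]
  exact h

theorem hasTaylorOn_const (a : C) : HasTaylorOn (fun _ => a) z R (PowerSeries.C a) :=
  fun ε _ => by
  convert! hasSum_single (f := fun n => (PowerSeries.C a).coeff n * ε ^ n) 0 fun n hn => ?_ using 1
  · simp
  · simp [PowerSeries.coeff_C, hn]

theorem hasTaylorOn_id : HasTaylorOn (fun x => x) z R (PowerSeries.C z + PowerSeries.X) := by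
  have h : HasTaylorOn (fun x => x - z) z R (PowerSeries.X : PowerSeries C) := fun ε _ => by
    convert! hasSum_single (f := fun n => (PowerSeries.X : PowerSeries C).coeff n * ε ^ n) 1
      fun n hn => ?_ using 1
    · simp
    · simp [PowerSeries.coeff_X, hn]
  simpa using (hasTaylorOn_const z).add h

theorem HasTaylorOn.pow (hf : HasTaylorOn f z R c) (n : ℕ) :
    HasTaylorOn (fun x => f x ^ n) z R (c ^ n) := by
  induction n with
  | zero => simpa using hasTaylorOn_const (z := z) (R := R) (1 : C)
  | succ n ih => simpa [pow_succ] using ih.mul hf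

theorem HasTaylorOn.sum {ι : Type*} (s : Finset ι) {f : ι → C → C} {c : ι → PowerSeries C}
    (h : ∀ i ∈ s, HasTaylorOn (f i) z R (c i)) :
    HasTaylorOn (fun x => ∑ i ∈ s, f i x) z R (∑ i ∈ s, c i) := fun ε hε => by
  simpa [Finset.sum_mul] using hasSum_sum fun i hi => h i hi ε hε

theorem HasTaylorOn.congr (hf : HasTaylorOn f z R c) (h : ∀ x, ‖x - z‖ < R → f x = g x) :
    HasTaylorOn g z R c := fun ε hε => by
  rw [← h (z + ε) (by simpa using hε)]
  exact hf ε hε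

theorem hasTaylorOn_inv_linear {a : C} (ha : R ≤ ‖z - a‖) :
    ∃ c, HasTaylorOn (fun x => (x - a)⁻¹) z R c := by
  by_cases hR : 0 < R
  · have hz : z - a ≠ 0 := norm_pos_iff.1 (hR.trans_le ha)
    refine ⟨PowerSeries.mk fun n => (z - a)⁻¹ * (-(z - a)⁻¹) ^ n, fun ε hε => ?_⟩
    have h1 : ‖-(z - a)⁻¹ * ε‖ < 1 := by
      rw [norm_mul, norm_neg, norm_inv, inv_mul_lt_iff₀ (norm_pos_iff.2 hz), mul_one]
      exact hε.trans_le ha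
    have h2 := (hasSum_geometric_of_norm_lt_one h1).mul_left (z - a)⁻¹
    have h3 : (z - a)⁻¹ * (1 - -(z - a)⁻¹ * ε)⁻¹ = (z + ε - a)⁻¹ := by
      rw [← mul_inv]
      congr 1
      field_simp
      ring
    rw [h3] at h2
    convert! h2 using 2 with n
    simp only [PowerSeries.coeff_mk]
    rw [mul_pow]
    ring
  · exact ⟨0, fun ε hε => absurd ((norm_nonneg ε).trans_lt hε) hR⟩

theorem hasTaylorOn_eval (P : C[X]) : ∃ c, HasTaylorOn (fun x => P.eval x) z R c := by
  simp_rw [Polynomial.eval_eq_sum, Polynomial.sum]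
  exact ⟨_, HasTaylorOn.sum _ fun i _ => (hasTaylorOn_const _).mul (hasTaylorOn_id.pow i)⟩

/-- Over an algebraically closed field `Q` is a product of linear factors. Their roots lie outside
the disc, so each inverse is a geometric series converging on the whole disc. -/
theorem hasTaylorOn_inv_eval [IsAlgClosed C] {Q : C[X]} (hQ : ∀ x, ‖x - z‖ < R → Q.eval x ≠ 0) :
    ∃ c, HasTaylorOn (fun x => (Q.eval x)⁻¹) z R c := by
  have hsplit := IsAlgClosed.splits Q
  have key : ∀ s : Multiset C, (∀ a ∈ s, R ≤ ‖z - a‖) →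
      ∃ c, HasTaylorOn (fun x => ((s.map fun a => x - a).prod)⁻¹) z R c := by
    intro s
    induction s using Multiset.induction_on with
    | empty => exact fun _ => ⟨_, by simpa using hasTaylorOn_const (1 : C)⟩
    | cons a s ih =>
      intro h
      obtain ⟨c, hc⟩ := ih fun b hb => h b (Multiset.mem_cons_of_mem hb)
      obtain ⟨d, hd⟩ := hasTaylorOn_inv_linear (h a (Multiset.mem_cons_self a s))
      exact ⟨d * c, by simpa [mul_comm] using hd.mul hc⟩
  obtain ⟨c, hc⟩ := key Q.roots fun a ha => by
    by_contra! h
    rw [← norm_neg, neg_sub] at h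
    exact hQ a h (Polynomial.isRoot_of_mem_roots ha)
  refine ⟨_, ((hasTaylorOn_const Q.leadingCoeff⁻¹).mul hc).congr fun x _ => ?_⟩
  conv_rhs => rw [hsplit.eq_prod_roots]
  simp [Polynomial.eval_multiset_prod, Multiset.map_map, mul_comm]

theorem hasTaylorOn_eval_div_eval [IsAlgClosed C] (P : C[X]) {Q : C[X]}
    (hQ : ∀ x, ‖x - z‖ < R → Q.eval x ≠ 0) :
    ∃ c, HasTaylorOn (fun x => P.eval x / Q.eval x) z R c := by
  obtain ⟨c, hc⟩ := hasTaylorOn_eval (z := z) (R := R) P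
  obtain ⟨d, hd⟩ := hasTaylorOn_inv_eval hQ
  exact ⟨c * d, by simpa [div_eq_mul_inv] using hc.mul hd⟩

end Ultrametric

end DrinfeldMS

namespace DrinfeldMS

/-! ### The Cauchy estimate and uniform limits of power series -/

section Cauchy

variable {C : Type*} [NontriviallyNormedField C] [CompleteSpace C] [IsUltrametricDist C]

/-- The Cauchy estimate on the unit circle. -/
theorem norm_le_of_norm_tsum_le [IsAlgClosed C] {p : ℕ} [Fact p.Prime] [CharP C p] {c : ℕ → C}
    (hc : Summable c) {B : ℝ} (hB : ∀ ζ : C, ‖ζ‖ = 1 → ‖∑' i, c i * ζ ^ i‖ ≤ B) (n : ℕ) :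
    ‖c n‖ ≤ B := by
  by_contra! hlt
  have hB0 : 0 ≤ B := (norm_nonneg _).trans (hB 1 norm_one)
  have hcn : 0 < ‖c n‖ := hB0.trans_lt hlt
  obtain ⟨I, hI⟩ := eventually_atTop.1
    ((summable_iff_tendsto_norm.1 hc).eventually_lt_const (half_pos hcn))
  set a := max n I + 1 with ha
  set N := p ^ a - 1 with hN
  have hp2 : 2 ≤ p := (Fact.out : p.Prime).two_le
  have haN : a ≤ N := by
    have h1 : a < p ^ a := Nat.lt_pow_self hp2
    omega
  have hnN : n < N := by omega
  have hIN : I < N := by omega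
  have hNC : (N : C) = -1 := by
    rw [hN, Nat.cast_sub (Nat.one_le_pow _ _ (by omega)), Nat.cast_pow, CharP.cast_eq_zero,
      zero_pow (by omega)]
    simp
  have : NeZero (N : C) := ⟨by rw [hNC]; simp⟩
  obtain ⟨ζ, hζ⟩ := HasEnoughRootsOfUnity.exists_primitiveRoot C N
  have hζ1 : ‖ζ‖ = 1 := by
    have h := congrArg norm hζ.pow_eq_one
    rw [norm_pow, norm_one] at h
    exact (pow_eq_one_iff_of_nonneg (norm_nonneg _) (by omega)).1 h
  -- Discrete Fourier inversion: averaging the values at the `ζ ^ j` against `ζ ^ (-n j)` weights `c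
  -- i` by `w i`, which is `N` for `i = n` and `0` for the other `i < N`. The exponent `N - n`
  -- replaces `-n`.
  let w : ℕ → C := fun i => ∑ j ∈ Finset.range N, (ζ ^ (i + (N - n))) ^ j
  have hsum : ∀ ξ : C, ‖ξ‖ = 1 → Summable fun i => c i * ξ ^ i := fun ξ hξ =>
    summable_of_norm_le hc (B := 1) fun i => by simp [hξ]
  have hS : HasSum (fun i => c i * w i)
      (∑ j ∈ Finset.range N, (ζ ^ (N - n)) ^ j * ∑' i, c i * (ζ ^ j) ^ i) := by
    have h := hasSum_sum (s := Finset.range N)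
      (f := fun j i => (ζ ^ (N - n)) ^ j * (c i * (ζ ^ j) ^ i)) fun j _ =>
        ((hsum (ζ ^ j) (by simp [hζ1])).hasSum.mul_left ((ζ ^ (N - n)) ^ j))
    refine h.congr_fun fun i => ?_
    rw [Finset.mul_sum]
    refine Finset.sum_congr rfl fun j _ => ?_
    rw [pow_add, mul_pow, ← pow_mul, ← pow_mul ζ j i, mul_comm j i]
    ring
  have hSB : ‖∑ j ∈ Finset.range N, (ζ ^ (N - n)) ^ j * ∑' i, c i * (ζ ^ j) ^ i‖ ≤ B := by
    refine IsUltrametricDist.norm_sum_le_of_forall_le_of_nonneg hB0 fun j _ => ?_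
    rw [norm_mul, norm_pow, norm_pow, hζ1, one_pow, one_pow, one_mul]
    exact hB _ (by simp [hζ1])
  have hwn : w n = N := by
    have h : ζ ^ (n + (N - n)) = 1 := by rw [Nat.add_sub_cancel' hnN.le, hζ.pow_eq_one]
    simp [w, h]
  have hw0 : ∀ i, i < N → i ≠ n → w i = 0 := fun i hi hin => by
    have h1 : ζ ^ (i + (N - n)) ≠ 1 := fun h => by
      have h2 := (hζ.pow_eq_one_iff_dvd _).1 h
      obtain ⟨t, ht⟩ := h2
      have ht1 : t = 1 := by
        have : N * t < N * 2 := by omega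
        have h3 := Nat.lt_of_mul_lt_mul_left this
        rcases Nat.eq_zero_or_pos t with h4 | h4
        · subst h4; omega
        · omega
      subst ht1
      omega
    refine (mul_eq_zero.1 (geom_sum_mul (ζ ^ (i + (N - n))) N ▸ ?_)).resolve_right
      (sub_ne_zero.2 h1)
    rw [← pow_mul, mul_comm, pow_mul, hζ.pow_eq_one, one_pow, sub_self]
  have hw1 : ∀ i, ‖w i‖ ≤ 1 := fun i =>
    IsUltrametricDist.norm_sum_le_of_forall_le_of_nonneg zero_le_one fun j _ => by simp [hζ1]
  have hrest := (hasSum_ite_sub_hasSum hS n)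
  -- Only the indices `i ≥ N > I` survive, and there `c i` is smaller than half of `c n`. So the
  -- aliasing error cannot account for `c n`.
  have hle : ∀ i, ‖if i = n then 0 else c i * w i‖ ≤ ‖c n‖ / 2 := fun i => by
    split_ifs with hi
    · rw [norm_zero]; positivity
    · by_cases hiN : i < N
      · rw [hw0 i hiN hi, mul_zero, norm_zero]; positivity
      · rw [norm_mul]
        have h1 := hI i (by omega)
        nlinarith [hw1 i, norm_nonneg (c i), norm_nonneg (w i)]
  have hr := norm_hasSum_le hrest hle
  have hfin : ‖c n * w n‖ ≤ max B (‖c n‖ / 2) := by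
    have h := norm_sub_le_of_le (hSB.trans (le_max_left B (‖c n‖ / 2)))
      (hr.trans (le_max_right B (‖c n‖ / 2)))
    rwa [sub_sub_cancel] at h
  rw [norm_mul, hwn, hNC, norm_neg, norm_one, mul_one] at hfin
  rcases le_max_iff.1 hfin with h | h <;> linarith

variable {f : C → C} {z : C} {R : ℝ} {c : PowerSeries C}

/-- The Cauchy estimate. -/
theorem HasTaylorOn.norm_coeff_mul_le [IsAlgClosed C] {p : ℕ} [Fact p.Prime] [CharP C p]
    (hf : HasTaylorOn f z R c) {B : ℝ} (hB : ∀ x, ‖x - z‖ < R → ‖f x‖ ≤ B) {ε : C} (hε : ‖ε‖ < R)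
    (n : ℕ) : ‖c.coeff n‖ * ‖ε‖ ^ n ≤ B := by
  rw [← norm_pow, ← norm_mul]
  refine norm_le_of_norm_tsum_le (c := fun n => c.coeff n * ε ^ n) (p := p) (hf ε hε).summable
    (fun ζ hζ => ?_) n
  have hζε : ‖ε * ζ‖ < R := by rwa [norm_mul, hζ, mul_one]
  have h := hf (ε * ζ) hζε
  simp_rw [mul_pow, ← mul_assoc] at h
  rw [h.tsum_eq]
  exact hB _ (by simpa using hζε)

/-- A uniform limit of power series converging on a disc is given by a power series on this
disc. -/
theorem HasTaylorOn.of_uniform_limit [IsAlgClosed C] {p : ℕ} [Fact p.Prime] [CharP C p]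
    (hR : 0 < R) {G : ℕ → C → C} {P : ℕ → PowerSeries C} (hG : ∀ k, HasTaylorOn (G k) z R (P k))
    (hlim : ∀ η : ℝ, 0 < η → ∀ᶠ k in atTop, ∀ x, ‖x - z‖ < R → ‖f x - G k x‖ ≤ η) :
    ∃ c, HasTaylorOn f z R c ∧
      ∀ n, Tendsto (fun k => (P k).coeff n) atTop (𝓝 (c.coeff n)) := by
  -- The Cauchy estimate for `G k - G l` bounds all coefficients at once. This uniformity in `n` is
  -- what lets the limit series converge, with the right sum, on the entire open disc.
  have hdiff : ∀ η : ℝ, 0 < η → ∃ K, ∀ k ≥ K, ∀ l ≥ K, ∀ ε : C, ‖ε‖ < R → ∀ n,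
      ‖(P k).coeff n - (P l).coeff n‖ * ‖ε‖ ^ n ≤ η := by
    intro η hη
    obtain ⟨K, hK⟩ := eventually_atTop.1 (hlim η hη)
    refine ⟨K, fun k hk l hl ε hε n => ?_⟩
    rw [← map_sub]
    refine ((hG k).sub (hG l)).norm_coeff_mul_le (p := p) (fun x hx => ?_) hε n
    have h := norm_sub_le_of_le (hK l hl x hx) (hK k hk x hx)
    rwa [sub_sub_sub_cancel_left] at h
  obtain ⟨ε₀, hε₀, hε₀R⟩ := NormedField.exists_norm_lt C hR
  have hcauchy : ∀ n, ∃ a, Tendsto (fun k => (P k).coeff n) atTop (𝓝 a) := fun n => by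
    refine cauchySeq_tendsto_of_complete (Metric.cauchySeq_iff.2 fun η hη => ?_)
    have hpos : 0 < ‖ε₀‖ ^ n := pow_pos hε₀ n
    obtain ⟨K, hK⟩ := hdiff (η / 2 * ‖ε₀‖ ^ n) (by positivity)
    refine ⟨K, fun k hk l hl => ?_⟩
    have h := le_of_mul_le_mul_right (hK k hk l hl ε₀ hε₀R n) hpos
    rw [dist_eq_norm]
    linarith
  choose a ha using hcauchy
  refine ⟨PowerSeries.mk a, fun ε hε => ?_, by simpa using ha⟩
  have hclose : ∀ η : ℝ, 0 < η → ∃ K, ∀ k ≥ K, ∀ n,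
      ‖(P k).coeff n * ε ^ n - a n * ε ^ n‖ ≤ η := fun η hη => by
    obtain ⟨K, hK⟩ := hdiff η hη
    refine ⟨K, fun k hk n => ?_⟩
    have ht := (((tendsto_const_nhds (x := (P k).coeff n)).sub (ha n)).mul_const (ε ^ n)).norm
    simp_rw [norm_mul, norm_pow] at ht
    rw [← sub_mul, norm_mul, norm_pow]
    exact le_of_tendsto ht (eventually_atTop.2 ⟨K, fun l hl => hK k hk l hl ε hε n⟩)
  have hsummable : Summable fun n => a n * ε ^ n := by
    rw [summable_iff_tendsto_norm, Metric.tendsto_atTop]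
    intro η hη
    obtain ⟨K, hK⟩ := hclose (η / 2) (half_pos hη)
    obtain ⟨N, hN⟩ := eventually_atTop.1 ((summable_iff_tendsto_norm.1
      (hG K ε hε).summable).eventually_lt_const (half_pos hη))
    refine ⟨N, fun n hn => ?_⟩
    have h := norm_sub_le_of_le (hN n hn).le (hK K le_rfl n)
    rw [sub_sub_cancel] at h
    rw [Real.dist_eq, sub_zero, abs_of_nonneg (norm_nonneg _)]
    linarith
  have hval : f (z + ε) = ∑' n, a n * ε ^ n := by
    refine eq_of_sub_eq_zero (norm_eq_zero.1 (le_antisymm (le_of_forall_pos_le_add fun η hη => ?_)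
      (norm_nonneg _)))
    obtain ⟨K, hK⟩ := hclose η hη
    obtain ⟨k, hkK, hk⟩ := ((eventually_ge_atTop K).and (hlim η hη)).exists
    have h1 := norm_hasSum_le ((hG k ε hε).sub hsummable.hasSum) (hK k hkK)
    have h2 := norm_add_le_of_le (hk (z + ε) (by simpa using hε)) h1
    rw [sub_add_sub_cancel] at h2
    linarith
  simp only [PowerSeries.coeff_mk]
  rw [hval]
  exact hsummable.hasSum

theorem HasTaylorOn.analyticAt (hf : HasTaylorOn f z R c) (hR : 0 < R) : AnalyticAt C f z := by
  refine ⟨FormalMultilinearSeries.ofScalars C fun n => c.coeff n, ?_⟩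
  rw [hasFPowerSeriesAt_iff]
  filter_upwards [Metric.ball_mem_nhds (0 : C) hR] with ε hε
  refine (hf ε (by simpa using hε)).congr_fun fun n => ?_
  simp [FormalMultilinearSeries.coeff_ofScalars, mul_comm]

theorem exists_hasTaylorOn_of_analyticAt (hf : AnalyticAt C f z) :
    ∃ R > 0, ∃ c, HasTaylorOn f z R c := by
  obtain ⟨p, hp⟩ := hf
  rw [hasFPowerSeriesAt_iff, Metric.eventually_nhds_iff] at hp
  obtain ⟨R, hR, h⟩ := hp
  refine ⟨R, hR, PowerSeries.mk p.coeff, fun ε hε => ?_⟩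
  refine (h (y := ε) (by simpa using hε)).congr_fun fun n => ?_
  simp [mul_comm]

/-- Makes the chosen series in `hyperderiv` independent of the choice, by uniqueness of power series
representations. -/
theorem HasTaylorOn.coeff_unique {d : ℕ → C} (hf : HasTaylorOn f z R c) (hR : 0 < R)
    (hd : ∀ᶠ ε in 𝓝 (0 : C), HasSum (fun n => d n * ε ^ n) (f (z + ε))) (n : ℕ) :
    d n = c.coeff n := by
  have h1 : HasFPowerSeriesAt f (FormalMultilinearSeries.ofScalars C fun n => c.coeff n) z := by
    rw [hasFPowerSeriesAt_iff]
    filter_upwards [Metric.ball_mem_nhds (0 : C) hR] with ε hε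
    refine (hf ε (by simpa using hε)).congr_fun fun n => ?_
    simp [FormalMultilinearSeries.coeff_ofScalars, mul_comm]
  have h2 : HasFPowerSeriesAt f (FormalMultilinearSeries.ofScalars C d) z := by
    rw [hasFPowerSeriesAt_iff]
    filter_upwards [hd] with ε hε
    refine hε.congr_fun fun n => ?_
    simp [FormalMultilinearSeries.coeff_ofScalars, mul_comm]
  have h := congrArg (fun p => FormalMultilinearSeries.coeff p n) (h2.eq_formalMultilinearSeries h1)
  simpa [FormalMultilinearSeries.coeff_ofScalars] using h

end Cauchy

end DrinfeldMS

namespace DrinfeldMS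

/-! ### The field `ℂ_∞` -/

section Instances

variable (F : Type*) [Field F] [Fintype F]

instance : IsUltrametricDist (Kbar F) :=
  IsUltrametricDist.isUltrametricDist_of_isNonarchimedean_norm
    (isNonarchimedean_spectralNorm (K := Kinf F) (L := Kbar F))

instance : IsUltrametricDist (Cinf F) :=
  IsUltrametricDist.isUltrametricDist_of_forall_norm_add_le_max_norm fun x y => by
    induction x, y using UniformSpace.Completion.induction_on₂ with
    | hp => exact isClosed_le (by fun_prop) (by fun_prop)
    | ih a b =>
      rw [← UniformSpace.Completion.coe_add]
      simp only [UniformSpace.Completion.norm_coe]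
      exact IsUltrametricDist.norm_add_le_max a b

theorem norm_theta : ‖theta F‖ = q F := by
  rw [theta, ofA, RingHom.comp_apply, ofK, RingHom.comp_apply, norm_ofKinf, norm_ratToKinf,
    RatFunc.algebraMap_X, inftyAbs_apply F RatFunc.X_ne_zero, RatFunc.intDegree_X, zpow_one]

instance : NontriviallyNormedField (Cinf F) where
  non_trivial := ⟨theta F, by rw [norm_theta]; exact_mod_cast one_lt_q F⟩

instance : IsAlgClosed (Cinf F) :=
  isAlgClosed_of_denseRange_of_isUltrametricDist (k := Kbar F)
    UniformSpace.Completion.denseRange_coe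

theorem isometry_ofKinf : Isometry (ofKinf F) :=
  AddMonoidHomClass.isometry_of_norm _ (norm_ofKinf F)

theorem exists_charP_Cinf : ∃ p : ℕ, p.Prime ∧ CharP (Cinf F) p := by
  obtain ⟨p, hp⟩ := CharP.exists F
  refine ⟨p, CharP.char_is_prime F p, ?_⟩
  exact (RingHom.charP_iff (ofFq F) (ofFq F).injective p).1 hp

end Instances

variable {F : Type*} [Field F] [Fintype F]

/-! ### The imaginary norm -/

theorem isClosed_range_ofKinf : IsClosed (Set.range (ofKinf F)) :=
  (isometry_ofKinf F).isClosedEmbedding.isClosed_range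

theorem range_ofKinf_nonempty : (Set.range (ofKinf F)).Nonempty := Set.range_nonempty _

theorem imNorm_pos_iff {z : Cinf F} : 0 < imNorm z ↔ z ∈ Omega F :=
  (isClosed_range_ofKinf.notMem_iff_infDist_pos range_ofKinf_nonempty).symm

theorem imNorm_le (z : Cinf F) (a : Kinf F) : imNorm z ≤ ‖z - ofKinf F a‖ := by
  rw [← dist_eq_norm]
  exact Metric.infDist_le_dist_of_mem (Set.mem_range_self a)

theorem le_imNorm {z : Cinf F} {B : ℝ} (h : ∀ a, B ≤ ‖z - ofKinf F a‖) : B ≤ imNorm z := by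
  refine (Metric.le_infDist range_ofKinf_nonempty).2 ?_
  rintro _ ⟨a, rfl⟩
  rw [dist_eq_norm]
  exact h a

/-- By the ultrametric inequality, a move shorter than $|z|_i$ changes no distance to $K_\infty$.
Consequently a disc of radius $|z|_i$ stays in every affinoid that contains its centre. -/
theorem norm_sub_ofKinf_eq {z x : Cinf F} (h : ‖x - z‖ < imNorm z) (a : Kinf F) :
    ‖x - ofKinf F a‖ = ‖z - ofKinf F a‖ := by
  rw [show x - ofKinf F a = (z - ofKinf F a) + (x - z) by ring]
  exact norm_add_eq_of_lt (h.trans_le (imNorm_le z a))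

theorem imNorm_eq_of_lt {z x : Cinf F} (h : ‖x - z‖ < imNorm z) : imNorm x = imNorm z :=
  le_antisymm (le_imNorm fun a => norm_sub_ofKinf_eq h a ▸ imNorm_le x a)
    (le_imNorm fun a => norm_sub_ofKinf_eq h a ▸ imNorm_le z a)

theorem norm_eq_of_lt_imNorm {z x : Cinf F} (h : ‖x - z‖ < imNorm z) : ‖x‖ = ‖z‖ := by
  simpa using norm_sub_ofKinf_eq h 0

theorem mem_Omega_of_lt {z x : Cinf F} (h : ‖x - z‖ < imNorm z) : x ∈ Omega F := by
  rw [← imNorm_pos_iff, imNorm_eq_of_lt h]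
  exact (norm_nonneg _).trans_lt h

theorem mem_affinoid_of_lt {z x : Cinf F} {n : ℕ} (hz : z ∈ affinoid F n)
    (h : ‖x - z‖ < imNorm z) : x ∈ affinoid F n :=
  ⟨mem_Omega_of_lt h, norm_eq_of_lt_imNorm h ▸ hz.2.1, imNorm_eq_of_lt h ▸ hz.2.2⟩

theorem one_lt_q_real : (1 : ℝ) < q F := by exact_mod_cast one_lt_q F

theorem exists_mem_affinoid {z : Cinf F} (hz : z ∈ Omega F) : ∃ n, 1 ≤ n ∧ z ∈ affinoid F n := by
  have hpos := imNorm_pos_iff.2 hz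
  obtain ⟨n, hn⟩ := pow_unbounded_of_one_lt (max ‖z‖ (imNorm z)⁻¹) (one_lt_q_real (F := F))
  have hle : (q F : ℝ) ^ n ≤ (q F : ℝ) ^ (n + 1) :=
    pow_le_pow_right₀ one_lt_q_real.le n.le_succ
  refine ⟨n + 1, by omega, hz, ?_, ?_⟩
  · exact ((le_max_left _ _).trans hn.le).trans hle
  · exact inv_le_of_inv_le₀ hpos (((le_max_right _ _).trans hn.le).trans hle)

theorem Omega_mem_nhds {z : Cinf F} (hz : z ∈ Omega F) : Omega F ∈ 𝓝 z :=
  isClosed_range_ofKinf.isOpen_compl.mem_nhds hz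

/-! ### Taylor series -/

/-- The formal power series `∑ (𝒟ⁿ f)(z) Tⁿ`. -/
def taylor (f : Cinf F → Cinf F) (z : Cinf F) : PowerSeries (Cinf F) :=
  PowerSeries.mk fun n => hyperderiv n f z

@[simp]
theorem coeff_taylor (f : Cinf F → Cinf F) (z : Cinf F) (n : ℕ) :
    (taylor f z).coeff n = hyperderiv n f z := PowerSeries.coeff_mk _ _

variable {f g : Cinf F → Cinf F} {z : Cinf F} {R : ℝ} {c : PowerSeries (Cinf F)}

theorem HasTaylorOn.hyperderiv_eq (hf : HasTaylorOn f z R c) (hR : 0 < R) (n : ℕ) :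
    hyperderiv n f z = c.coeff n := by
  have h : ∃ c : ℕ → Cinf F, ∀ᶠ ε in 𝓝 (0 : Cinf F),
      HasSum (fun i : ℕ => c i * ε ^ i) (f (z + ε)) :=
    ⟨fun n => c.coeff n, by
      filter_upwards [Metric.ball_mem_nhds (0 : Cinf F) hR] with ε hε
      exact hf ε (by simpa using hε)⟩
  rw [hyperderiv, dif_pos h]
  exact hf.coeff_unique hR h.choose_spec n

theorem HasTaylorOn.taylor_eq (hf : HasTaylorOn f z R c) (hR : 0 < R) : taylor f z = c := by
  ext n
  rw [coeff_taylor, hf.hyperderiv_eq hR]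

theorem exists_hasTaylorOn_taylor (hf : AnalyticAt (Cinf F) f z) :
    ∃ R > 0, HasTaylorOn f z R (taylor f z) := by
  obtain ⟨R, hR, c, hc⟩ := exists_hasTaylorOn_of_analyticAt hf
  exact ⟨R, hR, hc.taylor_eq hR ▸ hc⟩

theorem taylor_congr (h : ∀ᶠ x in 𝓝 z, f x = g x) (hf : AnalyticAt (Cinf F) f z) :
    taylor f z = taylor g z := by
  obtain ⟨R, hR, hc⟩ := exists_hasTaylorOn_taylor hf
  obtain ⟨R', hR', h'⟩ := Metric.eventually_nhds_iff.1 h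
  refine (((hc.mono (min_le_left R R')).congr fun x hx => h' ?_).taylor_eq (lt_min hR hR')).symm
  rw [dist_eq_norm]
  exact hx.trans_le (min_le_right _ _)

theorem taylor_add (hf : AnalyticAt (Cinf F) f z) (hg : AnalyticAt (Cinf F) g z) :
    taylor (fun x => f x + g x) z = taylor f z + taylor g z := by
  obtain ⟨R, hR, hc⟩ := exists_hasTaylorOn_taylor hf
  obtain ⟨R', hR', hc'⟩ := exists_hasTaylorOn_taylor hg
  exact ((hc.mono (min_le_left R R')).add (hc'.mono (min_le_right R R'))).taylor_eq
    (lt_min hR hR')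

theorem taylor_mul (hf : AnalyticAt (Cinf F) f z) (hg : AnalyticAt (Cinf F) g z) :
    taylor (fun x => f x * g x) z = taylor f z * taylor g z := by
  obtain ⟨R, hR, hc⟩ := exists_hasTaylorOn_taylor hf
  obtain ⟨R', hR', hc'⟩ := exists_hasTaylorOn_taylor hg
  exact ((hc.mono (min_le_left R R')).mul (hc'.mono (min_le_right R R'))).taylor_eq
    (lt_min hR hR')

theorem taylor_const (a : Cinf F) : taylor (fun _ => a) z = PowerSeries.C a :=
  (hasTaylorOn_const a).taylor_eq one_pos

theorem taylor_id : taylor (fun x => x) z = PowerSeries.C z + PowerSeries.X :=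
  hasTaylorOn_id.taylor_eq one_pos

theorem taylor_pow (hf : AnalyticAt (Cinf F) f z) (n : ℕ) :
    taylor (fun x => f x ^ n) z = taylor f z ^ n := by
  obtain ⟨R, hR, hc⟩ := exists_hasTaylorOn_taylor hf
  exact (hc.pow n).taylor_eq hR

theorem taylor_sum {ι : Type*} (s : Finset ι) {f : ι → Cinf F → Cinf F}
    (hf : ∀ i ∈ s, AnalyticAt (Cinf F) (f i) z) :
    taylor (fun x => ∑ i ∈ s, f i x) z = ∑ i ∈ s, taylor (f i) z := by
  classical
  induction s using Finset.induction_on with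
  | empty => simpa using taylor_const (z := z) (0 : Cinf F)
  | insert i s hi ih =>
    simp only [Finset.sum_insert hi]
    rw [taylor_add (hf i (Finset.mem_insert_self i s)) (Finset.analyticAt_fun_sum _ fun j hj =>
      hf j (Finset.mem_insert_of_mem hj)), ih fun j hj => hf j (Finset.mem_insert_of_mem hj)]

theorem taylor_inv (hf : AnalyticAt (Cinf F) f z) (h0 : f z ≠ 0) :
    taylor (fun x => (f x)⁻¹) z * taylor f z = 1 := by
  rw [← taylor_mul (hf.fun_inv h0) hf, ← map_one (PowerSeries.C (R := Cinf F)),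
    ← taylor_const (z := z)]
  refine taylor_congr ?_ ((hf.fun_inv h0).fun_mul hf)
  filter_upwards [hf.continuousAt.eventually_ne h0] with x hx
  exact inv_mul_cancel₀ hx

/-! ### Holomorphic functions -/

/-- The disc of radius $|z|_i$ lies in one affinoid. There `f` is a uniform limit of rational
functions without poles, each of which has a Taylor series on the whole disc. -/
theorem IsHolomorphic.exists_hasTaylorOn (hf : IsHolomorphic f) (hz : z ∈ Omega F) :
    ∃ c, HasTaylorOn f z (imNorm z) c := by
  obtain ⟨p, hp, hchar⟩ := exists_charP_Cinf F
  have : Fact p.Prime := ⟨hp⟩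
  obtain ⟨n, hn, hzn⟩ := exists_mem_affinoid hz
  choose P Q hPQ using fun k : ℕ => hf n hn (1 / ((k : ℝ) + 1)) Nat.one_div_pos_of_nat
  have hball : ∀ x, ‖x - z‖ < imNorm z → x ∈ affinoid F n := fun x hx =>
    mem_affinoid_of_lt hzn hx
  choose c hc using fun k => hasTaylorOn_eval_div_eval (z := z) (R := imNorm z) (P k)
    fun x hx => (hPQ k x (hball x hx)).1
  obtain ⟨d, hd, -⟩ := HasTaylorOn.of_uniform_limit (p := p) (f := f) (imNorm_pos_iff.2 hz) hc
    fun η hη => by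
      filter_upwards [(tendsto_one_div_add_atTop_nhds_zero_nat (𝕜 := ℝ)).eventually_lt_const hη]
        with k hk x hx
      exact ((hPQ k x (hball x hx)).2.trans hk).le
  exact ⟨d, hd⟩

theorem IsHolomorphic.hasTaylorOn (hf : IsHolomorphic f) (hz : z ∈ Omega F) :
    HasTaylorOn f z (imNorm z) (taylor f z) := by
  obtain ⟨c, hc⟩ := hf.exists_hasTaylorOn hz
  rwa [hc.taylor_eq (imNorm_pos_iff.2 hz)]

theorem IsHolomorphic.analyticAt (hf : IsHolomorphic f) (hz : z ∈ Omega F) :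
    AnalyticAt (Cinf F) f z :=
  (hf.hasTaylorOn hz).analyticAt (imNorm_pos_iff.2 hz)

theorem HasTaylorOn.norm_hyperderiv_mul_le (hf : HasTaylorOn f z R c) {B : ℝ}
    (hB : ∀ x, ‖x - z‖ < R → ‖f x‖ ≤ B) {ε : Cinf F} (hε : ‖ε‖ < R) (n : ℕ) :
    ‖hyperderiv n f z‖ * ‖ε‖ ^ n ≤ B := by
  obtain ⟨p, hp, hchar⟩ := exists_charP_Cinf F
  have : Fact p.Prime := ⟨hp⟩
  rw [hf.hyperderiv_eq ((norm_nonneg ε).trans_lt hε)]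
  exact hf.norm_coeff_mul_le (p := p) hB hε n

theorem IsHolomorphic.add (hf : IsHolomorphic f) (hg : IsHolomorphic g) :
    IsHolomorphic (fun x => f x + g x) := by
  intro n hn ε hε
  obtain ⟨P, Q, h⟩ := hf n hn ε hε
  obtain ⟨P', Q', h'⟩ := hg n hn ε hε
  refine ⟨P * Q' + P' * Q, Q * Q', fun z hz => ?_⟩
  obtain ⟨h1, h2⟩ := h z hz
  obtain ⟨h3, h4⟩ := h' z hz
  refine ⟨by simp [h1, h3], ?_⟩
  rw [show f z + g z - (P * Q' + P' * Q).eval z / (Q * Q').eval z =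
    (f z - P.eval z / Q.eval z) + (g z - P'.eval z / Q'.eval z) by
      simp only [eval_add, eval_mul]; field_simp; ring]
  exact (IsUltrametricDist.norm_add_le_max _ _).trans_lt (max_lt h2 h4)

/-- On each affinoid it is enough to approximate up to a constant factor. -/
theorem IsHolomorphic.of_forall_affinoid {f : Cinf F → Cinf F}
    (h : ∀ n : ℕ, 1 ≤ n → ∃ B : ℝ, ∀ ε : ℝ, 0 < ε → ∃ P Q : (Cinf F)[X],
      ∀ z ∈ affinoid F n, Q.eval z ≠ 0 ∧ ‖f z - P.eval z / Q.eval z‖ ≤ B * ε) :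
    IsHolomorphic f := by
  intro n hn ε hε
  obtain ⟨B, hB⟩ := h n hn
  obtain ⟨P, Q, hPQ⟩ := hB (ε / (|B| + 1)) (by positivity)
  refine ⟨P, Q, fun z hz => ⟨(hPQ z hz).1, (hPQ z hz).2.trans_lt ?_⟩⟩
  have h1 : B ≤ |B| := le_abs_self B
  rw [mul_div_assoc', div_lt_iff₀ (by positivity)]
  nlinarith

theorem isHolomorphic_const (a : Cinf F) : IsHolomorphic fun _ => a := fun n _ ε hε =>
  ⟨Polynomial.C a, 1, fun z _ => by simpa using hε⟩

theorem IsHolomorphic.const_mul (hf : IsHolomorphic f) (a : Cinf F) :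
    IsHolomorphic fun x => a * f x := by
  refine IsHolomorphic.of_forall_affinoid fun n hn => ⟨‖a‖, fun ε hε => ?_⟩
  obtain ⟨P, Q, h⟩ := hf n hn ε hε
  refine ⟨Polynomial.C a * P, Q, fun z hz => ⟨(h z hz).1, ?_⟩⟩
  rw [eval_mul, eval_C, mul_div_assoc, ← mul_sub, norm_mul]
  exact mul_le_mul_of_nonneg_left (h z hz).2.le (norm_nonneg a)

theorem IsHolomorphic.sum {ι : Type*} (s : Finset ι) {f : ι → Cinf F → Cinf F}
    (hf : ∀ i ∈ s, IsHolomorphic (f i)) : IsHolomorphic fun x => ∑ i ∈ s, f i x := by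
  classical
  induction s using Finset.induction_on with
  | empty => simpa using isHolomorphic_const (0 : Cinf F)
  | insert i s hi ih =>
    simp only [Finset.sum_insert hi]
    exact (hf i (Finset.mem_insert_self i s)).add
      (ih fun j hj => hf j (Finset.mem_insert_of_mem hj))

theorem taylor_eval_eq (P : (Cinf F)[X]) (z : Cinf F) (n : ℕ) :
    hyperderiv n (fun x => P.eval x) z = (hasseDeriv n P).eval z := by
  have h : HasTaylorOn (fun x => P.eval x) z 1 (Polynomial.taylor z P : (Cinf F)[X]) := by
    intro ε _
    have h1 : P.eval (z + ε) = (Polynomial.taylor z P).eval ε := by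
      rw [Polynomial.taylor_eval, add_comm]
    change HasSum _ (P.eval (z + ε))
    rw [h1, Polynomial.eval_eq_sum]
    simp only [Polynomial.coeff_coe]
    refine hasSum_sum_of_ne_finset_zero fun n hn => ?_
    rw [Polynomial.notMem_support_iff.1 hn, zero_mul]
  rw [h.hyperderiv_eq one_pos, Polynomial.coeff_coe, Polynomial.taylor_coeff]

/-- Hyperderivatives of rational functions are rational. -/
theorem exists_hyperderiv_rational (P Q : (Cinf F)[X]) (n : ℕ) :
    ∃ S : (Cinf F)[X], ∀ z, Q.eval z ≠ 0 →
      hyperderiv n (fun x => P.eval x / Q.eval x) z = S.eval z / Q.eval z ^ (n + 1) := by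
  induction n using Nat.strong_induction_on with
  | _ n ih =>
    choose S hS using ih
    -- The Leibniz rule for `(P / Q) * Q = P`, solved for the `n`-th hyperderivative of `P / Q` and
    -- multiplied by `Q ^ n`.
    refine ⟨hasseDeriv n P * Q ^ n - ∑ j : Fin n, hasseDeriv (n - j) Q * S j j.2 * Q ^ (n - 1 - j),
      fun z hz => ?_⟩
    have hQ : AnalyticAt (Cinf F) (fun x => Q.eval x) z := by
      obtain ⟨c, hc⟩ := hasTaylorOn_eval (z := z) (R := 1) Q
      exact hc.analyticAt one_pos
    have hP : AnalyticAt (Cinf F) (fun x => P.eval x) z := by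
      obtain ⟨c, hc⟩ := hasTaylorOn_eval (z := z) (R := 1) P
      exact hc.analyticAt one_pos
    have hPQ : AnalyticAt (Cinf F) (fun x => P.eval x / Q.eval x) z := hP.fun_div hQ hz
    have h1 : taylor (fun x => P.eval x / Q.eval x) z * taylor (fun x => Q.eval x) z =
        taylor (fun x => P.eval x) z := by
      rw [← taylor_mul hPQ hQ]
      refine taylor_congr ?_ (hPQ.fun_mul hQ)
      filter_upwards [hQ.continuousAt.eventually_ne hz] with x hx
      exact div_mul_cancel₀ _ hx
    have h2 := congrArg (PowerSeries.coeff n) h1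
    rw [PowerSeries.coeff_mul, Finset.Nat.sum_antidiagonal_eq_sum_range_succ_mk,
      Finset.sum_range_succ] at h2
    simp only [coeff_taylor, taylor_eval_eq, Nat.sub_self, hasseDeriv_zero] at h2
    rw [LinearMap.id_apply, Finset.sum_range] at h2
    rw [eq_div_iff (pow_ne_zero _ hz), pow_succ', ← mul_assoc, eq_sub_iff_add_eq'.2 h2]
    simp only [eval_sub, eval_mul, eval_pow, eval_finsetSum]
    rw [sub_mul, Finset.sum_mul]
    congr 1
    refine Finset.sum_congr rfl fun j _ => ?_
    rw [hS j j.2 z hz, div_mul_eq_mul_div, div_mul_eq_mul_div, div_eq_iff (pow_ne_zero _ hz)]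
    have h3 : Q.eval z ^ n = Q.eval z ^ (n - 1 - j) * Q.eval z ^ ((j : ℕ) + 1) := by
      rw [← pow_add]
      congr 1
      omega
    rw [h3]
    ring

/-- If `P / Q` approximates `f` on an affinoid, its hyperderivative approximates that of `f`. The
Cauchy estimate loses only the factor `‖δ‖ ^ (-m)`, and one `δ` with $|\delta|<q^{-n}$ serves all
points of $\Omega_n$. -/
theorem IsHolomorphic.hyperderiv (hf : IsHolomorphic f) (m : ℕ) :
    IsHolomorphic (hyperderiv m f) := by
  refine IsHolomorphic.of_forall_affinoid fun n hn => ?_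
  obtain ⟨δ, hδ0, hδ⟩ := NormedField.exists_norm_lt (Cinf F)
    (r := ((q F : ℝ) ^ n)⁻¹) (inv_pos.2 (pow_pos (zero_lt_one.trans one_lt_q_real) n))
  refine ⟨(‖δ‖ ^ m)⁻¹, fun ε hε => ?_⟩
  obtain ⟨P, Q, hPQ⟩ := hf n hn ε hε
  obtain ⟨S, hS⟩ := exists_hyperderiv_rational P Q m
  refine ⟨S, Q ^ (m + 1), fun z hz => ⟨by simpa using fun h => absurd h (hPQ z hz).1, ?_⟩⟩
  have hball : ∀ x, ‖x - z‖ < imNorm z → x ∈ affinoid F n := fun x hx =>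
    mem_affinoid_of_lt hz hx
  obtain ⟨c, hc⟩ := hasTaylorOn_eval_div_eval (z := z) (R := imNorm z) P
    fun x hx => (hPQ x (hball x hx)).1
  have hpos : 0 < imNorm z := imNorm_pos_iff.2 hz.1
  have hsub := (hf.hasTaylorOn hz.1).sub hc
  have h := hsub.norm_hyperderiv_mul_le (fun x hx => (hPQ x (hball x hx)).2.le)
    (hδ.trans_le hz.2.2) m
  rw [hsub.hyperderiv_eq hpos, map_sub, ← hc.hyperderiv_eq hpos, coeff_taylor,
    hS z (hPQ z hz).1, ← eval_pow] at h
  rwa [inv_mul_eq_div, le_div_iff₀ (pow_pos hδ0 m)]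

/-- Where $|z|_i>\max(R,1)$, the disc of radius $|z|_i$ contains a step of norm 1 and stays in the
region where `f` is bounded. The Cauchy estimate then has no loss. -/
theorem IsBoundedOnVerticalLines.hyperderiv (hf : IsHolomorphic f)
    (hb : IsBoundedOnVerticalLines f) (m : ℕ) : IsBoundedOnVerticalLines (hyperderiv m f) := by
  obtain ⟨R, N, hR, hN, h⟩ := hb
  refine ⟨max R 1, N + 1, by positivity, by positivity, fun z hz hzR => ?_⟩
  have hzR' := max_lt_iff.1 hzR
  have h1 := (hf.hasTaylorOn hz).norm_hyperderiv_mul_le (B := N) (fun x hx =>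
    (h x (mem_Omega_of_lt hx) (imNorm_eq_of_lt hx ▸ hzR'.1)).le) (ε := 1)
      (by rw [norm_one]; exact hzR'.2) m
  rw [norm_one, one_pow, mul_one] at h1
  linarith

theorem IsBoundedOnVerticalLines.add (hf : IsBoundedOnVerticalLines f)
    (hg : IsBoundedOnVerticalLines g) : IsBoundedOnVerticalLines fun x => f x + g x := by
  obtain ⟨R, N, hR, hN, h⟩ := hf
  obtain ⟨R', N', hR', hN', h'⟩ := hg
  refine ⟨max R R', N + N', by positivity, by positivity, fun z hz hzR => ?_⟩
  have h1 := h z hz (max_lt_iff.1 hzR).1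
  have h2 := h' z hz (max_lt_iff.1 hzR).2
  exact (norm_add_le _ _).trans_lt (by linarith)

theorem isBoundedOnVerticalLines_zero : IsBoundedOnVerticalLines fun _ : Cinf F => (0 : Cinf F) :=
  ⟨1, 1, one_pos, one_pos, fun z _ _ => by simp⟩

theorem IsBoundedOnVerticalLines.const_mul (hf : IsBoundedOnVerticalLines f) (a : Cinf F) :
    IsBoundedOnVerticalLines fun x => a * f x := by
  obtain ⟨R, N, hR, hN, h⟩ := hf
  refine ⟨R, ‖a‖ * N + 1, hR, by positivity, fun z hz hzR => ?_⟩
  have h1 := h z hz hzR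
  rw [norm_mul]
  nlinarith [norm_nonneg a]

theorem IsBoundedOnVerticalLines.sum {ι : Type*} (s : Finset ι) {f : ι → Cinf F → Cinf F}
    (hf : ∀ i ∈ s, IsBoundedOnVerticalLines (f i)) :
    IsBoundedOnVerticalLines fun x => ∑ i ∈ s, f i x := by
  classical
  induction s using Finset.induction_on with
  | empty => simpa using isBoundedOnVerticalLines_zero
  | insert i s hi ih =>
    simp only [Finset.sum_insert hi]
    exact (hf i (Finset.mem_insert_self i s)).add
      (ih fun j hj => hf j (Finset.mem_insert_of_mem hj))

end DrinfeldMS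

namespace DrinfeldMS

variable {F : Type*} [Field F] [Fintype F]

/-! ### Fractional linear transformations -/

theorem det_eq (γ : GL (Fin 2) (RatFunc F)) :
    ofK F γ.val.det = ofK F (γ.val 0 0) * ofK F (γ.val 1 1) -
      ofK F (γ.val 0 1) * ofK F (γ.val 1 0) := by
  rw [Matrix.det_fin_two, map_sub, map_mul, map_mul]

theorem det_ne_zero (γ : GL (Fin 2) (RatFunc F)) : ofK F γ.val.det ≠ 0 := by
  rw [Ne, map_eq_zero_iff _ (ofK F).injective]
  exact γ.isUnit.map Matrix.detMonoidHom |>.ne_zero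

theorem mul_imNorm_le (α β : Kinf F) (z : Cinf F) :
    ‖α‖ * imNorm z ≤ ‖ofKinf F α * z + ofKinf F β‖ := by
  by_cases hα : α = 0
  · simp [hα]
  · have h0 : ofKinf F α ≠ 0 := (_root_.map_ne_zero _).2 hα
    have h : ofKinf F α * z + ofKinf F β = ofKinf F α * (z - ofKinf F (-β / α)) := by
      rw [map_div₀, map_neg]
      field_simp
      ring
    rw [h, norm_mul, norm_ofKinf]
    exact mul_le_mul_of_nonneg_left (imNorm_le z _) (norm_nonneg _)

/-- A linear form over $K_\infty$ cannot be small on $\Omega_n$ unless its coefficients are: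
$|z|_i\ge q^{-n}$ controls `α`, and then $|z|\le q^n$ controls `β`. -/
theorem max_le_norm_linear (α β : Kinf F) {z : Cinf F} {n : ℕ} (hz : z ∈ affinoid F n) :
    max ‖α‖ ‖β‖ ≤ ((q F : ℝ) ^ n) ^ 2 * ‖ofKinf F α * z + ofKinf F β‖ := by
  set Q := (q F : ℝ) ^ n
  have hQ : 1 ≤ Q := one_le_pow₀ one_lt_q_real.le
  have h1 : ‖α‖ ≤ Q * ‖ofKinf F α * z + ofKinf F β‖ := by
    have h2 : Q * (‖α‖ * Q⁻¹) ≤ Q * ‖ofKinf F α * z + ofKinf F β‖ :=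
      mul_le_mul_of_nonneg_left ((mul_le_mul_of_nonneg_left hz.2.2 (norm_nonneg _)).trans
        (mul_imNorm_le α β z)) (by positivity)
    rwa [mul_comm ‖α‖, mul_inv_cancel_left₀ (by positivity)] at h2
  have hnn := norm_nonneg (ofKinf F α * z + ofKinf F β)
  refine max_le (h1.trans ?_) ?_
  · exact mul_le_mul_of_nonneg_right (le_self_pow₀ hQ two_ne_zero) hnn
  · by_cases h : ‖ofKinf F α * z‖ < ‖ofKinf F β‖
    · rw [add_comm, norm_add_eq_of_lt h, norm_ofKinf]
      nlinarith [norm_nonneg β, one_le_pow₀ hQ (n := 2)]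
    · rw [not_lt, norm_mul, norm_ofKinf, norm_ofKinf] at h
      have h3 : ‖α‖ * ‖z‖ ≤ (Q * ‖ofKinf F α * z + ofKinf F β‖) * Q :=
        mul_le_mul h1 hz.2.1 (norm_nonneg _) (by positivity)
      linarith

theorem norm_linear_le (α β : Kinf F) {z : Cinf F} {n : ℕ} (hz : z ∈ affinoid F n) :
    ‖ofKinf F α * z + ofKinf F β‖ ≤ ‖α‖ * (q F : ℝ) ^ n + ‖β‖ := by
  refine (norm_add_le _ _).trans ?_
  rw [norm_mul, norm_ofKinf, norm_ofKinf]
  gcongr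
  exact hz.2.1

theorem exists_jFactor_bounds (γ : GL (Fin 2) (RatFunc F)) (n : ℕ) :
    ∃ l u : ℝ, 0 < l ∧ 0 < u ∧ ∀ z ∈ affinoid F n, l ≤ ‖jFactor γ z‖ ∧ ‖jFactor γ z‖ ≤ u := by
  set c := ratToKinf F (γ.val 1 0)
  set d := ratToKinf F (γ.val 1 1)
  have hQ : 0 < ((q F : ℝ) ^ n) ^ 2 := by
    have := one_lt_q_real (F := F)
    positivity
  have hcd : 0 < max ‖c‖ ‖d‖ := by
    by_contra! h
    have hc : c = 0 := norm_le_zero_iff.1 ((le_max_left _ _).trans h)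
    have hd : d = 0 := norm_le_zero_iff.1 ((le_max_right _ _).trans h)
    refine det_ne_zero γ ?_
    rw [det_eq, show ofK F (γ.val 1 1) = ofKinf F d from rfl,
      show ofK F (γ.val 1 0) = ofKinf F c from rfl, hc, hd]
    simp
  refine ⟨(((q F : ℝ) ^ n) ^ 2)⁻¹ * max ‖c‖ ‖d‖, ‖c‖ * (q F : ℝ) ^ n + ‖d‖ + 1, by positivity,
    by positivity, fun z hz => ⟨?_, (norm_linear_le c d hz).trans (by linarith)⟩⟩
  rw [inv_mul_le_iff₀ hQ]
  exact max_le_norm_linear c d hz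

/-- For $e\in K_\infty$ the numerator of $\gamma z-e$ is the linear form with coefficients $a-ec$
and $b-ed$. These are not both small, because $d(a-ec)-c(b-ed)=\det\gamma$. This bounds $|\gamma
z|_i$ from below uniformly on $\Omega_n$. -/
theorem exists_mobius_mem_affinoid (γ : GL (Fin 2) (RatFunc F)) (n : ℕ) :
    ∃ n', 1 ≤ n' ∧ ∀ z ∈ affinoid F n, mobius γ z ∈ affinoid F n' := by
  obtain ⟨l, u, hl, hu, hj⟩ := exists_jFactor_bounds γ n
  set a := ratToKinf F (γ.val 0 0) with ha
  set b := ratToKinf F (γ.val 0 1) with hb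
  set c := ratToKinf F (γ.val 1 0) with hc
  set d := ratToKinf F (γ.val 1 1) with hd
  set Q := (q F : ℝ) ^ n
  have hQ : 1 ≤ Q := one_le_pow₀ one_lt_q_real.le
  set D := a * d - b * c with hD
  have hD0 : 0 < ‖D‖ := by
    rw [norm_pos_iff]
    intro h
    refine det_ne_zero γ ?_
    rw [det_eq]
    have h' : ofKinf F a * ofKinf F d - ofKinf F b * ofKinf F c = 0 := by
      rw [← (ofKinf F).map_mul a d, ← (ofKinf F).map_mul b c,
        ← (ofKinf F).map_sub (a * d) (b * c), ← hD, h, map_zero]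
    exact h'
  have him : ∀ z ∈ affinoid F n, ‖D‖ / ((‖d‖ + ‖c‖) * Q ^ 2 * u) ≤ imNorm (mobius γ z) := by
    intro z hz
    refine le_imNorm fun e => ?_
    have hj0 : jFactor γ z ≠ 0 := jFactor_ne_zero γ hz.1
    have h1 : mobius γ z - ofKinf F e =
        (ofKinf F (a - e * c) * z + ofKinf F (b - e * d)) / jFactor γ z := by
      rw [mobius, eq_div_iff hj0, sub_mul, div_mul_cancel₀ _ hj0]
      change ofKinf F a * z + ofKinf F b - ofKinf F e * (ofKinf F c * z + ofKinf F d) = _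
      simp only [map_sub, map_mul]
      ring
    have h2 := max_le_norm_linear (a - e * c) (b - e * d) hz
    have h3 : ‖D‖ ≤ (‖d‖ + ‖c‖) * max ‖a - e * c‖ ‖b - e * d‖ := by
      have h4 : D = d * (a - e * c) - c * (b - e * d) := by rw [hD]; ring
      rw [h4]
      refine (norm_sub_le _ _).trans ?_
      rw [norm_mul, norm_mul, add_mul]
      gcongr
      · exact le_max_left _ _
      · exact le_max_right _ _
    have hcd : 0 < ‖d‖ + ‖c‖ := by
      by_contra! h
      have := h3.trans (mul_nonpos_of_nonpos_of_nonneg h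
        (le_max_of_le_left (norm_nonneg (a - e * c))))
      linarith
    have h5 := (hj z hz)
    rw [h1, norm_div, div_le_div_iff₀ (by positivity) (hl.trans_le h5.1)]
    have h6 : ‖D‖ ≤ (‖d‖ + ‖c‖) * (Q ^ 2 * ‖ofKinf F (a - e * c) * z + ofKinf F (b - e * d)‖) :=
      h3.trans (mul_le_mul_of_nonneg_left h2 hcd.le)
    calc ‖D‖ * ‖jFactor γ z‖ ≤ ‖D‖ * u := by gcongr; exact h5.2
      _ ≤ _ := by
        refine (mul_le_mul_of_nonneg_right h6 hu.le).trans (le_of_eq ?_)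
        ring
  by_cases hne : (affinoid F n).Nonempty
  · obtain ⟨z₀, hz₀⟩ := hne
    have hcd : 0 < ‖d‖ + ‖c‖ := by
      rcases (add_nonneg (norm_nonneg d) (norm_nonneg c)).eq_or_lt with h | h
      · exfalso
        have hd0 : ‖d‖ = 0 := by linarith [norm_nonneg d, norm_nonneg c]
        have hc0 : ‖c‖ = 0 := by linarith [norm_nonneg d, norm_nonneg c]
        rw [norm_eq_zero] at hd0 hc0
        rw [hD, hd0, hc0] at hD0
        simp at hD0
      · exact h
    set B := ‖D‖ / ((‖d‖ + ‖c‖) * Q ^ 2 * u) with hB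
    have hB0 : 0 < B := by positivity
    obtain ⟨N, hN⟩ := pow_unbounded_of_one_lt (max ((‖a‖ * Q + ‖b‖) / l) B⁻¹)
      (one_lt_q_real (F := F))
    have hle : (q F : ℝ) ^ N ≤ (q F : ℝ) ^ (N + 1) :=
      pow_le_pow_right₀ one_lt_q_real.le N.le_succ
    refine ⟨N + 1, by omega, fun z hz => ⟨?_, ?_, ?_⟩⟩
    · rw [← imNorm_pos_iff]
      exact hB0.trans_le (him z hz)
    · refine le_trans ?_ (((le_max_left _ _).trans hN.le).trans hle)
      rw [mobius, norm_div]
      exact div_le_div₀ (by positivity) (norm_linear_le a b hz) hl (hj z hz).1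
    · refine le_trans ?_ (him z hz)
      exact inv_le_of_inv_le₀ hB0 (((le_max_right _ _).trans hN.le).trans hle)
  · exact ⟨1, le_rfl, fun z hz => absurd ⟨z, hz⟩ hne⟩

theorem mobius_mem_Omega (γ : GL (Fin 2) (RatFunc F)) {z : Cinf F} (hz : z ∈ Omega F) :
    mobius γ z ∈ Omega F := by
  obtain ⟨n, -, hn⟩ := exists_mem_affinoid hz
  obtain ⟨n', -, h⟩ := exists_mobius_mem_affinoid γ n
  exact (h z hn).1

theorem exists_homogenize (γ : GL (Fin 2) (RatFunc F)) (P : (Cinf F)[X]) {N : ℕ}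
    (hN : P.natDegree ≤ N) : ∃ S : (Cinf F)[X], ∀ z, jFactor γ z ≠ 0 →
      S.eval z = jFactor γ z ^ N * P.eval (mobius γ z) := by
  set A : (Cinf F)[X] := Polynomial.C (ofK F (γ.val 0 0)) * X + Polynomial.C (ofK F (γ.val 0 1))
  set J : (Cinf F)[X] := Polynomial.C (ofK F (γ.val 1 0)) * X + Polynomial.C (ofK F (γ.val 1 1))
  refine ⟨∑ i ∈ Finset.range (N + 1), Polynomial.C (P.coeff i) * A ^ i * J ^ (N - i),
    fun z hz => ?_⟩
  rw [Polynomial.eval_eq_sum_range' (Nat.lt_succ_of_le hN), Finset.mul_sum, eval_finsetSum]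
  refine Finset.sum_congr rfl fun i hi => ?_
  have hA : A.eval z = jFactor γ z * mobius γ z := by
    rw [mobius, mul_div_cancel₀ _ hz]
    simp [A]
  have hJ : J.eval z = jFactor γ z := by simp [J, jFactor]
  rw [eval_mul, eval_mul, eval_C, eval_pow, eval_pow, hA, hJ, mul_pow]
  have h : jFactor γ z ^ N = jFactor γ z ^ i * jFactor γ z ^ (N - i) := by
    rw [← pow_add, Nat.add_sub_cancel' (Nat.lt_succ_iff.1 (Finset.mem_range.1 hi))]
  rw [h]
  ring

/-- Pulling back a rational approximation gives a rational function again. Numerator and denominator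
are homogenized to the same degree, so the powers of `jFactor` cancel. The factor `jFactor ^ t` is
bounded on each affinoid. -/
theorem IsHolomorphic.comp_mobius {f : Cinf F → Cinf F} (hf : IsHolomorphic f)
    (γ : GL (Fin 2) (RatFunc F)) (t : ℤ) :
    IsHolomorphic fun z => jFactor γ z ^ t * f (mobius γ z) := by
  refine IsHolomorphic.of_forall_affinoid fun n _ => ?_
  obtain ⟨l, u, hl, hu, hj⟩ := exists_jFactor_bounds γ n
  obtain ⟨n', hn', hmem⟩ := exists_mobius_mem_affinoid γ n
  refine ⟨max (u ^ t.toNat) 1 * max (l⁻¹ ^ (-t).toNat) 1, fun ε hε => ?_⟩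
  obtain ⟨P, Q, hPQ⟩ := hf n' hn' ε hε
  obtain ⟨P', hP'⟩ := exists_homogenize γ P (le_max_left P.natDegree Q.natDegree)
  obtain ⟨Q', hQ'⟩ := exists_homogenize γ Q (le_max_right P.natDegree Q.natDegree)
  set J : (Cinf F)[X] := Polynomial.C (ofK F (γ.val 1 0)) * X + Polynomial.C (ofK F (γ.val 1 1))
  refine ⟨P' * J ^ t.toNat, Q' * J ^ (-t).toNat, fun z hz => ?_⟩
  have hj0 : jFactor γ z ≠ 0 := jFactor_ne_zero γ hz.1
  have hJ : J.eval z = jFactor γ z := by simp [J, jFactor]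
  obtain ⟨h1, h2⟩ := hPQ _ (hmem z hz)
  have hzpow : jFactor γ z ^ t = jFactor γ z ^ t.toNat / jFactor γ z ^ (-t).toNat := by
    rw [← zpow_natCast, ← zpow_natCast, ← zpow_sub₀ hj0]
    congr 1
    omega
  refine ⟨?_, ?_⟩
  · rw [eval_mul, eval_pow, hJ, hQ' z hj0]
    exact mul_ne_zero (mul_ne_zero (pow_ne_zero _ hj0) h1) (pow_ne_zero _ hj0)
  · have h3 : jFactor γ z ^ t * f (mobius γ z) -
        (P' * J ^ t.toNat).eval z / (Q' * J ^ (-t).toNat).eval z =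
        jFactor γ z ^ t *
          (f (mobius γ z) - P.eval (mobius γ z) / Q.eval (mobius γ z)) := by
      rw [eval_mul, eval_mul, eval_pow, eval_pow, hJ, hP' z hj0, hQ' z hj0, hzpow, mul_sub]
      congr 1
      field_simp
    rw [h3, norm_mul]
    refine mul_le_mul ?_ h2.le (norm_nonneg _) (by positivity)
    rw [hzpow, norm_div, norm_pow, norm_pow, div_eq_mul_inv, ← inv_pow]
    have h4 := hj z hz
    refine mul_le_mul ((pow_le_pow_left₀ (norm_nonneg _) h4.2 _).trans (le_max_left _ _))
      ((pow_le_pow_left₀ (by positivity) (inv_anti₀ hl h4.1) _).trans (le_max_left _ _))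
      (by positivity) (by positivity)

end DrinfeldMS

namespace DrinfeldMS

variable {F : Type*} [Field F] [Fintype F]

/-! ### Uniqueness of the coefficients of nearly holomorphic functions -/

section Recenter

variable {f : Cinf F → Cinf F} {z₀ z : Cinf F} {R : ℝ} {c : PowerSeries (Cinf F)}

/-- Every point of an ultrametric disc is a centre. The partial sums are polynomials, hence
expandable at `z`, and they converge uniformly on the smaller disc of radius `‖ε₁‖`. -/
theorem HasTaylorOn.exists_recenter (hf : HasTaylorOn f z₀ R c) {ε₁ : Cinf F}
    (hε₁ : ‖ε₁‖ < R) (hz : ‖z - z₀‖ < ‖ε₁‖) : ∃ d, HasTaylorOn f z ‖ε₁‖ d := by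
  obtain ⟨p, hp, hchar⟩ := exists_charP_Cinf F
  have : Fact p.Prime := ⟨hp⟩
  choose P hP using fun k : ℕ => hasTaylorOn_eval (z := z) (R := ‖ε₁‖)
    (∑ i ∈ Finset.range k, Polynomial.C (c.coeff i) * (X - Polynomial.C z₀) ^ i)
  obtain ⟨d, hd, -⟩ := HasTaylorOn.of_uniform_limit (p := p) (f := f)
    ((norm_nonneg _).trans_lt hz) hP fun η hη => by
      obtain ⟨K, hK⟩ := eventually_atTop.1
        ((summable_iff_tendsto_norm.1 (hf ε₁ hε₁).summable).eventually_lt_const hη)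
      refine eventually_atTop.2 ⟨K, fun k hk x hx => ?_⟩
      have hx0 : ‖x - z₀‖ ≤ ‖ε₁‖ := by
        have h := norm_add_le_of_le hx.le hz.le
        rwa [sub_add_sub_cancel] at h
      have hsum := (hasSum_nat_add_iff' k).2 (hf (x - z₀) (hx0.trans_lt hε₁))
      rw [add_sub_cancel] at hsum
      simp only [eval_finsetSum, eval_mul, eval_C, eval_pow, eval_sub, eval_X]
      refine norm_hasSum_le hsum fun i => ?_
      refine le_trans ?_ (hK (i + k) (by omega)).le
      rw [norm_mul, norm_mul, norm_pow, norm_pow]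
      gcongr
  exact ⟨d, hd⟩

theorem HasTaylorOn.eq_zero_of_eventually (hf : HasTaylorOn f z R c)
    (h : ∀ᶠ x in 𝓝 z, f x = 0) {x : Cinf F} (hx : ‖x - z‖ < R) : f x = 0 := by
  have hR := (norm_nonneg _).trans_lt hx
  have hc : c = 0 := by
    rw [← hf.taylor_eq hR, taylor_congr h (hf.analyticAt hR), taylor_const, map_zero]
  have h1 := hf (x - z) hx
  rw [add_sub_cancel, hc] at h1
  simpa using h1.unique (by simp)

end Recenter

variable {ψ : SigmaExtension F} {M : NrExtension F} {ρ : Cinf F}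

theorem sigma_apply_of_mem_fqBar (ψ : SigmaExtension F) {α : Cinf F} (hα : α ∈ fqBar F) :
    ψ α = α ^ q F := by
  have h0 : (0 : Cinf F) ∈ fqBar F := ⟨X, monic_X, by simp⟩
  have hq : q F ≠ 0 := (zero_lt_one.trans (one_lt_q F)).ne'
  have h := ψ.map_series 0 (fun i => if i = 0 then α else 0) fun i => by
    split_ifs
    · exact hα
    · exact h0
  rw [tsum_eq_single 0 fun i hi => by simp [hi], tsum_eq_single 0 fun i hi => by simp [hi, hq]] at h
  simpa using h

/-- On such an `α` the Frobenius is translation by 1, so adding $K_\infty$-multiples of `α` to `z`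
moves $z-\psi(z)$ by prescribed elements of $K_\infty$. -/
theorem exists_mem_fqBar_pow_eq_add_one : ∃ α ∈ fqBar F, α ^ q F = α + 1 := by
  have hmonic : ∀ (R : Type _) [CommRing R] [Nontrivial R],
      (X ^ q F - (X + 1 : R[X])).Monic ∧ (X ^ q F - (X + 1 : R[X])).natDegree = q F := by
    intro R _ _
    have hdeg : (X + 1 : R[X]).degree < q F := by
      rw [← Polynomial.C_1, degree_X_add_C]
      exact_mod_cast one_lt_q F
    refine ⟨monic_X_pow_sub (by simpa using hdeg), ?_⟩
    rw [natDegree_sub_eq_left_of_natDegree_lt, natDegree_X_pow]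
    rw [natDegree_X_pow, ← Polynomial.C_1, natDegree_X_add_C]
    exact one_lt_q F
  obtain ⟨α, hα⟩ := IsAlgClosed.exists_root (X ^ q F - (X + 1 : (Cinf F)[X])) (by
    rw [degree_eq_natDegree (hmonic (Cinf F)).1.ne_zero, (hmonic (Cinf F)).2]
    exact_mod_cast (zero_lt_one.trans (one_lt_q F)).ne')
  have hα' : α ^ q F - (α + 1) = 0 := by simpa [IsRoot.def] using hα
  exact ⟨α, ⟨_, (hmonic F).1, by simpa using hα'⟩, sub_eq_zero.1 hα'⟩

/-- The translate of a point of `Ω^ψ(M)` by an element of `K_∞`. -/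
def omegaTranslate (z : OmegaPsi ψ M) (ε : Kinf F) : OmegaPsi ψ M :=
  ⟨z + ofKinf F ε, add_mem z.2.1 (ofKinf_mem M ε), fun h => z.2.2 (by
    rw [map_add, ψ.map_kinf] at h
    exact add_right_cancel h)⟩

/-- The value of `(π̃ Id - π̃ ψ)⁻¹` at a point. -/
def nhX (ρ : Cinf F) (z : OmegaPsi ψ M) : Cinf F :=
  (carlitzPeriod ρ * z - carlitzPeriod ρ * ψ z)⁻¹

theorem nhTerm_eq (i : ℕ) (f : Cinf F → Cinf F) (z : OmegaPsi ψ M) :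
    nhTerm ρ i f z = f z * nhX ρ z ^ i := by
  rw [nhTerm, nhX, inv_pow, div_eq_mul_inv]

theorem nhX_translate (z : OmegaPsi ψ M) (ε : Kinf F) : nhX ρ (omegaTranslate z ε) = nhX ρ z := by
  simp only [nhX, omegaTranslate, map_add, ψ.map_kinf]
  congr 1
  ring

theorem nhX_ne_zero (hπ : carlitzPeriod ρ ≠ 0) (z : OmegaPsi ψ M) : nhX ρ z ≠ 0 := by
  rw [nhX, ← mul_sub]
  exact inv_ne_zero (mul_ne_zero hπ (sub_ne_zero.2 (Ne.symm z.2.2)))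

/-- For $z=z_0+\alpha\theta^{-n}$ with $\alpha^q=\alpha+1$ one has
$z-\psi(z)=z_0-\psi(z_0)-\theta^{-n}$. These values are distinct, and they are nonzero for large
`n`. -/
theorem infinite_nhX (hπ : carlitzPeriod ρ ≠ 0) (z₀ : OmegaPsi ψ M) {r : ℝ} (hr : 0 < r) :
    (nhX ρ '' {z : OmegaPsi ψ M | ‖(z : Cinf F) - z₀‖ < r}).Infinite := by
  obtain ⟨α, hα, hαq⟩ := exists_mem_fqBar_pow_eq_add_one (F := F)
  have hαM : α ∈ M.1 := M.2 (Subfield.le_topologicalClosure _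
    (Subfield.subset_closure (Set.mem_union_right _ hα)))
  set τ : Kinf F := (ratToKinf F RatFunc.X)⁻¹
  have hτ0 : τ ≠ 0 := inv_ne_zero ((_root_.map_ne_zero _).2 RatFunc.X_ne_zero)
  have hτ : ‖τ‖ < 1 := by
    rw [norm_inv, norm_ratToKinf, inftyAbs_apply F RatFunc.X_ne_zero, RatFunc.intDegree_X,
      zpow_one]
    exact inv_lt_one_of_one_lt₀ one_lt_q_real
  have hlim : Tendsto (fun n : ℕ => ‖τ‖ ^ n) atTop (𝓝 0) :=
    tendsto_pow_atTop_nhds_zero_of_lt_one (norm_nonneg _) hτ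
  set w₀ := (z₀ : Cinf F) - ψ z₀
  have hw₀ : w₀ ≠ 0 := sub_ne_zero.2 (Ne.symm z₀.2.2)
  obtain ⟨N, hN⟩ := eventually_atTop.1 ((hlim.eventually_lt_const (norm_pos_iff.2 hw₀)).and
    ((by simpa using hlim.const_mul ‖α‖ :
      Tendsto (fun n : ℕ => ‖α‖ * ‖τ‖ ^ n) atTop (𝓝 0)).eventually_lt_const hr))
  have hψ : ∀ n : ℕ, (z₀ + α * ofKinf F (τ ^ n) : Cinf F) - ψ (z₀ + α * ofKinf F (τ ^ n)) =
      w₀ - ofKinf F (τ ^ n) := fun n => by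
    rw [map_add, map_mul, ψ.map_kinf, sigma_apply_of_mem_fqBar ψ hα, hαq]
    ring
  have hmem : ∀ n, N ≤ n → (z₀ + α * ofKinf F (τ ^ n) : Cinf F) ∈ OmegaPsi ψ M := fun n hn => by
    refine ⟨add_mem z₀.2.1 (mul_mem hαM (ofKinf_mem M _)), fun h => ?_⟩
    have h1 := hψ n
    rw [h, sub_self, eq_comm, sub_eq_zero] at h1
    have h2 := (hN n hn).1
    rw [h1, norm_ofKinf, norm_pow] at h2
    exact lt_irrefl _ h2
  refine Set.infinite_of_injective_forall_mem
    (f := fun n : ℕ => (carlitzPeriod ρ * (w₀ - ofKinf F (τ ^ (n + N))))⁻¹) ?_ fun n => ?_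
  · intro m n hmn
    have h1 := mul_left_cancel₀ hπ (inv_injective hmn)
    have h2 := (ofKinf F).injective (sub_right_injective h1)
    have h3 := congrArg norm h2
    rw [norm_pow, norm_pow] at h3
    have h4 := (pow_right_injective₀ (norm_pos_iff.2 hτ0) hτ.ne) h3
    omega
  · refine ⟨⟨_, hmem (n + N) (by omega)⟩, ?_, ?_⟩
    · simp only [Set.mem_ofPred_eq, add_sub_cancel_left]
      rw [norm_mul, norm_ofKinf, norm_pow]
      exact (hN (n + N) (by omega)).2
    · rw [nhX, ← mul_sub, hψ]

/-- Local uniqueness of the coefficients. The argument of the `f i` and the value of $X$ can be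
varied independently: the first along $K_\infty$, which leaves $X$ fixed, the second by moving `z`.
-/
theorem eventually_eq_zero_of_nhSum_eq_zero (hπ : carlitzPeriod ρ ≠ 0) {z₀ : OmegaPsi ψ M} {s : ℕ}
    {f : ℕ → Cinf F → Cinf F} (hf : ∀ i ≤ s, AnalyticAt (Cinf F) (f i) z₀)
    (h : ∀ᶠ z in 𝓝 z₀, nhSum ρ s f z = 0) : ∀ i ≤ s, ∀ᶠ x in 𝓝 (z₀ : Cinf F), f i x = 0 := by
  obtain ⟨R, hR, hRf, hRz⟩ : ∃ R : ℝ, 0 < R ∧ (∀ i ∈ Finset.range (s + 1),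
      HasTaylorOn (f i) z₀ R (taylor (f i) z₀)) ∧
      ∀ z : OmegaPsi ψ M, ‖(z : Cinf F) - z₀‖ < R → nhSum ρ s f z = 0 := by
    have h1 : ∀ᶠ R in 𝓝[>] (0 : ℝ), ∀ i ∈ Finset.range (s + 1),
        HasTaylorOn (f i) z₀ R (taylor (f i) z₀) := by
      rw [Filter.eventually_all_finset]
      intro i hi
      obtain ⟨R, hR, hc⟩ := exists_hasTaylorOn_taylor
        (hf i (Nat.lt_succ_iff.1 (Finset.mem_range.1 hi)))
      filter_upwards [Ioc_mem_nhdsGT hR] with R' hR'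
      exact hc.mono hR'.2
    have h2 : ∀ᶠ R in 𝓝[>] (0 : ℝ), ∀ z : OmegaPsi ψ M, ‖(z : Cinf F) - z₀‖ < R →
        nhSum ρ s f z = 0 := by
      obtain ⟨R, hR, hz⟩ := Metric.eventually_nhds_iff.1 h
      filter_upwards [Ioc_mem_nhdsGT hR] with R' hR' z hzR
      refine hz (y := z) ?_
      rw [Subtype.dist_eq, dist_eq_norm]
      exact hzR.trans_le hR'.2
    obtain ⟨R, hR⟩ := (h1.and (h2.and self_mem_nhdsWithin)).exists
    exact ⟨R, hR.2.2, hR.1, hR.2.1⟩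
  obtain ⟨ε₁, hε₀, hε₁⟩ := NormedField.exists_norm_lt (Cinf F) hR
  have key : ∀ z : OmegaPsi ψ M, ‖(z : Cinf F) - z₀‖ < ‖ε₁‖ → ∀ x : Cinf F, ‖x - z₀‖ < ‖ε₁‖ →
      ∑ i ∈ Finset.range (s + 1), f i x * nhX ρ z ^ i = 0 := by
    intro z hz x hx
    -- Expanding at `z` on a disc of the same radius as the one around `z₀` ensures that every `x`
    -- near `z₀` is reached, uniformly in `z`.
    choose! d hd using fun (i : ℕ) (hi : i ∈ Finset.range (s + 1)) =>
      (hRf i hi).exists_recenter hε₁ hz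
    have hsum := HasTaylorOn.sum (Finset.range (s + 1)) fun i hi =>
      (hd i hi).mul (hasTaylorOn_const (nhX ρ z ^ i))
    refine hsum.eq_zero_of_eventually ?_ (x := x) ?_
    -- Identity theorem: with $X(z)$ fixed, the function of `x` vanishes at all points
    -- $z+\varepsilon$ with small $\varepsilon\in K_\infty$, and these accumulate at `z`.
    · refine ((hsum.analyticAt hε₀).frequently_eq_iff_eventually_eq analyticAt_const).1 ?_
      have ht : Tendsto (fun ε : Kinf F => (z : Cinf F) + ofKinf F ε) (𝓝[≠] 0)
          (𝓝[≠] (z : Cinf F)) := by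
        refine tendsto_nhdsWithin_iff.2 ⟨?_, ?_⟩
        · have hcont : Continuous fun ε : Kinf F => (z : Cinf F) + ofKinf F ε :=
            continuous_const.add (isometry_ofKinf F).continuous
          simpa using (hcont.tendsto 0).mono_left nhdsWithin_le_nhds
        · filter_upwards [self_mem_nhdsWithin] with ε hε
          simpa using hε
      refine ht.frequently (Eventually.frequently ?_)
      have hball : ∀ᶠ ε : Kinf F in 𝓝[≠] 0, ‖ε‖ < ‖ε₁‖ := by
        refine eventually_nhdsWithin_of_eventually_nhds ?_
        filter_upwards [Metric.ball_mem_nhds (0 : Kinf F) hε₀] with ε hε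
        simpa using hε
      filter_upwards [hball] with ε hε
      have h1 := hRz (omegaTranslate z ε) (by
        have h2 := norm_add_le_of_le hz.le ((norm_ofKinf F ε).trans_le hε.le)
        rw [sub_add_eq_add_sub] at h2
        exact h2.trans_lt hε₁)
      simp only [nhSum, nhTerm_eq, nhX_translate] at h1
      exact h1
    · have h3 := IsUltrametricDist.norm_add_le_max (x - z₀) (z₀ - (z : Cinf F))
      rw [sub_add_sub_cancel] at h3
      exact h3.trans_lt (max_lt hx (by rwa [norm_sub_rev]))
  intro i hi
  filter_upwards [Metric.ball_mem_nhds (z₀ : Cinf F) hε₀] with x hx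
  rw [mem_ball_iff_norm] at hx
  set P : (Cinf F)[X] := ∑ i ∈ Finset.range (s + 1), Polynomial.C (f i x) * X ^ i with hP
  have hP0 : P = 0 := by
    refine Polynomial.eq_zero_of_infinite_isRoot P ((infinite_nhX hπ z₀ hε₀).mono ?_)
    rintro _ ⟨z, hz, rfl⟩
    simpa [hP, IsRoot.def, eval_finsetSum] using key z hz x hx
  have hcoeff := congrArg (fun p => Polynomial.coeff p i) hP0
  simpa [hP, Polynomial.finsetSum_coeff, Polynomial.coeff_C_mul, Polynomial.coeff_X_pow,
    Nat.lt_succ_iff, hi] using hcoeff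

/-! ### The Maass-Shimura operators in terms of local expansions -/

theorem hyperderiv_congr {f g : Cinf F → Cinf F} {z : Cinf F} (h : ∀ᶠ x in 𝓝 z, f x = g x)
    (hf : AnalyticAt (Cinf F) f z) (n : ℕ) : hyperderiv n f z = hyperderiv n g z := by
  rw [← coeff_taylor, taylor_congr h hf, coeff_taylor]

theorem msTerm_congr {f g : Cinf F → Cinf F} {z : OmegaPsi ψ M}
    (h : ∀ᶠ x in 𝓝 (z : Cinf F), f x = g x) (hf : AnalyticAt (Cinf F) f z) (k r μ : ℕ) :
    msTerm ρ k r μ f z = msTerm ρ k r μ g z := by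
  simp only [msTerm, nhTerm, del, hyperderiv_congr h hf]

theorem hyperderiv_zero_fun (n : ℕ) (z : Cinf F) : hyperderiv n 0 z = 0 := by
  rw [← coeff_taylor, Pi.zero_def, taylor_const, map_zero, map_zero]

theorem msTerm_zero_fun (k r μ : ℕ) (z : OmegaPsi ψ M) : msTerm ρ k r μ 0 z = 0 := by
  simp [msTerm, nhTerm, del, hyperderiv_zero_fun]

/-- Extension of a finite family of coefficients by zero. -/
def padCoeff (s : ℕ) (f : ℕ → Cinf F → Cinf F) (i : ℕ) : Cinf F → Cinf F :=
  if i ≤ s then f i else 0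

theorem sum_padCoeff {s S : ℕ} (h : s ≤ S) (f : ℕ → Cinf F → Cinf F)
    (T : ℕ → (Cinf F → Cinf F) → Cinf F) (hT : ∀ i, T i 0 = 0) :
    ∑ i ∈ Finset.range (S + 1), T i (padCoeff s f i) = ∑ i ∈ Finset.range (s + 1), T i (f i) := by
  rw [← Finset.sum_subset (Finset.range_mono (Nat.succ_le_succ h))]
  · refine Finset.sum_congr rfl fun i hi => ?_
    rw [padCoeff, if_pos (Nat.lt_succ_iff.1 (Finset.mem_range.1 hi))]
  · intro i _ hi
    rw [padCoeff, if_neg (fun h => hi (Finset.mem_range.2 (Nat.lt_succ_iff.2 h))), hT]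

theorem nhSum_padCoeff {s S : ℕ} (h : s ≤ S) (f : ℕ → Cinf F → Cinf F) (z : OmegaPsi ψ M) :
    nhSum ρ S (padCoeff s f) z = nhSum ρ s f z :=
  sum_padCoeff h f (fun i g => nhTerm ρ i g z) fun i => by simp [nhTerm]

theorem analyticAt_padCoeff {s : ℕ} {f : ℕ → Cinf F → Cinf F} {z : Cinf F}
    (hf : ∀ i ≤ s, AnalyticAt (Cinf F) (f i) z) (i : ℕ) :
    AnalyticAt (Cinf F) (padCoeff s f i) z := by
  rw [padCoeff]
  split_ifs with h
  · exact hf i h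
  · exact analyticAt_const

theorem sum_msTerm_eq_of_nhSum_eq (hπ : carlitzPeriod ρ ≠ 0) {z : OmegaPsi ψ M} {s s' : ℕ}
    {f f' : ℕ → Cinf F → Cinf F} (hf : ∀ i ≤ s, AnalyticAt (Cinf F) (f i) z)
    (hf' : ∀ i ≤ s', AnalyticAt (Cinf F) (f' i) z)
    (h : ∀ᶠ w in 𝓝 z, nhSum ρ s f w = nhSum ρ s' f' w) (k r : ℕ) :
    ∑ i ∈ Finset.range (s + 1), msTerm ρ k r i (f i) z =
      ∑ i ∈ Finset.range (s' + 1), msTerm ρ k r i (f' i) z := by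
  set S := max s s'
  rw [← sum_padCoeff (le_max_left s s') f (fun i g => msTerm ρ k r i g z)
    fun i => msTerm_zero_fun k r i z, ← sum_padCoeff (le_max_right s s') f'
    (fun i g => msTerm ρ k r i g z) fun i => msTerm_zero_fun k r i z]
  refine Finset.sum_congr rfl fun i hi => ?_
  refine msTerm_congr ?_ (analyticAt_padCoeff hf i) k r i
  have h0 := eventually_eq_zero_of_nhSum_eq_zero (s := S) hπ
    (f := fun i x => padCoeff s f i x - padCoeff s' f' i x)
    (fun i _ => (analyticAt_padCoeff hf i).fun_sub (analyticAt_padCoeff hf' i)) (by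
      filter_upwards [h] with w hw
      rw [← nhSum_padCoeff (le_max_left s s') f, ← nhSum_padCoeff (le_max_right s s') f',
        ← sub_eq_zero] at hw
      rw [← hw]
      simp only [nhSum, nhTerm, ← Finset.sum_sub_distrib, sub_div]
      rfl) i (Nat.lt_succ_iff.1 (Finset.mem_range.1 hi))
  filter_upwards [h0] with x hx using sub_eq_zero.1 hx

/-- The value at `z` may be computed from any analytic expansion valid near `z`, not only from a
global one. This is needed at the cusps, where expansions exist only for small $|u|$. -/
theorem maassShimura_apply (hπ : carlitzPeriod ρ ≠ 0) {G : OmegaPsi ψ M → Cinf F}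
    {s₀ : ℕ} {f₀ : ℕ → Cinf F → Cinf F} (hG : HasExpansion ρ G s₀ f₀) {z : OmegaPsi ψ M} {s : ℕ}
    {f : ℕ → Cinf F → Cinf F} (hf : ∀ i ≤ s, AnalyticAt (Cinf F) (f i) z)
    (h : ∀ᶠ w in 𝓝 z, G w = nhSum ρ s f w) (k r : ℕ) :
    maassShimura ρ k r G z = ∑ i ∈ Finset.range (s + 1), msTerm ρ k r i (f i) z := by
  have hex : ∃ p : ℕ × (ℕ → Cinf F → Cinf F), HasExpansion ρ G p.1 p.2 := ⟨(s₀, f₀), hG⟩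
  rw [maassShimura, dif_pos hex]
  refine sum_msTerm_eq_of_nhSum_eq hπ (fun i hi => (hex.choose_spec.1 i hi).analyticAt
    (OmegaPsi_subset_Omega ψ M z.2)) hf ?_ k r
  filter_upwards [h] with w hw
  rw [← hw]
  conv_rhs => rw [hex.choose_spec.2]

theorem maassShimura_eq (hπ : carlitzPeriod ρ ≠ 0) {G : OmegaPsi ψ M → Cinf F}
    {s : ℕ} {f : ℕ → Cinf F → Cinf F} (hG : HasExpansion ρ G s f) (k r : ℕ) (z : OmegaPsi ψ M) :
    maassShimura ρ k r G z = ∑ i ∈ Finset.range (s + 1), msTerm ρ k r i (f i) z :=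
  maassShimura_apply hπ hG
    (fun i hi => (hG.1 i hi).analyticAt (OmegaPsi_subset_Omega ψ M z.2))
    (Eventually.of_forall fun w => congrFun hG.2 w) k r

end DrinfeldMS

namespace DrinfeldMS

/-! ### Binomial series -/

section Binomial

variable {R : Type*} [CommRing R]

/-- The power series `(1 + Y T) ^ a`. -/
def binomSeries (a : ℤ) (Y : R) : PowerSeries R :=
  PowerSeries.rescale Y (PowerSeries.binomialSeries R a)

@[simp]
theorem coeff_binomSeries (a : ℤ) (Y : R) (n : ℕ) :
    (binomSeries a Y).coeff n = ((Ring.choose a n : ℤ) : R) * Y ^ n := by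
  rw [binomSeries, PowerSeries.coeff_rescale, PowerSeries.binomialSeries_coeff, zsmul_one, mul_comm]

@[simp]
theorem constantCoeff_binomSeries (a : ℤ) (Y : R) :
    PowerSeries.constantCoeff (binomSeries a Y) = 1 := by
  rw [← PowerSeries.coeff_zero_eq_constantCoeff_apply, coeff_binomSeries]
  simp

theorem binomSeries_add (a b : ℤ) (Y : R) :
    binomSeries (a + b) Y = binomSeries a Y * binomSeries b Y := by
  rw [binomSeries, PowerSeries.binomialSeries_add, map_mul]
  rfl

@[simp]
theorem binomSeries_zero (Y : R) : binomSeries 0 Y = 1 := by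
  rw [binomSeries, PowerSeries.binomialSeries_zero, map_one]

theorem binomSeries_natCast (n : ℕ) (Y : R) :
    binomSeries n Y = (1 + PowerSeries.C Y * PowerSeries.X) ^ n := by
  rw [binomSeries, PowerSeries.binomialSeries_nat, map_pow, map_add, map_one,
    PowerSeries.rescale_X]

theorem binomSeries_neg_one_pow (n : ℕ) (Y : R) : binomSeries (-1) Y ^ n = binomSeries (-n) Y := by
  induction n with
  | zero => simp
  | succ n ih =>
    rw [pow_succ, ih, ← binomSeries_add]
    congr 1
    push_cast
    ring

theorem binomSeries_mul_neg_one (Y : R) :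
    binomSeries (-1) Y * (1 + PowerSeries.C Y * PowerSeries.X) = 1 := by
  have h := binomSeries_natCast 1 Y
  rw [pow_one] at h
  rw [← h, ← binomSeries_add]
  simp

/-- The coefficient of `T ^ e` in `(1 + X T) ^ N (1 + Y T) ^ (e - N - 1)`. -/
theorem coeff_binomSeries_mul_binomSeries (N e : ℕ) (X Y : R) :
    (binomSeries N X * binomSeries ((e : ℤ) - N - 1) Y).coeff e =
      ((Ring.choose (N : ℤ) e : ℤ) : R) * (X - Y) ^ e := by
  -- Write $1+XT=(X-Y)T+(1+YT)$ and expand. After multiplication by $(1+YT)^{e-N-1}$, the `i`-th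
  -- term carries $T^i(1+YT)^{e-1-i}$.
  have h1 : binomSeries (N : ℤ) X = ∑ i ∈ Finset.range (N + 1),
      PowerSeries.C ((N.choose i : R) * (X - Y) ^ i) * PowerSeries.X ^ i *
        binomSeries ((N - i : ℕ) : ℤ) Y := by
    have h2 : (1 : PowerSeries R) + PowerSeries.C X * PowerSeries.X =
        PowerSeries.C (X - Y) * PowerSeries.X + (1 + PowerSeries.C Y * PowerSeries.X) := by
      rw [map_sub]
      ring
    rw [binomSeries_natCast, h2, add_pow]
    refine Finset.sum_congr rfl fun i _ => ?_
    rw [binomSeries_natCast, mul_pow, map_mul, map_pow, map_natCast]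
    ring
  rw [h1, Finset.sum_mul, map_sum]
  have h3 : ∀ i ∈ Finset.range (N + 1),
      (PowerSeries.C ((N.choose i : R) * (X - Y) ^ i) * PowerSeries.X ^ i *
        binomSeries ((N - i : ℕ) : ℤ) Y * binomSeries ((e : ℤ) - N - 1) Y).coeff e =
      if i = e then (N.choose i : R) * (X - Y) ^ i else 0 := by
    intro i hi
    have hi' : i ≤ N := Nat.lt_succ_iff.1 (Finset.mem_range.1 hi)
    rw [mul_assoc, mul_assoc, ← binomSeries_add, PowerSeries.coeff_C_mul,
      PowerSeries.coeff_X_pow_mul']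
    by_cases h5 : i = e
    · subst h5
      simp
    · rw [if_neg h5]
      split_ifs with h4
      -- For `i < e` the exponent is a natural number, so $(1+YT)^{e-1-i}$ is a polynomial of degree
      -- too small to contribute to $T^{e-i}$.
      · have h6 : ((N - i : ℕ) : ℤ) + ((e : ℤ) - N - 1) = ((e - 1 - i : ℕ) : ℤ) := by omega
        have h7 : e - 1 - i < e - i := by omega
        rw [h6, coeff_binomSeries, Ring.choose_natCast, Nat.choose_eq_zero_of_lt h7]
        simp
      · simp
  rw [Finset.sum_congr rfl h3, Finset.sum_ite_eq', Ring.choose_natCast]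
  split_ifs with h
  · simp
  · rw [Nat.choose_eq_zero_of_lt (by simpa using h)]
    simp

end Binomial

variable {F : Type*} [Field F] [Fintype F]

/-! ### Equivariance of the Maass-Shimura operators -/

section LocalOperator

variable {f : Cinf F → Cinf F} {z : Cinf F} {ϖ : Cinf F}

theorem analyticAt_linear (α β : Cinf F) : AnalyticAt (Cinf F) (fun x => α * x + β) z := by
  fun_prop

theorem taylor_linear (α β : Cinf F) :
    taylor (fun x => α * x + β) z =
      PowerSeries.C (α * z + β) + PowerSeries.C α * PowerSeries.X := by
  have h1 : AnalyticAt (Cinf F) (fun x : Cinf F => x) z := analyticAt_id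
  rw [taylor_add (analyticAt_const.fun_mul h1) analyticAt_const, taylor_mul analyticAt_const h1,
    taylor_const, taylor_const, taylor_id, map_add, map_mul]
  ring

theorem rescale_C (a b : Cinf F) :
    PowerSeries.rescale a (PowerSeries.C b) = PowerSeries.C b := by
  ext n
  rw [PowerSeries.coeff_rescale, PowerSeries.coeff_C]
  split_ifs with h
  · simp [h]
  · simp

/-- Used for two linear forms: the automorphy factor, and $\tilde\pi x-\tilde\pi w$ with `w` frozen.
Both thereby become binomial series in the same variable. -/
theorem rescale_taylor_linear_inv (hϖ : ϖ ≠ 0) (α β : Cinf F) (h0 : α * z + β ≠ 0) :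
    PowerSeries.rescale ϖ⁻¹ (taylor (fun x => (α * x + β)⁻¹) z) =
      PowerSeries.C (α * z + β)⁻¹ * binomSeries (-1) (α / (ϖ * (α * z + β))) := by
  have h1 := congrArg (PowerSeries.rescale ϖ⁻¹) (taylor_inv (analyticAt_linear α β) h0)
  rw [map_mul, map_one, taylor_linear, map_add, map_mul, rescale_C, rescale_C,
    PowerSeries.rescale_X] at h1
  have h2 : (PowerSeries.C (α * z + β) + PowerSeries.C α * (PowerSeries.C ϖ⁻¹ * PowerSeries.X) :
      PowerSeries (Cinf F)) = PowerSeries.C (α * z + β) *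
        (1 + PowerSeries.C (α / (ϖ * (α * z + β))) * PowerSeries.X) := by
    rw [mul_add, mul_one, ← mul_assoc, ← mul_assoc, ← map_mul, ← map_mul]
    congr 3
    field_simp
  rw [h2] at h1
  have h3 := binomSeries_mul_neg_one (α / (ϖ * (α * z + β)))
  have h4 : PowerSeries.C (α * z + β)⁻¹ * PowerSeries.C (α * z + β) =
      (1 : PowerSeries (Cinf F)) := by
    rw [← map_mul, inv_mul_cancel₀ h0, map_one]
  set B := binomSeries (-1) (α / (ϖ * (α * z + β)))
  set U := PowerSeries.rescale ϖ⁻¹ (taylor (fun x => (α * x + β)⁻¹) z)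
  set L := (1 : PowerSeries (Cinf F)) + PowerSeries.C (α / (ϖ * (α * z + β))) * PowerSeries.X
  calc U = U * (PowerSeries.C (α * z + β)⁻¹ * PowerSeries.C (α * z + β)) * (B * L) := by
        rw [h3, h4, mul_one, mul_one]
    _ = (U * (PowerSeries.C (α * z + β) * L)) * (PowerSeries.C (α * z + β)⁻¹ * B) := by ring
    _ = _ := by rw [h1, one_mul]

theorem taylor_sub_self : taylor (fun x => x - z) z = PowerSeries.X := by
  have h := taylor_linear (z := z) 1 (-z)
  simpa [sub_eq_add_neg] using h

/-- A finite expansion with analytic remainder, from iterated difference quotients. It replaces the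
substitution of the power series of a fractional linear map into that of a function. -/
theorem exists_taylor_remainder (hf : AnalyticAt (Cinf F) f z) (r : ℕ) :
    ∃ (h : ℕ → Cinf F) (g : Cinf F → Cinf F), AnalyticAt (Cinf F) g z ∧
      ∀ x, f x = ∑ n ∈ Finset.range r, h n * (x - z) ^ n + (x - z) ^ r * g x := by
  induction r with
  | zero => exact ⟨0, f, hf, by simp⟩
  | succ r ih =>
    obtain ⟨h, g, hg, heq⟩ := ih
    obtain ⟨p, hp⟩ := hg
    refine ⟨Function.update h r (g z), dslope g z, ⟨_, hp.has_fpower_series_dslope_fslope⟩,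
      fun x => ?_⟩
    have h1 := sub_smul_dslope g z x
    rw [smul_eq_mul] at h1
    have h2 : ∑ n ∈ Finset.range r, Function.update h r (g z) n * (x - z) ^ n =
        ∑ n ∈ Finset.range r, h n * (x - z) ^ n := Finset.sum_congr rfl fun n hn => by
      rw [Function.update_of_ne (Finset.mem_range.1 hn).ne]
    rw [Finset.sum_range_succ, Function.update_self, pow_succ, mul_assoc, h1, heq x, h2]
    ring

theorem mobius_sub_mobius (γ : GL (Fin 2) (RatFunc F)) {x : Cinf F} (hx : jFactor γ x ≠ 0)
    (hz : jFactor γ z ≠ 0) : mobius γ x - mobius γ z =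
      ofK F γ.val.det * (jFactor γ z)⁻¹ * (jFactor γ x)⁻¹ * (x - z) := by
  rw [mobius, mobius, det_eq]
  field_simp
  simp only [jFactor]
  ring

theorem analyticAt_jFactor (γ : GL (Fin 2) (RatFunc F)) :
    AnalyticAt (Cinf F) (jFactor γ) z := analyticAt_linear _ _

theorem analyticAt_mobius (γ : GL (Fin 2) (RatFunc F)) (hz : jFactor γ z ≠ 0) :
    AnalyticAt (Cinf F) (mobius γ) z :=
  (analyticAt_linear _ _).fun_div (analyticAt_jFactor γ) hz

/-- The operator `f ↦ ∑ⱼ binom(k + r - 1, j) Yʲ ϖ^(j - r) 𝒟^(r - j) f` at a point. -/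
def localOperator (ϖ : Cinf F) (k r : ℕ) (Y : Cinf F) (f : Cinf F → Cinf F) (z : Cinf F) :
    Cinf F :=
  (binomSeries ((k : ℤ) + r - 1) Y * PowerSeries.rescale ϖ⁻¹ (taylor f z)).coeff r

theorem coeff_mul_C_mul_X_pow (A B : PowerSeries (Cinf F)) (a b : Cinf F) (n r : ℕ) :
    (A * (PowerSeries.C a * (PowerSeries.C b * PowerSeries.X) ^ n * B)).coeff r =
      if n ≤ r then a * b ^ n * (A * B).coeff (r - n) else 0 := by
  rw [show A * (PowerSeries.C a * (PowerSeries.C b * PowerSeries.X) ^ n * B) =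
    PowerSeries.C (a * b ^ n) * (PowerSeries.X ^ n * (A * B)) by
      rw [map_mul, map_pow]; ring, PowerSeries.coeff_C_mul, PowerSeries.coeff_X_pow_mul']
  split_ifs <;> simp

/-- Both sides are linear in the Taylor coefficients `H n` of `Ψ` at $\gamma z$, so they are
compared one `n` at a time. Powers of $\gamma x-\gamma z$ turn into powers of $x-z$ with `n` more
factors $j(x)^{-1}$. -/
theorem localOperator_slash (hϖ : ϖ ≠ 0) (γ : GL (Fin 2) (RatFunc F)) (hz : z ∈ Omega F)
    {Φ Ψ : Cinf F → Cinf F} (hΨ : AnalyticAt (Cinf F) Ψ (mobius γ z)) (k r : ℕ) (m : ℤ)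
    (h : ∀ᶠ x in 𝓝 z, Φ x = ofK F γ.val.det ^ m * (jFactor γ x)⁻¹ ^ k * Ψ (mobius γ x))
    (Y : Cinf F) :
    localOperator ϖ k r Y Φ z =
      ofK F γ.val.det ^ (m + r) * jFactor γ z ^ (-((k : ℤ) + 2 * r)) *
        localOperator ϖ k r (jFactor γ z ^ 2 / ofK F γ.val.det *
          (Y - ofK F (γ.val 1 0) / (ϖ * jFactor γ z))) Ψ (mobius γ z) := by
  set D := ofK F γ.val.det with hD
  have hD0 : D ≠ 0 := det_ne_zero γ
  set j := jFactor γ z with hj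
  have hj0 : j ≠ 0 := jFactor_ne_zero γ hz
  have hjan : AnalyticAt (Cinf F) (fun x => (jFactor γ x)⁻¹) z := (analyticAt_jFactor γ).fun_inv hj0
  have hjTaylor : PowerSeries.rescale ϖ⁻¹ (taylor (fun x => (jFactor γ x)⁻¹) z) =
      PowerSeries.C j⁻¹ * binomSeries (-1) (ofK F (γ.val 1 0) / (ϖ * j)) :=
    rescale_taylor_linear_inv hϖ _ _ hj0
  set Y₁ := ofK F (γ.val 1 0) / (ϖ * j)
  -- Order `r + 1`, so that the remainder does not reach the coefficient of $T^r$.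
  obtain ⟨H, g, hg, hgeq⟩ := exists_taylor_remainder hΨ (r + 1)
  have hgm : AnalyticAt (Cinf F) (fun x => g (mobius γ x)) z :=
    AnalyticAt.fun_comp hg (analyticAt_mobius γ hj0)
  have hsub : AnalyticAt (Cinf F) (fun x => x - z) z := by fun_prop
  have hsub' : AnalyticAt (Cinf F) (fun x => x - mobius γ z) (mobius γ z) := by fun_prop
  have hΦ : ∀ᶠ x in 𝓝 z,
      ∑ n ∈ Finset.range (r + 1), H n * D ^ (m + n) * j⁻¹ ^ n *
        (x - z) ^ n * (jFactor γ x)⁻¹ ^ (k + n) + D ^ (m + (r + 1 : ℕ)) * j⁻¹ ^ (r + 1) *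
        (x - z) ^ (r + 1) * ((jFactor γ x)⁻¹ ^ (k + (r + 1)) * g (mobius γ x)) = Φ x := by
    filter_upwards [h, (analyticAt_jFactor γ).continuousAt.eventually_ne hj0] with x hx hjx
    rw [hx, hgeq, mobius_sub_mobius γ hjx hj0, mul_add, Finset.mul_sum]
    congr 1
    · refine Finset.sum_congr rfl fun n _ => ?_
      rw [zpow_add₀ hD0, zpow_natCast, pow_add, mul_pow, mul_pow, mul_pow]
      ring
    · rw [zpow_add₀ hD0, zpow_natCast, pow_add _ k, mul_pow, mul_pow, mul_pow]
      ring
  have hT : PowerSeries.rescale ϖ⁻¹ (taylor Φ z) = ∑ n ∈ Finset.range (r + 1),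
      PowerSeries.C (H n * D ^ (m + n) * j⁻¹ ^ n) * (PowerSeries.C ϖ⁻¹ * PowerSeries.X) ^ n *
        (PowerSeries.C j⁻¹ * binomSeries (-1) Y₁) ^ (k + n) +
      PowerSeries.C (D ^ (m + (r + 1 : ℕ)) * j⁻¹ ^ (r + 1)) *
        (PowerSeries.C ϖ⁻¹ * PowerSeries.X) ^ (r + 1) * PowerSeries.rescale ϖ⁻¹
          (taylor (fun x => (jFactor γ x)⁻¹ ^ (k + (r + 1)) * g (mobius γ x)) z) := by
    have hterm : ∀ n : ℕ, AnalyticAt (Cinf F) (fun x => H n * D ^ (m + n) * j⁻¹ ^ n *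
        (x - z) ^ n * (jFactor γ x)⁻¹ ^ (k + n)) z := fun n =>
      (analyticAt_const.fun_mul (hsub.fun_pow n)).fun_mul (hjan.fun_pow _)
    have hrem : AnalyticAt (Cinf F) (fun x => (jFactor γ x)⁻¹ ^ (k + (r + 1)) *
        g (mobius γ x)) z := (hjan.fun_pow _).fun_mul hgm
    have hlast : AnalyticAt (Cinf F) (fun x => D ^ (m + (r + 1 : ℕ)) * j⁻¹ ^ (r + 1) *
        (x - z) ^ (r + 1)) z := analyticAt_const.fun_mul (hsub.fun_pow _)
    rw [← taylor_congr hΦ ((Finset.analyticAt_fun_sum _ fun n _ => hterm n).fun_add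
      (hlast.fun_mul hrem)), taylor_add (Finset.analyticAt_fun_sum _ fun n _ => hterm n)
      (hlast.fun_mul hrem), taylor_sum _ fun n _ => hterm n, taylor_mul hlast hrem,
      taylor_mul analyticAt_const (hsub.fun_pow _), taylor_pow hsub, taylor_sub_self, taylor_const,
      map_add, map_sum, map_mul, map_mul, map_pow, PowerSeries.rescale_X, rescale_C]
    congr 1
    refine Finset.sum_congr rfl fun n _ => ?_
    rw [taylor_mul (analyticAt_const.fun_mul (hsub.fun_pow n)) (hjan.fun_pow _),
      taylor_mul analyticAt_const (hsub.fun_pow n), taylor_pow hsub, taylor_pow hjan,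
      taylor_sub_self, taylor_const, map_mul, map_mul, map_pow, map_pow, PowerSeries.rescale_X,
      rescale_C, hjTaylor]
  have hT' : PowerSeries.rescale ϖ⁻¹ (taylor Ψ (mobius γ z)) = ∑ n ∈ Finset.range (r + 1),
      PowerSeries.C (H n) * (PowerSeries.C ϖ⁻¹ * PowerSeries.X) ^ n * 1 +
      PowerSeries.C 1 * (PowerSeries.C ϖ⁻¹ * PowerSeries.X) ^ (r + 1) *
        PowerSeries.rescale ϖ⁻¹ (taylor g (mobius γ z)) := by
    have hterm : ∀ n : ℕ, AnalyticAt (Cinf F) (fun x => H n * (x - mobius γ z) ^ n)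
        (mobius γ z) := fun n => analyticAt_const.fun_mul (hsub'.fun_pow n)
    rw [show Ψ = _ from funext hgeq, taylor_add (Finset.analyticAt_fun_sum _ fun n _ => hterm n)
      ((hsub'.fun_pow _).fun_mul hg), taylor_sum _ fun n _ => hterm n,
      taylor_mul (hsub'.fun_pow _) hg, taylor_pow hsub', taylor_sub_self, map_add, map_sum,
      map_mul, map_pow, PowerSeries.rescale_X, map_one, one_mul]
    congr 1
    refine Finset.sum_congr rfl fun n _ => ?_
    rw [taylor_mul analyticAt_const (hsub'.fun_pow n), taylor_pow hsub', taylor_sub_self,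
      taylor_const, map_mul, map_pow, PowerSeries.rescale_X, rescale_C, mul_one]
  rw [localOperator, localOperator, hT, hT', mul_add, mul_add, map_add, map_add,
    coeff_mul_C_mul_X_pow, coeff_mul_C_mul_X_pow, if_neg (by omega), if_neg (by omega), add_zero,
    add_zero, Finset.mul_sum, Finset.mul_sum, map_sum, map_sum, Finset.mul_sum]
  refine Finset.sum_congr rfl fun n hn => ?_
  have hnr : n ≤ r := Nat.lt_succ_iff.1 (Finset.mem_range.1 hn)
  rw [coeff_mul_C_mul_X_pow, coeff_mul_C_mul_X_pow, if_pos hnr, if_pos hnr, mul_one, mul_pow,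
    binomSeries_neg_one_pow, ← map_pow, mul_left_comm, PowerSeries.coeff_C_mul, coeff_binomSeries]
  -- The binomial identity with $N=k+r-1$ and $e=r-n$, for which $-(k+n)=e-N-1$. When $k=r=0$ this
  -- $N$ is negative and the claim is checked directly.
  have hmain : (binomSeries ((k : ℤ) + r - 1) Y * binomSeries (-(k + n : ℕ)) Y₁).coeff (r - n) =
      ((Ring.choose ((k : ℤ) + r - 1) (r - n) : ℤ) : Cinf F) * (Y - Y₁) ^ (r - n) := by
    rcases Nat.eq_zero_or_pos (k + r) with h0 | h0
    · have hr : r = 0 := by omega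
      have hn0 : n = 0 := by omega
      subst hr hn0
      simp
    · have h1 : ((k : ℤ) + r - 1) = ((k + r - 1 : ℕ) : ℤ) := by omega
      have h2 : -(((k + n : ℕ) : ℤ)) = ((r - n : ℕ) : ℤ) - ((k + r - 1 : ℕ) : ℤ) - 1 := by omega
      rw [h1, h2, coeff_binomSeries_mul_binomSeries]
  rw [hmain]
  obtain ⟨e, rfl⟩ := Nat.exists_eq_add_of_le hnr
  rw [Nat.add_sub_cancel_left, mul_pow, div_pow]
  have hz1 : D ^ (m + ((n + e : ℕ) : ℤ)) = D ^ (m + n) * D ^ e := by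
    rw [← zpow_natCast D e, ← zpow_add₀ hD0]
    congr 1
    push_cast
    ring
  have hz2 : j ^ (-((k : ℤ) + 2 * ((n + e : ℕ) : ℤ))) =
      j⁻¹ ^ n * j⁻¹ ^ (k + n) * (j⁻¹ ^ 2) ^ e := by
    rw [← pow_mul, ← pow_add, ← pow_add, ← zpow_natCast, inv_zpow, ← zpow_neg]
    congr 1
    push_cast
    ring
  rw [hz1, hz2]
  have hj2 : (j⁻¹ ^ 2) ^ e * (j ^ 2) ^ e = 1 := by
    rw [← mul_pow, ← mul_pow, inv_mul_cancel₀ hj0, one_pow, one_pow]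
  have hDe : D ^ e * (D ^ e)⁻¹ = 1 := mul_inv_cancel₀ (pow_ne_zero e hD0)
  rw [div_eq_mul_inv]
  linear_combination (-(H n * ϖ⁻¹ ^ n * j⁻¹ ^ (k + n) * j⁻¹ ^ n * D ^ (m + n) *
    ((Ring.choose ((k : ℤ) + ((n + e : ℕ) : ℤ) - 1) e : ℤ) : Cinf F) * (Y - Y₁) ^ e)) *
    ((j⁻¹ ^ 2) ^ e * (j ^ 2) ^ e * hDe + hj2)

end LocalOperator

end DrinfeldMS

/-! ### Reduction to analytic functions by freezing $\psi(z)$ -/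

namespace DrinfeldMS

variable {F : Type*} [Field F] [Fintype F]
variable {ψ : SigmaExtension F} {M : NrExtension F} {ρ : Cinf F}

/-- The function `∑ fᵢ(x) / (π̃ x - π̃ w)ⁱ` of `x`. -/
def frozenSum (ρ : Cinf F) (s : ℕ) (f : ℕ → Cinf F → Cinf F) (w x : Cinf F) : Cinf F :=
  ∑ i ∈ Finset.range (s + 1), f i x * (carlitzPeriod ρ * x + -(carlitzPeriod ρ * w))⁻¹ ^ i

theorem msTerm_eq_coeff (k r μ : ℕ) (f : Cinf F → Cinf F) (z : OmegaPsi ψ M) :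
    msTerm ρ k r μ f z = (PowerSeries.C (nhX ρ z ^ μ) *
      binomSeries ((k : ℤ) - μ + r - 1) (nhX ρ z) *
      PowerSeries.rescale (carlitzPeriod ρ)⁻¹ (taylor f z)).coeff r := by
  rw [PowerSeries.coeff_mul, Finset.Nat.sum_antidiagonal_eq_sum_range_succ_mk, msTerm]
  refine Finset.sum_congr rfl fun j _ => ?_
  simp only [PowerSeries.coeff_C_mul, coeff_binomSeries, PowerSeries.coeff_rescale, coeff_taylor,
    nhTerm_eq, del]
  rw [pow_add, inv_pow]
  ring

theorem nhX_inv_ne_zero (hπ : carlitzPeriod ρ ≠ 0) (z : OmegaPsi ψ M) :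
    carlitzPeriod ρ * z + -(carlitzPeriod ρ * ψ z) ≠ 0 := by
  have h := inv_ne_zero (nhX_ne_zero hπ z)
  rwa [nhX, inv_inv, sub_eq_add_neg] at h

theorem nhX_eq (z : OmegaPsi ψ M) :
    nhX ρ z = (carlitzPeriod ρ * z + -(carlitzPeriod ρ * ψ z))⁻¹ := by
  rw [nhX, sub_eq_add_neg]

theorem analyticAt_frozen_inv (hπ : carlitzPeriod ρ ≠ 0) (z : OmegaPsi ψ M) :
    AnalyticAt (Cinf F) (fun x => (carlitzPeriod ρ * x + -(carlitzPeriod ρ * ψ z))⁻¹) z :=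
  (analyticAt_linear _ _).fun_inv (nhX_inv_ne_zero hπ z)

theorem analyticAt_frozenSum (hπ : carlitzPeriod ρ ≠ 0) {z : OmegaPsi ψ M} {s : ℕ}
    {f : ℕ → Cinf F → Cinf F} (hf : ∀ i ≤ s, AnalyticAt (Cinf F) (f i) z) :
    AnalyticAt (Cinf F) (frozenSum ρ s f (ψ z)) z :=
  Finset.analyticAt_fun_sum _ fun i hi => (hf i (Nat.lt_succ_iff.1 (Finset.mem_range.1 hi))).fun_mul
    ((analyticAt_frozen_inv hπ z).fun_pow i)

/-- The frozen factor of depth `i` has rescaled Taylor series $X^i(1+XT)^{-i}$, which lowers the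
exponent $k+r-1$ of the operator to $k-i+r-1$. -/
theorem sum_msTerm_eq_localOperator (hπ : carlitzPeriod ρ ≠ 0) {z : OmegaPsi ψ M} {s : ℕ}
    {f : ℕ → Cinf F → Cinf F} (hf : ∀ i ≤ s, AnalyticAt (Cinf F) (f i) z) (k r : ℕ) :
    ∑ i ∈ Finset.range (s + 1), msTerm ρ k r i (f i) z =
      localOperator (carlitzPeriod ρ) k r (nhX ρ z) (frozenSum ρ s f (ψ z)) z := by
  have hf' : ∀ i ∈ Finset.range (s + 1), AnalyticAt (Cinf F) (f i) z := fun i hi =>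
    hf i (Nat.lt_succ_iff.1 (Finset.mem_range.1 hi))
  have hX := analyticAt_frozen_inv hπ z
  have hT : taylor (frozenSum ρ s f (ψ z)) z = ∑ i ∈ Finset.range (s + 1), taylor (f i) z *
      taylor (fun x => (carlitzPeriod ρ * x + -(carlitzPeriod ρ * ψ z))⁻¹) z ^ i := by
    rw [show frozenSum ρ s f (ψ z) = fun x => ∑ i ∈ Finset.range (s + 1),
      f i x * (carlitzPeriod ρ * x + -(carlitzPeriod ρ * ψ z))⁻¹ ^ i from rfl,
      taylor_sum _ fun i hi => (hf' i hi).fun_mul (hX.fun_pow i)]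
    refine Finset.sum_congr rfl fun i hi => ?_
    rw [taylor_mul (hf' i hi) (hX.fun_pow i), taylor_pow hX]
  rw [localOperator, hT, map_sum, Finset.mul_sum, map_sum]
  refine Finset.sum_congr rfl fun i _ => ?_
  rw [msTerm_eq_coeff, (PowerSeries.rescale _).map_mul, (PowerSeries.rescale _).map_pow,
    rescale_taylor_linear_inv hπ _ _ (nhX_inv_ne_zero hπ z),
    ← nhX_eq]
  congr 1
  have h1 : carlitzPeriod ρ / (carlitzPeriod ρ *
      (carlitzPeriod ρ * z + -(carlitzPeriod ρ * ψ z))) = nhX ρ z := by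
    rw [nhX_eq]
    field_simp
  rw [h1, mul_pow, binomSeries_neg_one_pow, map_pow, show (k : ℤ) - i + r - 1 =
    ((k : ℤ) + r - 1) + -i by ring, binomSeries_add]
  ring

/-! ### The slash operator on expansions -/

theorem jFactor_ne_zero_of_sigma (γ : GL (Fin 2) (RatFunc F)) (z : OmegaPsi ψ M) :
    jFactor γ (ψ z) ≠ 0 := by
  have h : jFactor γ (ψ z) = ψ (jFactor γ z) := by
    have hφ := map_ofK ψ
    simp only [jFactor, map_add, map_mul, hφ]
  rw [h]
  simpa using jFactor_ne_zero γ (OmegaPsi_subset_Omega ψ M z.2)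

theorem sigma_mobius (γ : GL (Fin 2) (RatFunc F)) (z : Cinf F) :
    ψ (mobius γ z) = mobius γ (ψ z) := by
  have hφ := map_ofK ψ
  simp only [mobius, jFactor, map_div₀, map_add, map_mul, hφ]

/-- Follows from $\gamma x-\gamma w=\det\gamma\,j(x)^{-1}j(w)^{-1}(x-w)$ and $j(w)=j(x)-c(x-w)$. It
is stated for independent `x` and `w` so that it applies to frozen sums as well as to $X$ itself. -/
theorem inv_linear_mobius (hπ : carlitzPeriod ρ ≠ 0) (γ : GL (Fin 2) (RatFunc F)) {x w : Cinf F}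
    (hx : jFactor γ x ≠ 0) (hw : jFactor γ w ≠ 0)
    (hxw : carlitzPeriod ρ * x + -(carlitzPeriod ρ * w) ≠ 0) :
    (carlitzPeriod ρ * mobius γ x + -(carlitzPeriod ρ * mobius γ w))⁻¹ =
      jFactor γ x ^ 2 / ofK F γ.val.det * ((carlitzPeriod ρ * x + -(carlitzPeriod ρ * w))⁻¹ -
        ofK F (γ.val 1 0) / (carlitzPeriod ρ * jFactor γ x)) := by
  have hD := det_ne_zero γ
  rw [← sub_eq_add_neg, ← mul_sub] at hxw ⊢
  have hxw' : x - w ≠ 0 := right_ne_zero_of_mul hxw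
  rw [← sub_eq_add_neg, ← mul_sub, mobius_sub_mobius γ hx hw]
  have hjw : jFactor γ w = jFactor γ x - ofK F (γ.val 1 0) * (x - w) := by
    simp only [jFactor]
    ring
  rw [mul_inv, mul_inv, mul_inv, mul_inv, inv_inv, inv_inv]
  field_simp
  rw [hjw]
  ring

/-- The coefficients of `G |_{k,m} γ`, where `G` has the coefficients `f`. -/
def slashCoeff (ρ : Cinf F) (k : ℕ) (m : ℤ) (γ : GL (Fin 2) (RatFunc F)) (s : ℕ)
    (f : ℕ → Cinf F → Cinf F) (t : ℕ) (x : Cinf F) : Cinf F :=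
  ∑ i ∈ Finset.range (s + 1), (ofK F γ.val.det ^ m * (ofK F γ.val.det)⁻¹ ^ i
    * (i.choose t : Cinf F) *
    (-(ofK F (γ.val 1 0) / carlitzPeriod ρ)) ^ (i - t)) *
      (jFactor γ x ^ ((i : ℤ) + t - k) * f i (mobius γ x))

theorem IsHolomorphic.slashCoeff {s : ℕ} {f : ℕ → Cinf F → Cinf F}
    (hf : ∀ i ≤ s, IsHolomorphic (f i)) (k : ℕ) (m : ℤ) (γ : GL (Fin 2) (RatFunc F)) (t : ℕ) :
    IsHolomorphic (slashCoeff ρ k m γ s f t) :=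
  IsHolomorphic.sum _ fun i hi =>
    ((hf i (Nat.lt_succ_iff.1 (Finset.mem_range.1 hi))).comp_mobius γ _).const_mul _

/-- The binomial theorem applied to the transformation law of $X$. Since `Y` is arbitrary, it serves
for $Y=X(z)$ and for the frozen value at a nearby `x`. -/
theorem sum_slashCoeff_mul_pow (k : ℕ) (m : ℤ) (γ : GL (Fin 2) (RatFunc F)) (s : ℕ)
    (f : ℕ → Cinf F → Cinf F) {x : Cinf F} (hx : jFactor γ x ≠ 0) (Y : Cinf F) :
    ∑ t ∈ Finset.range (s + 1), slashCoeff ρ k m γ s f t x * Y ^ t =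
      ofK F γ.val.det ^ m * (jFactor γ x)⁻¹ ^ k * ∑ i ∈ Finset.range (s + 1), f i (mobius γ x) *
        (jFactor γ x ^ 2 / ofK F γ.val.det *
          (Y - ofK F (γ.val 1 0) / (carlitzPeriod ρ * jFactor γ x))) ^ i := by
  set D := ofK F γ.val.det
  set j := jFactor γ x
  set c := ofK F (γ.val 1 0)
  set p := carlitzPeriod ρ
  have h1 : j ^ 2 / D * (Y - c / (p * j)) = D⁻¹ * (j * (j * Y + -(c / p))) := by
    field_simp
    ring
  simp only [slashCoeff, Finset.sum_mul]
  rw [Finset.sum_comm, Finset.mul_sum]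
  refine Finset.sum_congr rfl fun i hi => ?_
  have hle : Finset.range (i + 1) ⊆ Finset.range (s + 1) :=
    Finset.range_mono (Finset.mem_range.1 hi)
  rw [h1, mul_pow, mul_pow, add_pow, Finset.mul_sum, Finset.mul_sum, Finset.mul_sum, Finset.mul_sum,
    ← Finset.sum_subset hle fun t _ ht => ?_]
  · refine Finset.sum_congr rfl fun t _ => ?_
    have hz : j ^ ((i : ℤ) + t - k) = j ^ i * j ^ t * j⁻¹ ^ k := by
      rw [sub_eq_add_neg, zpow_add₀ hx, zpow_add₀ hx, zpow_natCast, zpow_natCast, zpow_neg,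
        zpow_natCast, inv_pow]
    rw [hz, mul_pow]
    ring
  · rw [Nat.choose_eq_zero_of_lt (by simpa using ht)]
    simp

theorem nhSum_eq (s : ℕ) (f : ℕ → Cinf F → Cinf F) (z : OmegaPsi ψ M) :
    nhSum ρ s f z = ∑ i ∈ Finset.range (s + 1), f i z * nhX ρ z ^ i := by
  simp only [nhSum, nhTerm_eq]

theorem nhX_mobius (hπ : carlitzPeriod ρ ≠ 0) (γ : GL (Fin 2) (RatFunc F)) (z : OmegaPsi ψ M) :
    nhX ρ (⟨mobius γ z, mobius_mem ψ M γ z.2⟩ : OmegaPsi ψ M) =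
      jFactor γ z ^ 2 / ofK F γ.val.det *
        (nhX ρ z - ofK F (γ.val 1 0) / (carlitzPeriod ρ * jFactor γ z)) := by
  rw [nhX_eq, nhX_eq, sigma_mobius]
  exact inv_linear_mobius hπ γ (jFactor_ne_zero γ (OmegaPsi_subset_Omega ψ M z.2))
    (jFactor_ne_zero_of_sigma γ z) (nhX_inv_ne_zero hπ z)

theorem slash_nhSum (hπ : carlitzPeriod ρ ≠ 0) (k : ℕ) (m : ℤ) (γ : GL (Fin 2) (RatFunc F)) (s : ℕ)
    (f : ℕ → Cinf F → Cinf F) (z : OmegaPsi ψ M) :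
    slash k m γ (nhSum ρ s f) z = nhSum ρ s (slashCoeff ρ k m γ s f) z := by
  rw [nhSum_eq, sum_slashCoeff_mul_pow k m γ s f
    (jFactor_ne_zero γ (OmegaPsi_subset_Omega ψ M z.2)), slash, nhSum_eq, nhX_mobius hπ,
    zpow_neg, zpow_natCast, inv_pow]

theorem HasExpansion.slash (hπ : carlitzPeriod ρ ≠ 0) {G : OmegaPsi ψ M → Cinf F} {s : ℕ}
    {f : ℕ → Cinf F → Cinf F} (hG : HasExpansion ρ G s f) (k : ℕ) (m : ℤ)
    (γ : GL (Fin 2) (RatFunc F)) :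
    HasExpansion ρ (slash k m γ G) s (slashCoeff ρ k m γ s f) :=
  ⟨fun t _ => IsHolomorphic.slashCoeff hG.1 k m γ t, funext fun z => by
    rw [hG.2, slash_nhSum hπ]⟩

/-- Near `z`, the frozen function of the slashed form is the slash of the function frozen at
$\psi(\gamma z)=\gamma\psi(z)$. So `localOperator_slash` applies with $Y=X(z)$. -/
theorem slash_maassShimura (hπ : carlitzPeriod ρ ≠ 0) {G : OmegaPsi ψ M → Cinf F} {s : ℕ}
    {f : ℕ → Cinf F → Cinf F} (hG : HasExpansion ρ G s f) (k r : ℕ) (m : ℤ)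
    (γ : GL (Fin 2) (RatFunc F)) :
    slash (k + 2 * r) (m + r) γ (maassShimura ρ k r G) = maassShimura ρ k r (slash k m γ G) := by
  funext z
  have hz := OmegaPsi_subset_Omega ψ M z.2
  have hf : ∀ i ≤ s, AnalyticAt (Cinf F) (f i) (mobius γ z) := fun i hi =>
    (hG.1 i hi).analyticAt (mobius_mem_Omega γ hz)
  rw [maassShimura_eq hπ (hG.slash hπ k m γ), sum_msTerm_eq_localOperator hπ fun t _ =>
    (IsHolomorphic.slashCoeff hG.1 k m γ t).analyticAt hz, slash, maassShimura_eq hπ hG,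
    sum_msTerm_eq_localOperator hπ hf, nhX_mobius hπ]
  refine (localOperator_slash hπ γ hz (analyticAt_frozenSum (z := ⟨mobius γ z, _⟩) hπ hf) k r m
    ?_ (nhX ρ z)).symm
  have hj := jFactor_ne_zero γ hz
  have hcont : ContinuousAt
      (fun x => carlitzPeriod ρ * x + -(carlitzPeriod ρ * ψ z)) (z : Cinf F) :=
    (analyticAt_linear _ _).continuousAt
  filter_upwards [(analyticAt_jFactor γ).continuousAt.eventually_ne hj,
    hcont.eventually_ne (nhX_inv_ne_zero hπ z)] with x hx hxw
  rw [frozenSum, sum_slashCoeff_mul_pow k m γ s f hx, frozenSum]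
  simp only [sigma_mobius]
  rw [inv_linear_mobius hπ γ hx (jFactor_ne_zero_of_sigma γ z) hxw]

/-! ### The coefficients of the image of the Maass-Shimura operator -/

/-- The coefficients of `δ_k^r G`, where `G` has the coefficients `f`. -/
def msCoeff (ρ : Cinf F) (k r s : ℕ) (f : ℕ → Cinf F → Cinf F) (t : ℕ) (x : Cinf F) : Cinf F :=
  ∑ i ∈ Finset.range (s + 1), ∑ j ∈ Finset.range (r + 1),
    (if i + j = t then ((Ring.choose ((k : ℤ) - i + r - 1) j : ℤ) : Cinf F) else 0) *
      del ρ (r - j) (f i) x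

theorem sum_msTerm_eq_nhSum (k r s : ℕ) (f : ℕ → Cinf F → Cinf F) (z : OmegaPsi ψ M) :
    ∑ i ∈ Finset.range (s + 1), msTerm ρ k r i (f i) z =
      nhSum ρ (s + r) (msCoeff ρ k r s f) z := by
  simp only [nhSum_eq, msCoeff, Finset.sum_mul, msTerm, nhTerm_eq]
  symm
  rw [Finset.sum_comm]
  refine Finset.sum_congr rfl fun i hi => ?_
  rw [Finset.sum_comm]
  refine Finset.sum_congr rfl fun j hj => ?_
  rw [Finset.sum_eq_single (i + j)]
  · rw [if_pos rfl]
    ring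
  · intro t _ ht
    rw [if_neg (Ne.symm ht), zero_mul, zero_mul]
  · intro h
    simp only [Finset.mem_range] at hi hj h
    omega

theorem IsHolomorphic.del {f : Cinf F → Cinf F} (hf : IsHolomorphic f) (n : ℕ) :
    IsHolomorphic (del ρ n f) := by
  have h := (hf.hyperderiv n).const_mul (carlitzPeriod ρ ^ n)⁻¹
  simp only [inv_mul_eq_div] at h
  exact h

theorem IsBoundedOnVerticalLines.del {f : Cinf F → Cinf F} (hf : IsHolomorphic f)
    (hb : IsBoundedOnVerticalLines f) (n : ℕ) : IsBoundedOnVerticalLines (del ρ n f) := by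
  have h := (IsBoundedOnVerticalLines.hyperderiv hf hb n).const_mul (carlitzPeriod ρ ^ n)⁻¹
  simp only [inv_mul_eq_div] at h
  exact h

theorem IsHolomorphic.msCoeff {k r s : ℕ} {f : ℕ → Cinf F → Cinf F}
    (hf : ∀ i ≤ s, IsHolomorphic (f i)) (t : ℕ) : IsHolomorphic (msCoeff ρ k r s f t) :=
  IsHolomorphic.sum _ fun i hi => IsHolomorphic.sum _ fun j _ =>
    ((hf i (Nat.lt_succ_iff.1 (Finset.mem_range.1 hi))).del (r - j)).const_mul _

theorem IsBoundedOnVerticalLines.msCoeff {k r s : ℕ} {f : ℕ → Cinf F → Cinf F}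
    (hf : ∀ i ≤ s, IsHolomorphic (f i)) (hb : ∀ i ≤ s, IsBoundedOnVerticalLines (f i)) (t : ℕ) :
    IsBoundedOnVerticalLines (msCoeff ρ k r s f t) :=
  IsBoundedOnVerticalLines.sum _ fun i hi => IsBoundedOnVerticalLines.sum _ fun j _ =>
    (IsBoundedOnVerticalLines.del (hf i (Nat.lt_succ_iff.1 (Finset.mem_range.1 hi)))
      (hb i (Nat.lt_succ_iff.1 (Finset.mem_range.1 hi))) (r - j)).const_mul _

theorem HasExpansion.maassShimura (hπ : carlitzPeriod ρ ≠ 0) {G : OmegaPsi ψ M → Cinf F} {s : ℕ}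
    {f : ℕ → Cinf F → Cinf F} (hG : HasExpansion ρ G s f) (k r : ℕ) :
    HasExpansion ρ (maassShimura ρ k r G) (s + r) (msCoeff ρ k r s f) :=
  ⟨fun t _ => IsHolomorphic.msCoeff hG.1 t, funext fun z => by
    rw [maassShimura_eq hπ hG, sum_msTerm_eq_nhSum]⟩

theorem HasExpansion.continuous (hπ : carlitzPeriod ρ ≠ 0) {G : OmegaPsi ψ M → Cinf F} {s : ℕ}
    {f : ℕ → Cinf F → Cinf F} (hG : HasExpansion ρ G s f) : Continuous G := by
  rw [hG.2]
  have hX : Continuous fun z : OmegaPsi ψ M => nhX ρ z := by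
    refine Continuous.inv₀ ?_ fun z => by
      have := nhX_inv_ne_zero hπ z
      rwa [← sub_eq_add_neg] at this
    exact (continuous_const.mul continuous_subtype_val).sub
      (continuous_const.mul (ψ.continuous_toRingEquiv.comp continuous_subtype_val))
  have : (nhSum ρ s f : OmegaPsi ψ M → Cinf F) = fun z : OmegaPsi ψ M =>
      ∑ i ∈ Finset.range (s + 1), f i z * nhX ρ z ^ i := funext fun z => nhSum_eq s f z
  rw [this]
  refine continuous_finsetSum _ fun i hi => Continuous.mul ?_ (hX.pow i)
  refine continuous_iff_continuousAt.2 fun z => ?_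
  exact ((hG.1 i (Nat.lt_succ_iff.1 (Finset.mem_range.1 hi))).analyticAt
    (OmegaPsi_subset_Omega ψ M z.2)).continuousAt.comp continuous_subtype_val.continuousAt

end DrinfeldMS

namespace DrinfeldMS

variable {F : Type*} [Field F] [Fintype F]

/-! ### The Frobenius endomorphism and constants -/

theorem exists_frobenius (F : Type*) [Field F] [Fintype F] (i : ℕ) :
    ∃ φ : Cinf F →+* Cinf F, ∀ x, φ x = x ^ q F ^ i := by
  obtain ⟨p, hp, hchar⟩ := exists_charP_Cinf F
  have : Fact p.Prime := ⟨hp⟩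
  have hF : CharP F p := (RingHom.charP_iff (ofFq F) (ofFq F).injective p).2 hchar
  obtain ⟨n, -, hn⟩ := FiniteField.card F p
  refine ⟨iterateFrobenius (Cinf F) p (n * i), fun x => ?_⟩
  rw [iterateFrobenius_def, pow_mul, ← hn]

theorem add_pow_q_pow (x y : Cinf F) (i : ℕ) :
    (x + y) ^ q F ^ i = x ^ q F ^ i + y ^ q F ^ i := by
  obtain ⟨φ, hφ⟩ := exists_frobenius F i
  simp only [← hφ, map_add]

theorem sub_pow_q_pow (x y : Cinf F) (i : ℕ) :
    (x - y) ^ q F ^ i = x ^ q F ^ i - y ^ q F ^ i := by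
  obtain ⟨φ, hφ⟩ := exists_frobenius F i
  simp only [← hφ, map_sub]

theorem neg_pow_q_pow (x : Cinf F) (i : ℕ) : (-x) ^ q F ^ i = -x ^ q F ^ i := by
  obtain ⟨φ, hφ⟩ := exists_frobenius F i
  simp only [← hφ, map_neg]

theorem q_pos : 0 < q F := zero_lt_one.trans (one_lt_q F)

theorem ofFq_pow_q_pow (c : F) (i : ℕ) : ofFq F c ^ q F ^ i = ofFq F c := by
  rw [← map_pow, FiniteField.pow_card_pow]

theorem mem_range_ofFq_of_pow_q_eq {x : Cinf F} (hx : x ^ q F = x) : ∃ c, x = ofFq F c := by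
  have h1 : (X ^ q F - X : F[X]).Monic := monic_X_pow_sub (by
    rw [degree_X]
    exact_mod_cast one_lt_q F)
  have h2 := prod_multiset_X_sub_C_of_monic_of_roots_card_eq h1 (by
    rw [FiniteField.roots_X_pow_card_sub_X,
      FiniteField.X_pow_card_sub_X_natDegree_eq F (one_lt_q F)]
    rfl)
  rw [FiniteField.roots_X_pow_card_sub_X] at h2
  have h3 := congrArg (fun p => p.eval₂ (ofFq F) x) h2
  simp only [eval₂_sub, eval₂_pow, eval₂_X, hx, sub_self] at h3
  rw [show (Multiset.map (fun a => X - Polynomial.C a) (Finset.univ : Finset F).val).prod =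
    ∏ a : F, (X - Polynomial.C a) from rfl, eval₂_finsetProd, Finset.prod_eq_zero_iff] at h3
  obtain ⟨c, -, hc⟩ := h3
  exact ⟨c, by simpa [sub_eq_zero] using hc⟩

/-! ### The Carlitz exponential -/

theorem norm_theta_pow_sub {i j : ℕ} (h : j < i) :
    ‖theta F ^ q F ^ i - theta F ^ q F ^ j‖ = (q F : ℝ) ^ q F ^ i := by
  rw [sub_eq_add_neg, norm_add_eq_of_lt, norm_pow, norm_theta]
  rw [norm_neg, norm_pow, norm_pow, norm_theta]
  exact pow_lt_pow_right₀ one_lt_q_real (Nat.pow_lt_pow_right (one_lt_q F) h)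

theorem norm_theta_pow_sub_theta (i : ℕ) :
    ‖theta F ^ q F ^ (i + 1) - theta F‖ = (q F : ℝ) ^ q F ^ (i + 1) := by
  simpa using norm_theta_pow_sub (F := F) (Nat.succ_pos i)

theorem norm_carlitzD (i : ℕ) : ‖carlitzD F i‖ = ((q F : ℝ) ^ i) ^ q F ^ i := by
  rw [carlitzD, norm_prod, Finset.prod_congr rfl fun j hj =>
    norm_theta_pow_sub (F := F) (Finset.mem_range.1 hj), Finset.prod_const, Finset.card_range,
    ← pow_mul, ← pow_mul, mul_comm]

theorem carlitzD_ne_zero (i : ℕ) : carlitzD F i ≠ 0 := by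
  rw [← norm_pos_iff, norm_carlitzD]
  have := one_lt_q_real (F := F)
  positivity

theorem carlitzD_zero : carlitzD F 0 = 1 := by simp [carlitzD]

theorem carlitzD_succ (i : ℕ) :
    carlitzD F (i + 1) = (theta F ^ q F ^ (i + 1) - theta F) * carlitzD F i ^ q F := by
  rw [carlitzD, Finset.prod_range_succ', carlitzD, ← Finset.prod_pow, pow_zero, pow_one, mul_comm]
  congr 1
  refine Finset.prod_congr rfl fun j _ => ?_
  have h := sub_pow_q_pow (theta F ^ q F ^ i) (theta F ^ q F ^ j) 1
  rw [pow_one] at h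
  rw [h, ← pow_mul, ← pow_mul, ← pow_succ, ← pow_succ]

theorem norm_carlitzExp_term (z : Cinf F) (i : ℕ) :
    ‖z ^ q F ^ i / carlitzD F i‖ = (‖z‖ / (q F : ℝ) ^ i) ^ q F ^ i := by
  rw [norm_div, norm_pow, norm_carlitzD, div_pow]

theorem summable_norm_carlitzExp (z : Cinf F) :
    Summable fun i : ℕ => ‖z ^ q F ^ i / carlitzD F i‖ := by
  have hq := one_lt_q_real (F := F)
  obtain ⟨N, hN⟩ := pow_unbounded_of_one_lt (2 * ‖z‖) hq
  refine Summable.of_norm_bounded_eventually_nat (g := fun i => (1 / 2 : ℝ) ^ i)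
    (summable_geometric_of_lt_one (by norm_num) (by norm_num)) ?_
  filter_upwards [eventually_ge_atTop N] with i hi
  rw [norm_norm, norm_carlitzExp_term]
  have h1 : ‖z‖ / (q F : ℝ) ^ i ≤ 1 / 2 := by
    rw [div_le_iff₀ (by positivity)]
    have := pow_le_pow_right₀ hq.le hi
    linarith
  exact (pow_le_pow_left₀ (by positivity) h1 _).trans
    (pow_le_pow_of_le_one (by norm_num) (by norm_num) (Nat.lt_pow_self (one_lt_q F)).le)

theorem hasSum_carlitzExp (z : Cinf F) :
    HasSum (fun i : ℕ => z ^ q F ^ i / carlitzD F i) (carlitzExp z) :=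
  (summable_norm_carlitzExp z).of_norm.hasSum

theorem carlitzExp_add (x y : Cinf F) : carlitzExp (x + y) = carlitzExp x + carlitzExp y := by
  refine (hasSum_carlitzExp (x + y)).unique ?_
  simpa only [add_pow_q_pow, add_div] using (hasSum_carlitzExp x).add (hasSum_carlitzExp y)

theorem carlitzExp_ofFq_mul (c : F) (x : Cinf F) :
    carlitzExp (ofFq F c * x) = ofFq F c * carlitzExp x := by
  refine (hasSum_carlitzExp _).unique ?_
  simpa only [mul_pow, ofFq_pow_q_pow, mul_div_assoc] using
    (hasSum_carlitzExp x).mul_left (ofFq F c)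

theorem carlitzExp_sub (x y : Cinf F) : carlitzExp (x - y) = carlitzExp x - carlitzExp y := by
  rw [eq_sub_iff_add_eq, ← carlitzExp_add, sub_add_cancel]

/-- Termwise, this is the recursion $D_{i+1}=(\theta^{q^{i+1}}-\theta)D_i^q$. -/
theorem carlitzExp_theta_mul (z : Cinf F) :
    carlitzExp (theta F * z) = theta F * carlitzExp z + carlitzExp z ^ q F := by
  rw [← sub_eq_iff_eq_add']
  have h1 := (hasSum_carlitzExp (theta F * z)).sub ((hasSum_carlitzExp z).mul_left (theta F))
  rw [← hasSum_nat_add_iff' 1] at h1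
  simp only [Finset.sum_range_one, pow_zero, pow_one, carlitzD_zero, div_one, sub_self,
    sub_zero] at h1
  obtain ⟨φ, hφ⟩ := exists_frobenius F 1
  simp only [pow_one] at hφ
  have h2 := (hasSum_carlitzExp z).map φ (by
    rw [show (φ : Cinf F → Cinf F) = fun x => x ^ q F from funext hφ]
    exact continuous_pow _)
  rw [hφ] at h2
  refine h1.unique (h2.congr_fun fun i => ?_)
  have hD := carlitzD_ne_zero (F := F) i
  have hθ : theta F ^ q F ^ (i + 1) - theta F ≠ 0 := by
    rw [← norm_pos_iff, norm_theta_pow_sub_theta]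
    have := one_lt_q_real (F := F)
    positivity
  rw [Function.comp_apply, hφ, carlitzD_succ, div_pow, ← pow_mul, ← pow_succ]
  field_simp
  ring

/-- From $q^i-1=(q-1)(1+q+\dots+q^{i-1})$. It separates off $x^{q-1}$, the only power in which the
period is naturally known. -/
theorem pow_q_pow_eq (R : Type*) [CommMonoid R] (F : Type*) [Field F] [Fintype F] (x : R) (i : ℕ) :
    x ^ q F ^ i = x * ∏ j ∈ Finset.range i, (x ^ (q F - 1)) ^ q F ^ j := by
  induction i with
  | zero => simp
  | succ i ih =>
    rw [Finset.prod_range_succ, ← mul_assoc, ← ih, ← pow_mul, ← pow_add]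
    congr 1
    obtain ⟨n, hn⟩ : ∃ n, q F = n + 1 := ⟨q F - 1, (Nat.sub_add_cancel q_pos).symm⟩
    rw [hn, Nat.add_sub_cancel, pow_succ]
    ring

/-- On the disc `|z|^(q-1) < q^q` the Carlitz exponential is an isometry. -/
theorem norm_carlitzExp_of_lt {z : Cinf F} (hz : ‖z‖ ^ (q F - 1) < (q F : ℝ) ^ q F) :
    ‖carlitzExp z‖ = ‖z‖ := by
  by_cases hz0 : z = 0
  · have h : carlitzExp (0 : Cinf F) = 0 := by simpa using carlitzExp_add (0 : Cinf F) 0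
    rw [hz0, h]
  have hzpos : 0 < ‖z‖ := norm_pos_iff.2 hz0
  have hq := one_lt_q_real (F := F)
  set L := ‖z‖ ^ (q F - 1) / (q F : ℝ) ^ q F with hL
  have hL1 : L < 1 := (div_lt_one (by positivity)).2 hz
  have hL0 : 0 ≤ L := by positivity
  have h1 := hasSum_carlitzExp z
  rw [← hasSum_nat_add_iff' 1] at h1
  simp only [Finset.sum_range_one, pow_zero, pow_one, carlitzD_zero, div_one] at h1
  -- Every term after the first is smaller than `z` by the fixed factor `L < 1`, so the first term
  -- determines the norm.
  have h2 : ∀ i : ℕ, ‖z ^ q F ^ (i + 1) / carlitzD F (i + 1)‖ ≤ L * ‖z‖ := fun i => by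
    rw [norm_div, norm_pow, norm_carlitzD, pow_q_pow_eq ℝ F ‖z‖, div_le_iff₀ (by positivity)]
    have h3 : ∏ j ∈ Finset.range (i + 1), (‖z‖ ^ (q F - 1)) ^ q F ^ j ≤
        L * ∏ j ∈ Finset.range (i + 1), ((q F : ℝ) ^ q F) ^ q F ^ j := by
      have h4 : ‖z‖ ^ (q F - 1) = L * (q F : ℝ) ^ q F := by
        rw [hL]
        field_simp
      rw [h4]
      simp only [mul_pow L, Finset.prod_mul_distrib]
      refine mul_le_mul_of_nonneg_right ?_ (by positivity)
      rw [Finset.prod_range_succ', pow_zero, pow_one]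
      exact mul_le_of_le_one_left hL0 (Finset.prod_le_one (fun j _ => by positivity)
        fun j _ => pow_le_one₀ hL0 hL1.le)
    have h5 : ∏ j ∈ Finset.range (i + 1), ((q F : ℝ) ^ q F) ^ q F ^ j ≤
        ((q F : ℝ) ^ (i + 1)) ^ q F ^ (i + 1) := by
      simp only [← pow_mul]
      rw [Finset.prod_pow_eq_pow_sum]
      refine pow_le_pow_right₀ hq.le ?_
      refine (Finset.sum_le_card_nsmul _ _ (q F ^ (i + 1)) fun j hj => ?_).trans (by simp)
      rw [← pow_succ']
      exact Nat.pow_le_pow_right q_pos (Finset.mem_range.1 hj)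
    calc ‖z‖ * ∏ j ∈ Finset.range (i + 1), (‖z‖ ^ (q F - 1)) ^ q F ^ j
        ≤ ‖z‖ * (L * ((q F : ℝ) ^ (i + 1)) ^ q F ^ (i + 1)) := by
          refine mul_le_mul_of_nonneg_left (h3.trans ?_) hzpos.le
          exact mul_le_mul_of_nonneg_left h5 hL0
      _ = _ := by ring
  have h6 := norm_hasSum_le h1 h2
  have h7 : ‖carlitzExp z - z‖ < ‖z‖ := h6.trans_lt (by nlinarith)
  have h8 := norm_add_eq_of_lt h7
  rwa [add_sub_cancel] at h8

end DrinfeldMS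

namespace DrinfeldMS

variable {F : Type*} [Field F] [Fintype F]

/-! ### The Carlitz period -/

theorem theta_ne_zero : theta F ≠ 0 := by
  rw [← norm_pos_iff, norm_theta]
  exact zero_lt_one.trans one_lt_q_real

theorem theta_pow_sub_theta_ne_zero (n : ℕ) : theta F ^ q F ^ (n + 1) - theta F ≠ 0 := by
  rw [← norm_pos_iff, norm_theta_pow_sub_theta]
  have := one_lt_q_real (F := F)
  positivity

/-- The coefficients `(-1)ⁿ / Lₙ` of the Carlitz logarithm. -/
def carlitzLogCoeff (F : Type*) [Field F] [Fintype F] : ℕ → Cinf F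
  | 0 => 1
  | n + 1 => -carlitzLogCoeff F n / (theta F ^ q F ^ (n + 1) - theta F)

theorem carlitzLogCoeff_succ_mul (n : ℕ) :
    carlitzLogCoeff F (n + 1) * (theta F ^ q F ^ (n + 1) - theta F) = -carlitzLogCoeff F n := by
  rw [carlitzLogCoeff, div_mul_cancel₀ _ (theta_pow_sub_theta_ne_zero n)]

theorem carlitzLogCoeff_ne_zero (n : ℕ) : carlitzLogCoeff F n ≠ 0 := by
  induction n with
  | zero => simp [carlitzLogCoeff]
  | succ n ih =>
    rw [carlitzLogCoeff]
    exact div_ne_zero (neg_ne_zero.2 ih) (theta_pow_sub_theta_ne_zero n)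

/-- The composition of the Carlitz exponential and the Carlitz logarithm is the identity. -/
theorem sum_exp_log_coeff (d : ℕ) : ∑ i ∈ Finset.range (d + 2),
    (carlitzD F i)⁻¹ * carlitzLogCoeff F (d + 1 - i) ^ q F ^ i = 0 := by
  set c : ℕ → Cinf F := fun d => ∑ i ∈ Finset.range (d + 1),
    (carlitzD F i)⁻¹ * carlitzLogCoeff F (d - i) ^ q F ^ i with hc
  -- Split $\theta^{q^{d+1}}-\theta=(\theta^{q^{d+1-i}}-\theta)^{q^i}+(\theta^{q^i}-\theta)$ and
  -- apply the recursions of the logarithm and exponential coefficients. Since `c 0 = 1`, all later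
  -- `c d` vanish.
  have hrec : ∀ d, (theta F ^ q F ^ (d + 1) - theta F) * c (d + 1) = c d ^ q F - c d := by
    intro d
    have h1 : (theta F ^ q F ^ (d + 1) - theta F) * c (d + 1) =
        ∑ i ∈ Finset.range (d + 2), (carlitzD F i)⁻¹ * (carlitzLogCoeff F (d + 1 - i) *
          (theta F ^ q F ^ (d + 1 - i) - theta F)) ^ q F ^ i +
        ∑ i ∈ Finset.range (d + 2), (carlitzD F i)⁻¹ * (theta F ^ q F ^ i - theta F) *
          carlitzLogCoeff F (d + 1 - i) ^ q F ^ i := by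
      rw [hc, Finset.mul_sum, ← Finset.sum_add_distrib]
      refine Finset.sum_congr rfl fun i hi => ?_
      have h2 : d + 1 - i + i = d + 1 :=
        Nat.sub_add_cancel (Nat.lt_succ_iff.1 (Finset.mem_range.1 hi))
      rw [mul_pow, sub_pow_q_pow, ← pow_mul, ← pow_add, h2]
      ring
    rw [h1, Finset.sum_range_succ, Nat.sub_self, pow_zero, pow_one, sub_self, mul_zero,
      zero_pow (pow_pos q_pos _).ne', mul_zero, add_zero, Finset.sum_range_succ' _ (d + 1)]
    simp only [pow_zero, pow_one, sub_self, mul_zero, zero_mul, add_zero, Nat.add_sub_add_right]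
    obtain ⟨φ, hφ⟩ := exists_frobenius F 1
    simp only [pow_one] at hφ
    rw [← hφ (c d), hc, map_sum, add_comm, sub_eq_add_neg, ← Finset.sum_neg_distrib]
    congr 1
    · refine Finset.sum_congr rfl fun i _ => ?_
      have hD := carlitzD_ne_zero (F := F) i
      have hθ := theta_pow_sub_theta_ne_zero (F := F) i
      rw [hφ, carlitzD_succ, mul_pow, inv_pow, ← pow_mul, ← pow_succ]
      field_simp
    · refine Finset.sum_congr rfl fun i hi => ?_
      have h2 : d + 1 - i = d - i + 1 := by
        have := Finset.mem_range.1 hi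
        omega
      rw [h2, carlitzLogCoeff_succ_mul, neg_pow_q_pow, mul_neg]
  have hzero : ∀ d, c (d + 1) = 0 := by
    intro d
    have hne := theta_pow_sub_theta_ne_zero (F := F) d
    refine (mul_eq_zero.1 ((hrec d).trans ?_)).resolve_left hne
    induction d with
    | zero => simp [hc, carlitzD_zero, carlitzLogCoeff]
    | succ d ih =>
      have hne := theta_pow_sub_theta_ne_zero (F := F) d
      rw [(mul_eq_zero.1 ((hrec d).trans (ih hne))).resolve_left hne, zero_pow q_pos.ne', sub_zero]
  exact hzero d

section Period

variable {ρ : Cinf F}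

theorem norm_theta_zpow (i : ℕ) :
    ‖theta F ^ (1 - (q F : ℤ) ^ (i + 1))‖ ≤ ((q F : ℝ)⁻¹) ^ (i + 1) := by
  have hq := one_lt_q_real (F := F)
  rw [norm_zpow, norm_theta, ← zpow_natCast, inv_zpow, ← zpow_neg]
  refine zpow_le_zpow_right₀ hq.le ?_
  have h : i + 1 < q F ^ (i + 1) := Nat.lt_pow_self (one_lt_q F)
  have h' : ((i + 1 : ℕ) : ℤ) < (q F : ℤ) ^ (i + 1) := by exact_mod_cast h
  linarith

theorem norm_theta_zpow_lt_one (i : ℕ) : ‖theta F ^ (1 - (q F : ℤ) ^ (i + 1))‖ < 1 := by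
  have hq := one_lt_q_real (F := F)
  exact (norm_theta_zpow i).trans_lt (pow_lt_one₀ (by positivity) (inv_lt_one_of_one_lt₀ hq)
    (by omega))

theorem norm_one_sub_theta_zpow (i : ℕ) : ‖1 - theta F ^ (1 - (q F : ℤ) ^ (i + 1))‖ = 1 := by
  rw [sub_eq_add_neg, norm_add_eq_of_lt (by
    rw [norm_neg, norm_one]
    exact norm_theta_zpow_lt_one i), norm_one]

theorem one_sub_theta_zpow_ne_zero (i : ℕ) : 1 - theta F ^ (1 - (q F : ℤ) ^ (i + 1)) ≠ 0 := by
  rw [← norm_pos_iff, norm_one_sub_theta_zpow]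
  exact one_pos

theorem multipliable_carlitzPeriod :
    Multipliable fun i : ℕ => (1 - theta F ^ (1 - (q F : ℤ) ^ (i + 1)))⁻¹ := by
  have hq := one_lt_q_real (F := F)
  set x : ℕ → Cinf F := fun i => theta F ^ (1 - (q F : ℤ) ^ (i + 1))
  have h : (fun i : ℕ => (1 - x i)⁻¹) = fun i => 1 + x i / (1 - x i) := by
    funext i
    have := one_sub_theta_zpow_ne_zero (F := F) i
    change 1 - x i ≠ 0 at this
    field_simp
    ring
  rw [h]
  refine multipliable_one_add_of_summable (Summable.of_nonneg_of_le (fun i => norm_nonneg _)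
    (fun i => ?_) ((summable_geometric_of_lt_one (by positivity)
      (inv_lt_one_of_one_lt₀ hq)).comp_injective (add_left_injective 1)))
  rw [norm_div, norm_one_sub_theta_zpow, div_one]
  exact norm_theta_zpow i

/-- The partial products of the Carlitz period. -/
def partialPeriod (ρ : Cinf F) (n : ℕ) : Cinf F :=
  theta F * ρ * ∏ i ∈ Finset.range n, (1 - theta F ^ (1 - (q F : ℤ) ^ (i + 1)))⁻¹

theorem tendsto_partialPeriod (ρ : Cinf F) :
    Tendsto (partialPeriod ρ) atTop (𝓝 (carlitzPeriod ρ)) :=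
  (multipliable_carlitzPeriod.hasProd.tendsto_prod_nat).const_mul _

theorem norm_partialPeriod (ρ : Cinf F) (n : ℕ) : ‖partialPeriod ρ n‖ = ‖theta F * ρ‖ := by
  rw [partialPeriod, norm_mul _ (∏ i ∈ _, _), norm_prod, Finset.prod_eq_one fun i _ => by
    rw [norm_inv, norm_one_sub_theta_zpow, inv_one], mul_one]

theorem norm_carlitzPeriod (ρ : Cinf F) : ‖carlitzPeriod ρ‖ = ‖theta F * ρ‖ :=
  tendsto_nhds_unique (tendsto_partialPeriod ρ).norm
    (by simpa only [norm_partialPeriod] using tendsto_const_nhds)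

theorem carlitzExp_theta_div_root {l : Cinf F} (hl : carlitzExp l = 0) :
    theta F * carlitzExp (l / theta F) + carlitzExp (l / theta F) ^ q F = 0 := by
  rw [← carlitzExp_theta_mul, mul_div_cancel₀ _ theta_ne_zero, hl]

variable (hρ : ρ ^ (q F - 1) = -theta F)
include hρ

theorem norm_period_pow : ‖theta F * ρ‖ ^ (q F - 1) = (q F : ℝ) ^ q F := by
  rw [norm_mul, mul_pow, ← norm_pow ρ, hρ, norm_neg, norm_theta, ← pow_succ,
    Nat.sub_add_cancel q_pos]

theorem carlitzPeriod_ne_zero : carlitzPeriod ρ ≠ 0 := by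
  rw [← norm_pos_iff, norm_carlitzPeriod, norm_pos_iff]
  refine mul_ne_zero theta_ne_zero ?_
  rintro rfl
  rw [zero_pow (Nat.sub_pos_of_lt (one_lt_q F)).ne', eq_comm, neg_eq_zero] at hρ
  exact theta_ne_zero hρ

/-- The ratio of consecutive coefficients of the Carlitz logarithm. -/
theorem carlitzLogCoeff_pow_div (n : ℕ) :
    carlitzLogCoeff F n ^ q F / carlitzLogCoeff F (n + 1) =
      partialPeriod ρ n ^ (q F - 1) * (1 - theta F ^ (1 - (q F : ℤ) ^ (n + 1))) := by
  have hθ := theta_ne_zero (F := F)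
  obtain ⟨t, ht⟩ : ∃ t, q F = t + 1 := ⟨q F - 1, (Nat.sub_add_cancel q_pos).symm⟩
  have hfac : ∀ n : ℕ, theta F ^ q F ^ (n + 1) - theta F =
      theta F ^ q F ^ (n + 1) * (1 - theta F ^ (1 - (q F : ℤ) ^ (n + 1))) := fun n => by
    rw [zpow_sub₀ hθ, zpow_one, ← Nat.cast_pow, zpow_natCast]
    field_simp
  have hβ : ∀ n, carlitzLogCoeff F n ^ q F / carlitzLogCoeff F (n + 1) =
      -(theta F ^ q F ^ (n + 1) - theta F) * carlitzLogCoeff F n ^ t := fun n => by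
    have h1 := carlitzLogCoeff_ne_zero (F := F) n
    rw [carlitzLogCoeff, ht, pow_succ]
    field_simp
  have ht' : q F - 1 = t := by omega
  rw [ht'] at hρ ⊢
  induction n with
  | zero =>
    rw [hβ, hfac, partialPeriod, carlitzLogCoeff, Finset.prod_range_zero, one_pow, mul_one, mul_one,
      mul_pow, hρ, zero_add, pow_one]
    rw [show theta F ^ q F = theta F ^ t * theta F by rw [ht, pow_succ]]
    ring
  | succ n ih =>
    have h1 := carlitzLogCoeff_ne_zero (F := F) n
    have h2 := carlitzLogCoeff_ne_zero (F := F) (n + 1)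
    have h3 := one_sub_theta_zpow_ne_zero (F := F) n
    have h4 : carlitzLogCoeff F n = -(carlitzLogCoeff F (n + 1) *
        (theta F ^ q F ^ (n + 1) - theta F)) := by
      rw [carlitzLogCoeff_succ_mul, neg_neg]
    have h5 : carlitzLogCoeff F n ^ q F = -(carlitzLogCoeff F (n + 1) ^ t *
        carlitzLogCoeff F (n + 1) * (theta F ^ q F ^ (n + 2) *
          (1 - theta F ^ (1 - (q F : ℤ) ^ (n + 1))) ^ q F)) := by
      have h6 := neg_pow_q_pow (F := F)
        (carlitzLogCoeff F (n + 1) * (theta F ^ q F ^ (n + 1) - theta F)) 1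
      rw [pow_one] at h6
      rw [h4, h6, mul_pow, hfac n, mul_pow, ← pow_mul, ← pow_succ,
        show carlitzLogCoeff F (n + 1) ^ q F = carlitzLogCoeff F (n + 1) ^ t *
          carlitzLogCoeff F (n + 1) by rw [ht, pow_succ]]
    rw [h5, show (1 - theta F ^ (1 - (q F : ℤ) ^ (n + 1))) ^ q F =
      (1 - theta F ^ (1 - (q F : ℤ) ^ (n + 1))) ^ t *
        (1 - theta F ^ (1 - (q F : ℤ) ^ (n + 1))) by rw [ht, pow_succ], div_eq_iff h2] at ih
    rw [hβ, hfac (n + 1), partialPeriod, Finset.prod_range_succ, ← mul_assoc, ← partialPeriod,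
      mul_pow, inv_pow]
    have h7 : -(carlitzLogCoeff F (n + 1) ^ t * theta F ^ q F ^ (n + 2)) *
        (1 - theta F ^ (1 - (q F : ℤ) ^ (n + 1))) ^ t = partialPeriod ρ n ^ t := by
      have h8 : (carlitzLogCoeff F (n + 1) * (1 - theta F ^ (1 - (q F : ℤ) ^ (n + 1)))) ≠ 0 :=
        mul_ne_zero h2 h3
      refine mul_right_cancel₀ h8 ?_
      linear_combination ih
    rw [← h7]
    field_simp

theorem norm_carlitzLogCoeff_pow_div (n : ℕ) :
    ‖carlitzLogCoeff F n ^ q F / carlitzLogCoeff F (n + 1)‖ = (q F : ℝ) ^ q F := by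
  rw [carlitzLogCoeff_pow_div hρ, norm_mul, norm_one_sub_theta_zpow, mul_one, norm_pow,
    norm_partialPeriod, norm_period_pow hρ]

theorem tendsto_carlitzLogCoeff_pow_div :
    Tendsto (fun n => carlitzLogCoeff F n ^ q F / carlitzLogCoeff F (n + 1)) atTop
      (𝓝 (carlitzPeriod ρ ^ (q F - 1))) := by
  have hq := one_lt_q_real (F := F)
  have h0 : Tendsto (fun n : ℕ => theta F ^ (1 - (q F : ℤ) ^ (n + 1))) atTop (𝓝 0) := by
    refine squeeze_zero_norm norm_theta_zpow ?_
    exact (tendsto_pow_atTop_nhds_zero_of_lt_one (by positivity)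
      (inv_lt_one_of_one_lt₀ hq)).comp (tendsto_add_atTop_nat 1)
  have h1 := ((tendsto_partialPeriod ρ).pow (q F - 1)).mul
    ((tendsto_const_nhds (x := (1 : Cinf F))).sub h0)
  simp only [sub_zero, mul_one] at h1
  exact h1.congr fun n => (carlitzLogCoeff_pow_div hρ n).symm

/-- With $\ell_n$ the logarithm coefficients, divide the vanishing coefficient of $\exp\circ\log$ in
degree $q^d$ by $\ell_d$. The ratios $\beta_n=\ell_n^q/\ell_{n+1}$ tend to $\tilde\pi^{q-1}$, so
letting $d\to\infty$ gives $\sum\tilde\pi^{q^i-1}/D_i=0$. -/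
theorem carlitzExp_carlitzPeriod : carlitzExp (carlitzPeriod ρ) = 0 := by
  set β : ℕ → Cinf F := fun n => carlitzLogCoeff F n ^ q F / carlitzLogCoeff F (n + 1) with hβ
  set T : ℕ → ℕ → Cinf F := fun d i =>
    if i ≤ d then (carlitzD F i)⁻¹ * ∏ j ∈ Finset.range i, β (d - 1 - j) ^ q F ^ j else 0 with hT
  set g : ℕ → Cinf F := fun i =>
    (carlitzD F i)⁻¹ * ∏ j ∈ Finset.range i, (carlitzPeriod ρ ^ (q F - 1)) ^ q F ^ j with hg
  have hexp : ∀ i, carlitzPeriod ρ ^ q F ^ i / carlitzD F i = carlitzPeriod ρ * g i := fun i => by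
    rw [pow_q_pow_eq _ F, hg]
    ring
  have hnorm : ‖carlitzPeriod ρ ^ (q F - 1)‖ = (q F : ℝ) ^ q F := by
    rw [norm_pow, norm_carlitzPeriod, norm_period_pow hρ]
  have hsum : Summable fun i => ‖g i‖ := by
    have h := (summable_norm_carlitzExp (carlitzPeriod ρ)).mul_left ‖carlitzPeriod ρ‖⁻¹
    refine h.congr fun i => ?_
    rw [hexp, norm_mul, inv_mul_cancel_left₀ (norm_ne_zero_iff.2 (carlitzPeriod_ne_zero hρ))]
  have hlim : ∀ i, Tendsto (T · i) atTop (𝓝 (g i)) := fun i => by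
    have h1 : Tendsto (fun d => (carlitzD F i)⁻¹ * ∏ j ∈ Finset.range i, β (d - 1 - j) ^ q F ^ j)
        atTop (𝓝 (g i)) := by
      refine Tendsto.const_mul _ (tendsto_finsetProd _ fun j _ => Tendsto.pow ?_ _)
      refine (tendsto_carlitzLogCoeff_pow_div hρ).comp ?_
      simpa only [Nat.sub_sub] using tendsto_sub_atTop_nat (1 + j)
    refine h1.congr' ?_
    filter_upwards [eventually_ge_atTop i] with d hd
    rw [hT]
    simp only [if_pos hd]
  -- All $\beta_n$ have the same norm as their limit, so the limiting series dominates.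
  have hbound : ∀ d i, ‖T d i‖ ≤ ‖g i‖ := fun d i => by
    simp only [hT]
    split_ifs
    · simp only [hg, norm_mul, norm_prod, norm_pow _ (q F ^ _), hnorm]
      simp only [hβ, norm_carlitzLogCoeff_pow_div hρ]
      exact le_rfl
    · rw [norm_zero]
      exact norm_nonneg _
  have hTsum : ∀ d, ∑' i, T (d + 1) i = 0 := fun d => by
    rw [tsum_eq_sum (s := Finset.range (d + 2)) fun i hi => by
      simp only [hT]
      rw [if_neg]
      simpa [Nat.lt_succ_iff] using hi]
    have hprod : ∀ i ≤ d + 1, ∏ j ∈ Finset.range i, β (d - j) ^ q F ^ j =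
        carlitzLogCoeff F (d + 1 - i) ^ q F ^ i / carlitzLogCoeff F (d + 1) := by
      intro i
      induction i with
      | zero => intro _; simp [carlitzLogCoeff_ne_zero]
      | succ i ih =>
        intro hi
        have h1 : d + 1 - i = d - i + 1 := by omega
        have h2 : d + 1 - (i + 1) = d - i := by omega
        have h3 := carlitzLogCoeff_ne_zero (F := F) (d - i + 1)
        have h4 := carlitzLogCoeff_ne_zero (F := F) (d + 1)
        rw [Finset.prod_range_succ, ih (by omega), h1, h2, hβ, div_pow, ← pow_mul, ← pow_succ']
        field_simp
    have h5 : ∀ i ∈ Finset.range (d + 2), T (d + 1) i = (carlitzD F i)⁻¹ *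
        carlitzLogCoeff F (d + 1 - i) ^ q F ^ i / carlitzLogCoeff F (d + 1) := fun i hi => by
      have hi' : i ≤ d + 1 := Nat.lt_succ_iff.1 (Finset.mem_range.1 hi)
      simp only [hT]
      rw [if_pos hi', Nat.add_sub_cancel, hprod i hi', mul_div_assoc]
    rw [Finset.sum_congr rfl h5, ← Finset.sum_div, sum_exp_log_coeff, zero_div]
  have hmain := tendsto_tsum_of_dominated_convergence hsum hlim
    (Eventually.of_forall fun d i => hbound d i)
  have hzero : ∑' i, g i = 0 := by
    refine tendsto_nhds_unique (hmain.comp (tendsto_add_atTop_nat 1)) ?_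
    simp only [Function.comp_def, hTsum]
    exact tendsto_const_nhds
  rw [carlitzExp]
  simp only [hexp]
  rw [tsum_mul_left, hzero, mul_zero]

/-- The zeros of the Carlitz exponential lie in `π̃ K_∞`. -/
theorem exists_ofKinf_of_carlitzExp_eq_zero {l : Cinf F} (hl : carlitzExp l = 0) :
    ∃ κ : Kinf F, l = carlitzPeriod ρ * ofKinf F κ := by
  have hq := one_lt_q_real (F := F)
  have hπ := carlitzPeriod_ne_zero hρ
  have hπn : 0 < ‖carlitzPeriod ρ‖ := norm_pos_iff.2 hπ
  have hiso : ∀ z : Cinf F, ‖z‖ < ‖carlitzPeriod ρ‖ → ‖carlitzExp z‖ = ‖z‖ := fun z hz => by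
    refine norm_carlitzExp_of_lt ?_
    rw [← norm_period_pow hρ, ← norm_carlitzPeriod]
    exact pow_lt_pow_left₀ hz (norm_nonneg _) (Nat.sub_pos_of_lt (one_lt_q F)).ne'
  obtain ⟨t, ht⟩ : ∃ t, q F = t + 1 := ⟨q F - 1, (Nat.sub_add_cancel q_pos).symm⟩
  set e := carlitzExp (carlitzPeriod ρ / theta F) with he
  have he0 : e ≠ 0 := by
    rw [← norm_pos_iff, he, hiso, norm_div, norm_theta]
    · positivity
    · rw [norm_div, norm_theta]
      exact div_lt_self hπn hq
  have het : e ^ t = -theta F := by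
    have h := carlitzExp_theta_div_root (carlitzExp_carlitzPeriod hρ)
    rw [ht, pow_succ, ← add_mul] at h
    exact eq_neg_of_add_eq_zero_right ((mul_eq_zero.1 h).resolve_right he0)
  -- Descent. Zeros smaller than the period vanish because the exponential is an isometry there.
  -- Otherwise $\exp_C(l/\theta)$ is a root of $\theta u+u^q$, so it is $ce$ with $c\in\mathbb F_q$,
  -- and $(l-c\tilde\pi)/\theta$ is a zero satisfying the bound for the preceding `n`.
  have key : ∀ n : ℕ, ∀ l : Cinf F, carlitzExp l = 0 → ‖l‖ < (q F : ℝ) ^ n * ‖carlitzPeriod ρ‖ →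
      ∃ κ : Kinf F, l = carlitzPeriod ρ * ofKinf F κ := by
    intro n
    induction n with
    | zero =>
      intro l hl hlt
      rw [pow_zero, one_mul] at hlt
      have h := hiso l hlt
      rw [hl, norm_zero, eq_comm, norm_eq_zero] at h
      exact ⟨0, by simp [h]⟩
    | succ n ih =>
      intro l hl hlt
      set u := carlitzExp (l / theta F) with hu
      have h1 := carlitzExp_theta_div_root hl
      obtain ⟨c, hc⟩ : ∃ c : F, u = ofFq F c * e := by
        by_cases hu0 : u = 0
        · exact ⟨0, by simp [hu0]⟩
        · rw [ht, pow_succ, ← add_mul] at h1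
          have h2 := eq_neg_of_add_eq_zero_right ((mul_eq_zero.1 h1).resolve_right hu0)
          obtain ⟨c, hc⟩ := mem_range_ofFq_of_pow_q_eq (x := u / e) (by
            rw [ht, pow_succ, div_pow, het, hu, h2, div_self (neg_ne_zero.2 theta_ne_zero),
              one_mul])
          exact ⟨c, by rw [← hc, div_mul_cancel₀ _ he0]⟩
      have h3 : carlitzExp ((l - ofFq F c * carlitzPeriod ρ) / theta F) = 0 := by
        rw [sub_div, carlitzExp_sub, mul_div_assoc, carlitzExp_ofFq_mul, ← hu, hc, sub_self]
      have hcn : ‖ofFq F c‖ ≤ 1 := by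
        by_contra! h
        have h4 := congrArg norm (ofFq_pow_q_pow c 1)
        rw [norm_pow, pow_one] at h4
        exact (lt_self_pow₀ h (one_lt_q F)).ne' h4
      have hp : ‖ofFq F c * carlitzPeriod ρ‖ < (q F : ℝ) ^ (n + 1) * ‖carlitzPeriod ρ‖ := by
        rw [norm_mul]
        refine mul_lt_mul_of_pos_right (hcn.trans_lt ?_) hπn
        exact one_lt_pow₀ hq (by omega)
      obtain ⟨κ, hκ⟩ := ih _ h3 (by
        rw [norm_div, norm_theta, div_lt_iff₀ (by positivity), sub_eq_add_neg]
        refine (IsUltrametricDist.norm_add_le_max _ _).trans_lt ?_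
        rw [norm_neg]
        refine (max_lt hlt hp).trans_eq ?_
        ring)
      refine ⟨ratToKinf F (RatFunc.C c) + ratToKinf F (algebraMap F[X] (RatFunc F) X) * κ, ?_⟩
      rw [div_eq_iff theta_ne_zero, sub_eq_iff_eq_add] at hκ
      have hcc : ofKinf F (ratToKinf F (RatFunc.C c)) = ofFq F c := rfl
      have hxx : ofKinf F (ratToKinf F (algebraMap F[X] (RatFunc F) X)) = theta F := rfl
      rw [hκ, map_add, map_mul, hcc, hxx]
      ring
  obtain ⟨n, hn⟩ := pow_unbounded_of_one_lt (‖l‖ / ‖carlitzPeriod ρ‖) hq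
  exact key n l hl ((div_lt_iff₀ hπn).1 hn)

end Period

end DrinfeldMS

namespace DrinfeldMS

variable {F : Type*} [Field F] [Fintype F]

/-! ### Expansions in the parameter at infinity -/

section UExpansion

theorem q_pow_injective : Function.Injective fun i : ℕ => q F ^ i :=
  Nat.pow_right_injective (one_lt_q F)

/-- The power series `exp_C (T / N)`. -/
def carlitzSeries (N : F[X]) : PowerSeries (Cinf F) :=
  PowerSeries.mk (Function.extend (fun i : ℕ => q F ^ i)
    (fun i => (ofA F N ^ q F ^ i * carlitzD F i)⁻¹) 0)

theorem coeff_carlitzSeries_q_pow (N : F[X]) (i : ℕ) :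
    (carlitzSeries N).coeff (q F ^ i) = (ofA F N ^ q F ^ i * carlitzD F i)⁻¹ := by
  rw [carlitzSeries, PowerSeries.coeff_mk]
  exact q_pow_injective.extend_apply _ _ i

theorem coeff_carlitzSeries_of_notMem (N : F[X]) {n : ℕ}
    (hn : n ∉ Set.range fun i : ℕ => q F ^ i) : (carlitzSeries N).coeff n = 0 := by
  rw [carlitzSeries, PowerSeries.coeff_mk, Function.extend_apply' _ _ _ hn]
  rfl

theorem X_dvd_carlitzSeries (N : F[X]) : PowerSeries.X ∣ carlitzSeries N := by
  rw [PowerSeries.X_dvd_iff, ← PowerSeries.coeff_zero_eq_constantCoeff_apply]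
  refine coeff_carlitzSeries_of_notMem N ?_
  rintro ⟨i, hi⟩
  exact (pow_pos q_pos i).ne' hi

theorem coeff_carlitzSeries_mem {L : Subfield (Cinf F)} (hL : ∀ x : RatFunc F, ofK F x ∈ L)
    (N : F[X]) (n : ℕ) : (carlitzSeries N).coeff n ∈ L := by
  by_cases hn : n ∈ Set.range fun i : ℕ => q F ^ i
  · obtain ⟨i, rfl⟩ := hn
    rw [coeff_carlitzSeries_q_pow]
    exact inv_mem (mul_mem (pow_mem (hL _) _) (prod_mem fun j _ =>
      sub_mem (pow_mem (hL _) _) (pow_mem (hL _) _)))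
  · rw [coeff_carlitzSeries_of_notMem N hn]
    exact zero_mem L

theorem coeff_carlitzSeries_pow_mem {L : Subfield (Cinf F)} (hL : ∀ x : RatFunc F, ofK F x ∈ L)
    (N : F[X]) (k n : ℕ) : (carlitzSeries N ^ k).coeff n ∈ L := by
  induction k generalizing n with
  | zero =>
    rw [pow_zero, PowerSeries.coeff_one]
    split_ifs
    · exact one_mem L
    · exact zero_mem L
  | succ k ih =>
    rw [pow_succ, PowerSeries.coeff_mul]
    exact sum_mem fun ij _ => mul_mem (ih _) (coeff_carlitzSeries_mem hL N _)

theorem hasTaylorOn_carlitzExp (a z : Cinf F) (N : F[X]) (R : ℝ) :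
    HasTaylorOn (fun x => carlitzExp (a * x / ofA F N)) z R
      (PowerSeries.C (carlitzExp (a * z / ofA F N)) +
        PowerSeries.rescale a (carlitzSeries N)) := by
  have h1 : HasTaylorOn (fun x => carlitzExp (a * (x - z) / ofA F N)) z R
      (PowerSeries.rescale a (carlitzSeries N)) := fun ε _ => by
    simp only [add_sub_cancel_left]
    refine (q_pow_injective (F := F).hasSum_iff fun n hn => ?_).1 ?_
    · rw [PowerSeries.coeff_rescale, coeff_carlitzSeries_of_notMem N hn, mul_zero, zero_mul]
    · refine (hasSum_carlitzExp _).congr_fun fun i => ?_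
      rw [Function.comp_apply, PowerSeries.coeff_rescale, coeff_carlitzSeries_q_pow, div_pow,
        mul_pow, mul_inv]
      ring
  refine ((hasTaylorOn_const _).add h1).congr fun x _ => ?_
  rw [← carlitzExp_add]
  congr 1
  ring

variable {ρ : Cinf F} {N : F[X]} {z : Cinf F}

theorem carlitzExp_ne_zero_of_mem_Omega (hρ : ρ ^ (q F - 1) = -theta F) (hN : N ≠ 0)
    (hz : z ∈ Omega F) : carlitzExp (carlitzPeriod ρ * z / ofA F N) ≠ 0 := by
  intro h
  have hN' : ofA F N ≠ 0 := by
    rw [ofA, RingHom.comp_apply, _root_.map_ne_zero]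
    simpa using hN
  obtain ⟨κ, hκ⟩ := exists_ofKinf_of_carlitzExp_eq_zero hρ h
  rw [mul_div_assoc] at hκ
  have h1 := mul_left_cancel₀ (carlitzPeriod_ne_zero hρ) hκ
  rw [div_eq_iff hN'] at h1
  refine hz ⟨κ * ratToKinf F (algebraMap F[X] (RatFunc F) N), ?_⟩
  rw [map_mul, h1]
  rfl

theorem uParam_ne_zero (hρ : ρ ^ (q F - 1) = -theta F) (hN : N ≠ 0) (hz : z ∈ Omega F) :
    uParam ρ N z ≠ 0 :=
  inv_ne_zero (carlitzExp_ne_zero_of_mem_Omega hρ hN hz)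

theorem analyticAt_uParam (hρ : ρ ^ (q F - 1) = -theta F) (hN : N ≠ 0) (hz : z ∈ Omega F) :
    AnalyticAt (Cinf F) (uParam ρ N) z :=
  ((hasTaylorOn_carlitzExp (carlitzPeriod ρ) z N 1).analyticAt one_pos).fun_inv
    (carlitzExp_ne_zero_of_mem_Omega hρ hN hz)

/-- Additivity of the exponential: $u(z+\epsilon)^{-1}=u(z)^{-1}+\exp_C(\tilde\pi\epsilon/N)$. -/
theorem taylor_uParam_mul (hρ : ρ ^ (q F - 1) = -theta F) (hN : N ≠ 0) (hz : z ∈ Omega F) :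
    taylor (uParam ρ N) z * (1 + PowerSeries.C (uParam ρ N z) *
      PowerSeries.rescale (carlitzPeriod ρ) (carlitzSeries N)) = PowerSeries.C (uParam ρ N z) := by
  have h0 := carlitzExp_ne_zero_of_mem_Omega hρ hN hz
  have hT := hasTaylorOn_carlitzExp (carlitzPeriod ρ) z N 1
  have h := taylor_inv (hT.analyticAt one_pos) h0
  rw [hT.taylor_eq one_pos] at h
  have h1 : PowerSeries.C (uParam ρ N z) *
      PowerSeries.C (carlitzExp (carlitzPeriod ρ * z / ofA F N)) = 1 := by
    rw [← map_mul, uParam, inv_mul_cancel₀ h0, map_one]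
  change taylor (uParam ρ N) z * _ = 1 at h
  linear_combination PowerSeries.C (uParam ρ N z) * h - taylor (uParam ρ N) z * h1

/-- Truncated binomial expansion of `U ^ l = u ^ l (1 + u W) ^ (-l)`. -/
theorem X_pow_dvd_pow_sub_sum {R : Type*} [CommRing R] {U W u : PowerSeries R}
    (hU : U * (1 + u * W) = u) (hW : PowerSeries.X ∣ W) (n l : ℕ) :
    PowerSeries.X ^ (n + 1) ∣ U ^ l - ∑ k ∈ Finset.range (n + 1),
      ((Ring.choose (-(l : ℤ)) k : ℤ) : PowerSeries R) * u ^ (l + k) * W ^ k := by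
  have hunit : IsUnit (1 + u * W) := by
    rw [PowerSeries.isUnit_iff_constantCoeff]
    simp [PowerSeries.X_dvd_iff.1 hW]
  induction l with
  | zero =>
    rw [Finset.sum_range_succ']
    simp [Ring.choose_zero_succ]
  | succ l ih =>
    rw [← hunit.dvd_mul_right]
    -- By Pascal's rule, multiplying the truncated sum by $1+uW$ gives the sum for the preceding
    -- `l`, up to one term divisible by $W^{n+1}$.
    have hsum : ∀ n : ℕ, (∑ k ∈ Finset.range (n + 1),
        ((Ring.choose (-((l + 1 : ℕ) : ℤ)) k : ℤ) : PowerSeries R) * u ^ (l + 1 + k) * W ^ k) *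
          (1 + u * W) = u * (∑ k ∈ Finset.range (n + 1),
            ((Ring.choose (-(l : ℤ)) k : ℤ) : PowerSeries R) * u ^ (l + k) * W ^ k) +
          ((Ring.choose (-((l + 1 : ℕ) : ℤ)) n : ℤ) : PowerSeries R) * u ^ (l + n + 2) *
            W ^ (n + 1) := by
      intro n
      induction n with
      | zero =>
        simp
        ring
      | succ n ihn =>
        have hc : Ring.choose (-(l : ℤ)) (n + 1) = Ring.choose (-((l + 1 : ℕ) : ℤ)) n +
            Ring.choose (-((l + 1 : ℕ) : ℤ)) (n + 1) := by
          rw [← Ring.choose_succ_succ]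
          congr 1
          push_cast
          ring
        rw [Finset.sum_range_succ, add_mul, ihn, Finset.sum_range_succ _ (n + 1), hc, Int.cast_add]
        ring
    rw [sub_mul, hsum, pow_succ U, mul_assoc (U ^ l), hU, ← sub_sub, mul_comm _ u, ← mul_sub]
    exact dvd_sub (ih.mul_left _) ((pow_dvd_pow_of_dvd hW _).mul_left _)

theorem coeff_taylor_uParam_pow (hρ : ρ ^ (q F - 1) = -theta F) (hN : N ≠ 0) (hz : z ∈ Omega F)
    (n l : ℕ) : (taylor (uParam ρ N) z ^ l).coeff n = ∑ k ∈ Finset.range (n + 1),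
      ((Ring.choose (-(l : ℤ)) k : ℤ) : Cinf F) * uParam ρ N z ^ (l + k) *
        (carlitzPeriod ρ ^ n * (carlitzSeries N ^ k).coeff n) := by
  have hW : PowerSeries.X ∣ PowerSeries.rescale (carlitzPeriod ρ) (carlitzSeries N) := by
    rw [PowerSeries.X_dvd_iff, ← PowerSeries.coeff_zero_eq_constantCoeff_apply,
      PowerSeries.coeff_rescale, PowerSeries.coeff_zero_eq_constantCoeff_apply,
      PowerSeries.X_dvd_iff.1 (X_dvd_carlitzSeries N), mul_zero]
  have h := PowerSeries.X_pow_dvd_iff.1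
    (X_pow_dvd_pow_sub_sum (taylor_uParam_mul hρ hN hz) hW n l) n n.lt_succ_self
  rw [map_sub, sub_eq_zero] at h
  rw [h, map_sum]
  refine Finset.sum_congr rfl fun k _ => ?_
  rw [← map_pow, ← map_pow, ← map_intCast (PowerSeries.C (R := Cinf F)), ← map_mul,
    PowerSeries.coeff_C_mul, PowerSeries.coeff_rescale]

/-- The coefficients of the `u_N`-expansion of `∂ⁿ f` in terms of those of `f`. -/
def uDelCoeff (N : F[X]) (n : ℕ) (a : ℕ → Cinf F) (l : ℕ) : Cinf F :=
  ∑ k ∈ Finset.range (n + 1), if k ≤ l then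
    a (l - k) * ((Ring.choose (-((l - k : ℕ) : ℤ)) k : ℤ) : Cinf F) * (carlitzSeries N ^ k).coeff n
    else 0

theorem uDelCoeff_mem {L : Subfield (Cinf F)} (hL : ∀ x : RatFunc F, ofK F x ∈ L) (N : F[X])
    (n : ℕ) {a : ℕ → Cinf F} (ha : ∀ l, a l ∈ L) (l : ℕ) : uDelCoeff N n a l ∈ L := by
  refine sum_mem fun k _ => ?_
  split_ifs
  · exact mul_mem (mul_mem (ha _) (intCast_mem L _)) (coeff_carlitzSeries_pow_mem hL N k n)
  · exact zero_mem L

theorem norm_intCast_le_one (m : ℤ) : ‖(m : Cinf F)‖ ≤ 1 :=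
  IsUltrametricDist.norm_intCast_le_one (Cinf F) m

theorem hasSum_shift {g : ℕ → Cinf F} {T : Cinf F} (h : HasSum g T) (k : ℕ) :
    HasSum (fun m => if k ≤ m then g (m - k) else 0) T := by
  refine ((add_left_injective k).hasSum_iff fun m hm => ?_).1 ?_
  · rw [if_neg]
    intro hk
    exact hm ⟨m - k, Nat.sub_add_cancel hk⟩
  · refine h.congr_fun fun m => ?_
    simp

/-- Convergence at the single point `z` suffices: $u_N(z)\ne0$, so $|u_N|$ is constant near `z` and
the series converges uniformly there. Taylor coefficients then pass to the limit, and the factor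
$\tilde\pi^n$ cancels against the normalization of $\partial^n$. -/
theorem analyticAt_and_hasSum_del_of_summable (hρ : ρ ^ (q F - 1) = -theta F) (hN : N ≠ 0)
    (hz : z ∈ Omega F) {a : ℕ → Cinf F} (ha : Summable fun l => a l * uParam ρ N z ^ l) :
    AnalyticAt (Cinf F) (fun w => ∑' l, a l * uParam ρ N w ^ l) z ∧ ∀ n,
      HasSum (fun l => uDelCoeff N n a l * uParam ρ N z ^ l)
        (del ρ n (fun w => ∑' l, a l * uParam ρ N w ^ l) z) := by
  obtain ⟨p, hp, hchar⟩ := exists_charP_Cinf F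
  have : Fact p.Prime := ⟨hp⟩
  have hu0 : 0 < ‖uParam ρ N z‖ := norm_pos_iff.2 (uParam_ne_zero hρ hN hz)
  have hπ := carlitzPeriod_ne_zero hρ
  have hua := analyticAt_uParam hρ hN hz
  obtain ⟨R₁, hR₁, hT₁⟩ := exists_hasTaylorOn_taylor hua
  obtain ⟨R₂, hR₂, hnear⟩ := Metric.continuousAt_iff.1 hua.continuousAt _ hu0
  set R := min R₁ R₂ with hRdef
  have hR : 0 < R := lt_min hR₁ hR₂
  have hT := hT₁.mono (min_le_left R₁ R₂)
  have hnorm : ∀ x, ‖x - z‖ < R → ‖uParam ρ N x‖ = ‖uParam ρ N z‖ := fun x hx => by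
    have h1 : ‖uParam ρ N x - uParam ρ N z‖ < ‖uParam ρ N z‖ := by
      rw [← dist_eq_norm]
      exact hnear (by rw [dist_eq_norm]; exact hx.trans_le (min_le_right _ _))
    have h2 := norm_add_eq_of_lt h1
    rwa [add_sub_cancel] at h2
  have hterm : ∀ x, ‖x - z‖ < R → ∀ l, ‖a l * uParam ρ N x ^ l‖ = ‖a l * uParam ρ N z ^ l‖ :=
    fun x hx l => by rw [norm_mul, norm_pow, hnorm x hx, ← norm_pow, ← norm_mul]
  obtain ⟨c, hc, hclim⟩ := HasTaylorOn.of_uniform_limit (p := p) hR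
    (f := fun w => ∑' l, a l * uParam ρ N w ^ l)
    (G := fun k w => ∑ l ∈ Finset.range k, a l * uParam ρ N w ^ l)
    (P := fun k => ∑ l ∈ Finset.range k, PowerSeries.C (a l) * taylor (uParam ρ N) z ^ l)
    (fun k => HasTaylorOn.sum _ fun l _ => (hasTaylorOn_const _).mul (hT.pow l))
    (fun η hη => by
      obtain ⟨K, hK⟩ := eventually_atTop.1
        ((summable_iff_tendsto_norm.1 ha).eventually_lt_const hη)
      filter_upwards [eventually_ge_atTop K] with k hk x hx
      have hs : Summable fun l => a l * uParam ρ N x ^ l :=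
        summable_of_norm_le ha (B := 1) fun l => by rw [one_mul, hterm x hx]
      rw [← hs.sum_add_tsum_nat_add k, add_sub_cancel_left]
      refine norm_tsum_le_bound fun l => ?_
      rw [hterm x hx]
      exact (hK _ (hk.trans (Nat.le_add_left _ _))).le)
  refine ⟨hc.analyticAt hR, fun n => ?_⟩
  have hk : ∀ k, ∃ T, HasSum (fun l => a l * (((Ring.choose (-(l : ℤ)) k : ℤ) : Cinf F) *
      uParam ρ N z ^ (l + k) * (carlitzPeriod ρ ^ n * (carlitzSeries N ^ k).coeff n))) T :=
    fun k => by
    refine (summable_of_norm_le ha (B := ‖uParam ρ N z‖ ^ k *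
      ‖carlitzPeriod ρ ^ n * (carlitzSeries N ^ k).coeff n‖) fun l => ?_)
    have h1 := norm_intCast_le_one (F := F) (Ring.choose (-(l : ℤ)) k)
    rw [pow_add, norm_mul, norm_mul, norm_mul, norm_mul (uParam ρ N z ^ l), norm_mul (a l),
      norm_pow _ k]
    calc _ = ‖((Ring.choose (-(l : ℤ)) k : ℤ) : Cinf F)‖ * (‖uParam ρ N z‖ ^ k *
          ‖carlitzPeriod ρ ^ n * (carlitzSeries N ^ k).coeff n‖ *
            (‖a l‖ * ‖uParam ρ N z ^ l‖)) := by ring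
      _ ≤ _ := mul_le_of_le_one_left (by positivity) h1
  choose T hTk using hk
  have hcn : c.coeff n = ∑ k ∈ Finset.range (n + 1), T k := by
    refine tendsto_nhds_unique (hclim n) ?_
    refine (hasSum_sum fun k (_ : k ∈ Finset.range (n + 1)) => hTk k).tendsto_sum_nat.congr
      fun m => ?_
    rw [map_sum]
    refine Finset.sum_congr rfl fun l _ => ?_
    rw [PowerSeries.coeff_C_mul, coeff_taylor_uParam_pow hρ hN hz, Finset.mul_sum]
  rw [del, hc.hyperderiv_eq hR, hcn]
  have h := (hasSum_sum fun k (_ : k ∈ Finset.range (n + 1)) =>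
    hasSum_shift (hTk k) k).div_const (carlitzPeriod ρ ^ n)
  refine h.congr_fun fun l => ?_
  rw [uDelCoeff, Finset.sum_mul, Finset.sum_div]
  refine Finset.sum_congr rfl fun k _ => ?_
  split_ifs with hkl
  · rw [Nat.sub_add_cancel hkl]
    field_simp
  · simp

end UExpansion

/-! ### The width of the cusps -/

theorem cuspGen_ne_zero {Γ : Subgroup (GL (Fin 2) F[X])} (h : IsCongruenceSubgroup Γ) :
    cuspGen Γ ≠ 0 := by
  obtain ⟨n, hn, hΓ⟩ := h
  have hn0 : n ≠ 0 := by
    rintro rfl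
    simp at hn
  have hmem : n ∈ cuspIdeal Γ := by
    refine (le_sSup (a := Ideal.span {n}) fun a ha => ?_) (Ideal.mem_span_singleton_self n)
    rw [Ideal.mem_span_singleton] at ha
    refine ⟨Matrix.GeneralLinearGroup.upperRightHom a, hΓ _ ?_ ?_ ?_ ?_, rfl⟩ <;>
      simp [Matrix.GeneralLinearGroup.upperRightHom, ha]
  have hgen : Submodule.IsPrincipal.generator (cuspIdeal Γ) ≠ 0 := by
    rw [Ne, ← Submodule.IsPrincipal.eq_bot_iff_generator_eq_zero]
    intro hbot
    rw [hbot] at hmem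
    exact hn0 hmem
  rw [cuspGen]
  exact mul_ne_zero hgen (C_ne_zero.2 (inv_ne_zero (leadingCoeff_ne_zero.2 hgen)))

theorem map_quotient_eq_one_iff (n : F[X]) (δ : GL (Fin 2) F[X]) :
    Matrix.GeneralLinearGroup.map (Ideal.Quotient.mk (Ideal.span {n})) δ = 1 ↔
      n ∣ δ.val 0 0 - 1 ∧ n ∣ δ.val 1 1 - 1 ∧ n ∣ δ.val 0 1 ∧ n ∣ δ.val 1 0 := by
  simp only [← Ideal.mem_span_singleton (y := n), ← Ideal.Quotient.eq_zero_iff_mem, map_sub,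
    map_one, sub_eq_zero]
  refine ⟨fun h => ?_, fun ⟨h1, h2, h3, h4⟩ => ?_⟩
  · have h' : ∀ i j,
        (Matrix.GeneralLinearGroup.map (Ideal.Quotient.mk (Ideal.span {n})) δ).val i j =
        (1 : GL (Fin 2) (F[X] ⧸ Ideal.span {n})).val i j := fun i j => by rw [h]
    exact ⟨by simpa using h' 0 0, by simpa using h' 1 1, by simpa using h' 0 1,
      by simpa using h' 1 0⟩
  · refine Units.ext (Matrix.ext fun i j => ?_)
    fin_cases i <;> fin_cases j <;> simp [h1, h2, h3, h4]

theorem IsCongruenceSubgroup.conjSubgroup {Γ : Subgroup (GL (Fin 2) F[X])}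
    (h : IsCongruenceSubgroup Γ) (γ : GL (Fin 2) F[X]) :
    IsCongruenceSubgroup (conjSubgroup Γ γ) := by
  obtain ⟨n, hn, hΓ⟩ := h
  refine ⟨n, hn, fun δ h00 h11 h01 h10 => ⟨γ * δ * γ⁻¹, ?_, by simp [mul_assoc]⟩⟩
  -- The principal congruence subgroup is the kernel of reduction modulo `n`, hence normal, so the
  -- same `n` works for the conjugate.
  have h1 := (map_quotient_eq_one_iff n δ).2 ⟨h00, h11, h01, h10⟩
  obtain ⟨h2, h3, h4, h5⟩ := (map_quotient_eq_one_iff n (γ * δ * γ⁻¹)).1 (by simp [h1])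
  exact hΓ _ h2 h3 h4 h5

end DrinfeldMS

namespace DrinfeldMS

variable {F : Type*} [Field F] [Fintype F]
variable {ψ : SigmaExtension F} {M : NrExtension F} {ρ : Cinf F}

/-! ### The Maass-Shimura operator on nearly holomorphic forms -/

/-- The coefficients of the `u_N`-expansions of the coefficients of `δ_k^r G`. -/
def msUCoeff (N : F[X]) (k r s : ℕ) (a : ℕ → ℕ → Cinf F) (t l : ℕ) : Cinf F :=
  ∑ i ∈ Finset.range (s + 1), ∑ j ∈ Finset.range (r + 1),
    (if i + j = t then ((Ring.choose ((k : ℤ) - i + r - 1) j : ℤ) : Cinf F) else 0) *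
      uDelCoeff N (r - j) (a i) l

theorem msUCoeff_mem {L : Subfield (Cinf F)} (hL : ∀ x : RatFunc F, ofK F x ∈ L) (N : F[X])
    (k r s : ℕ) {a : ℕ → ℕ → Cinf F} (ha : ∀ i ≤ s, ∀ l, a i l ∈ L) (t l : ℕ) :
    msUCoeff N k r s a t l ∈ L := by
  refine sum_mem fun i hi => sum_mem fun j _ => mul_mem ?_
    (uDelCoeff_mem hL N _ (ha i (Nat.lt_succ_iff.1 (Finset.mem_range.1 hi))) l)
  split_ifs
  · exact intCast_mem L _
  · exact zero_mem L

/-- Only agreement of `f i` with its series near `z` is required. It therefore covers both the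
holomorphic coefficients on $\Omega$ and the series at a cusp taken as the functions themselves. -/
theorem hasSum_msCoeff (hρ : ρ ^ (q F - 1) = -theta F) {N : F[X]} (hN : N ≠ 0) {z : Cinf F}
    (hz : z ∈ Omega F) {s : ℕ} {f : ℕ → Cinf F → Cinf F} {a : ℕ → ℕ → Cinf F}
    (ha : ∀ i ≤ s, Summable fun l => a i l * uParam ρ N z ^ l)
    (hf : ∀ i ≤ s, ∀ᶠ w in 𝓝 z, ∑' l, a i l * uParam ρ N w ^ l = f i w) (k r t : ℕ) :
    HasSum (fun l => msUCoeff N k r s a t l * uParam ρ N z ^ l) (msCoeff ρ k r s f t z) := by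
  simp only [msUCoeff, Finset.sum_mul]
  refine hasSum_sum fun i hi => hasSum_sum fun j _ => ?_
  have hi' : i ≤ s := Nat.lt_succ_iff.1 (Finset.mem_range.1 hi)
  obtain ⟨h1, h2⟩ := analyticAt_and_hasSum_del_of_summable hρ hN hz (ha i hi')
  have h3 := (h2 (r - j)).mul_left
    (if i + j = t then ((Ring.choose ((k : ℤ) - i + r - 1) j : ℤ) : Cinf F) else 0)
  rw [del, hyperderiv_congr (hf i hi') h1] at h3
  simpa only [mul_assoc, del] using h3

theorem eventually_norm_uParam_lt (hρ : ρ ^ (q F - 1) = -theta F) {N : F[X]} (hN : N ≠ 0)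
    {z : Cinf F} (hz : z ∈ Omega F) {ε : ℝ} (h : ‖uParam ρ N z‖ < ε) :
    ∀ᶠ w in 𝓝 z, w ∈ Omega F ∧ ‖uParam ρ N w‖ < ε :=
  (show ∀ᶠ w in 𝓝 z, w ∈ Omega F from Omega_mem_nhds hz).and
    ((analyticAt_uParam hρ hN hz).continuousAt.norm.eventually_lt continuousAt_const h)

theorem HasUExpansionOver.msCoeff (hρ : ρ ^ (q F - 1) = -theta F) {N : F[X]} (hN : N ≠ 0)
    {L : Subfield (Cinf F)} (hL : ∀ x : RatFunc F, ofK F x ∈ L) {s : ℕ}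
    {f : ℕ → Cinf F → Cinf F} (hf : ∀ i ≤ s, HasUExpansionOver ρ N L (f i)) (k r t : ℕ) :
    HasUExpansionOver ρ N L (msCoeff ρ k r s f t) := by
  have hf' : ∀ i, ∃ a : ℕ → Cinf F, ∃ ε : ℝ, 0 < ε ∧ (i ≤ s → (∀ l, a l ∈ L) ∧
      ∀ z ∈ Omega F, ‖uParam ρ N z‖ < ε →
        HasSum (fun l : ℕ => a l * uParam ρ N z ^ l) (f i z)) := by
    intro i
    by_cases hi : i ≤ s
    · obtain ⟨a, ha, ε, hε, h⟩ := hf i hi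
      exact ⟨a, ε, hε, fun _ => ⟨ha, h⟩⟩
    · exact ⟨0, 1, one_pos, fun h => absurd h hi⟩
  choose a ε hε h using hf'
  obtain ⟨η, hη, hηε⟩ : ∃ η : ℝ, 0 < η ∧ ∀ i ≤ s, η ≤ ε i := by
    exact ⟨(Finset.range (s + 1)).inf' Finset.nonempty_range_add_one ε,
      (Finset.lt_inf'_iff _).2 fun i _ => hε i, fun i hi =>
        Finset.inf'_le _ (Finset.mem_range.2 (Nat.lt_succ_iff.2 hi))⟩
  refine ⟨msUCoeff N k r s a t, msUCoeff_mem hL N k r s (fun i hi => (h i hi).1) t, η, hη,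
    fun z hz hzη => hasSum_msCoeff hρ hN hz (fun i hi =>
      ((h i hi).2 z hz (hzη.trans_le (hηε i hi))).summable) (fun i hi => ?_) k r t⟩
  filter_upwards [eventually_norm_uParam_lt hρ hN hz (hzη.trans_le (hηε i hi))] with w hw
  exact ((h i hi).2 w hw.1 hw.2).tsum_eq

theorem maassShimura_mem_nearlyHolomorphicForms (hρ : ρ ^ (q F - 1) = -theta F)
    {L : Subfield (Cinf F)} (hL : ∀ x : RatFunc F, ofK F x ∈ L) {Γ : Subgroup (GL (Fin 2) F[X])}
    (hΓ : IsCongruenceSubgroup Γ) {k s : ℕ} (r : ℕ) {m : ℤ} {G : OmegaPsi ψ M → Cinf F}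
    (hG : G ∈ nearlyHolomorphicForms ρ k m s Γ L) :
    maassShimura ρ k r G ∈ nearlyHolomorphicForms ρ (k + 2 * r) (m + r) (s + r) Γ L := by
  have hπ := carlitzPeriod_ne_zero hρ
  -- Boundedness and rationality are recorded by two expansions `f` and `g`. Each is carried through
  -- `msCoeff` separately.
  obtain ⟨⟨-, hslash, ⟨f, hf, hb⟩, hcusps⟩, g, hg, hgL⟩ := hG
  have hcast : ((k + 2 * r : ℕ) : ℤ) = k + 2 * r := by push_cast; ring
  refine ⟨⟨(hf.maassShimura hπ k r).continuous hπ, fun γ hγ => ?_,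
    ⟨msCoeff ρ k r s f, hf.maassShimura hπ k r, fun t _ =>
      IsBoundedOnVerticalLines.msCoeff hf.1 hb t⟩, fun γ => ?_⟩,
    msCoeff ρ k r s g, hg.maassShimura hπ k r, fun t _ =>
      HasUExpansionOver.msCoeff hρ (cuspGen_ne_zero hΓ) hL hgL k r t⟩
  · rw [hcast, slash_maassShimura hπ hf, hslash γ hγ]
  · obtain ⟨a, ε, hε, ha⟩ := hcusps γ
    have hN := cuspGen_ne_zero (hΓ.conjSubgroup γ)
    set N := cuspGen (conjSubgroup Γ γ)
    refine ⟨msUCoeff N k r s a, ε, hε, fun z hzε => ?_⟩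
    have hz := OmegaPsi_subset_Omega ψ M z.2
    have hsum := fun t => hasSum_msCoeff hρ hN hz (f := fun i w => ∑' l, a i l * uParam ρ N w ^ l)
      (ha z hzε).1 (fun i _ => Eventually.of_forall fun w => rfl) k r t
    refine ⟨fun t _ => (hsum t).summable, ?_⟩
    -- By equivariance it suffices to apply the operator to the slashed form. Near `z` its
    -- $u$-series are analytic coefficients, and by local uniqueness they compute the operator.
    rw [hcast, slash_maassShimura hπ hf, maassShimura_apply hπ (hf.slash hπ k m _)
      (f := fun i w => ∑' l, a i l * uParam ρ N w ^ l)
      (fun i hi => (analyticAt_and_hasSum_del_of_summable hρ hN hz ((ha z hzε).1 i hi)).1) ?_,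
      sum_msTerm_eq_nhSum, nhSum_eq, nhSum_eq]
    · exact Finset.sum_congr rfl fun t _ => by rw [(hsum t).tsum_eq]
    · have h := continuous_subtype_val.continuousAt.eventually
        (eventually_norm_uParam_lt hρ hN hz hzε)
      filter_upwards [h] with w hw
      exact (ha w hw.2).2

theorem hasExpansion_nhTerm (μ : ℕ) {f : Cinf F → Cinf F} (hf : IsHolomorphic f) :
    HasExpansion ρ (nhTerm (ψ := ψ) (M := M) ρ μ f) μ fun i => if i = μ then f else fun _ => 0 := by
  refine ⟨fun i _ => ?_, funext fun z => ?_⟩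
  · dsimp only
    split_ifs
    · exact hf
    · exact isHolomorphic_const 0
  · rw [nhSum, Finset.sum_eq_single μ]
    · rw [if_pos rfl]
    · intro i _ hi
      rw [if_neg hi, nhTerm, zero_div]
    · simp

end DrinfeldMS

end

/-! ### The main theorem -/

open DrinfeldMS in
theorem propositionP {F : Type*} [Field F] [Fintype F]
    (ρ : Cinf F) (hρ : ρ ^ (Fintype.card F - 1) = -theta F)
    (ψ : SigmaExtension F) (M : NrExtension F) :
    (∀ (k r s : ℕ) (f : ℕ → Cinf F → Cinf F), (∀ i ≤ s, IsHolomorphic (f i)) →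
      ∀ z : OmegaPsi ψ M, maassShimura ρ k r (nhSum (ψ := ψ) (M := M) ρ s f) z =
        ∑ i ∈ Finset.range (s + 1), msTerm ρ k r i (f i) z) ∧
    (∀ (γ : GL (Fin 2) (RatFunc F)) (f : Cinf F → Cinf F), IsHolomorphic f →
      ∀ (k μ r : ℕ) (m : ℤ), 2 * μ ≤ k →
        slash (k + 2 * r) (m + r) γ (maassShimura ρ k r (nhTerm (ψ := ψ) (M := M) ρ μ f)) =
          maassShimura ρ k r (slash k m γ (nhTerm (ψ := ψ) (M := M) ρ μ f))) ∧
    (∀ (L : Subfield (Cinf F)), (∀ x : RatFunc F, ofK F x ∈ L) →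
      ∀ Γ : Subgroup (GL (Fin 2) F[X]), IsCongruenceSubgroup Γ →
      ∀ (k r s : ℕ) (m : ℤ) (G : OmegaPsi ψ M → Cinf F),
        G ∈ nearlyHolomorphicForms ρ k m s Γ L →
          maassShimura ρ k r G ∈
            nearlyHolomorphicForms ρ (k + 2 * r) (m + r) (s + r) Γ L) := by
  have hπ := carlitzPeriod_ne_zero hρ
  exact ⟨fun k r s f hf z => maassShimura_eq hπ ⟨hf, rfl⟩ k r z,
    fun γ f hf k μ r m _ => slash_maassShimura hπ (hasExpansion_nhTerm μ hf) k r m γ,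
    fun L hL Γ hΓ k r s m G hG => maassShimura_mem_nearlyHolomorphicForms hρ hL hΓ r hG⟩
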